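/- **Setting.** Fix an integer $k\ge 1$. For a complex Hilbert space $E$ let $\mathcal B(E)$ be the bounded operators with the positive semidefinite order $\le$ on self-adjoint operators, and write $A>0$ if $A\ge\varepsilon I$ for some real $\varepsilon>0$. Put $\Re A=\frac{A+A^*}{2}$, $\Im A=\frac{A-A^*}{2i}$, $$\mathbb P(E)=\{A: A>0\},\qquad \Sigma^k(E)=\{X\in\mathcal B(E)^k:\Re X_i>0\ \forall i\},\qquad \Pi^k(E)=\{X\in\mathcal B(E)^k:\Im X_i>0\ \forall i\},$$ $\Pi=\Pi^1$, and $\mathbb P_{c_1,c_2}(E)=\{A: c_1I\le A\le c_2I\}$. A function given on a set $D(E)\subseteq\mathcal B(E)^k$ for every Hilbert space $E$ is *free* if the sets $D(E)$ are closed under (componentwise) unitary conjugation and direct sums, and the function respects both. A free function $F:\mathbb P^k\to\mathbb P$ is *operator monotone* if $X_i\le Y_i$ for all $i$ implies $F(X)\le F(Y)$, for all $E$ and $X,Y\in\mathbb P(E)^k$; it is *operator concave* if $(1-t)F(X)+tF(Y)\le F((1-t)X+tY)$ for all $E$, all $X,Y\in\mathbb P(E)^k$ and $t\in[0,1]$.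 Let $F:\mathbb P^k\to\mathbb P$ be a free operator monotone function and let $c_2>c_1>0$ be real. For every $n$, every $A\in\mathbb P_{c_1,c_2}(\mathbb C^n)^k$ and every unit vector $v\in\mathbb C^n$ let operators $B_0=B_0(A,v)$ and $B_i=B_i(A,v)$ $(1\le i\le k)$ on $\mathbb C^n$ be chosen such that, with $$L_{A,v}(X)=B_0\otimes I+\sum_{i=1}^kB_i\otimes(X_i-I),$$ 1. $B_i\ge0$ for $1\le i\le k$ and $\sum_{i=1}^kB_i\le B_0$; 2. $L_{A,v}(X)-vv^*\otimes Y\ge0$ for every Hilbert space $K$, every $X\in\mathbb P(K)^k$ and every self-adjoint $Y\in\mathcal B(K)$ with $Y\le F(X)$; 3. $\operatorname{tr}B_0\le F(c_2,\dots,c_2)/\min(1,c_1)$; 4. $F(A)v=(v^*\otimes I)\,\mathcal S_{A,v}(A)\,(v\otimes I)\,v$. Here, for $X\in\mathcal B(E)^k$ and $P=vv^*\otimes I$, $P^\perp=I-P$, $L=L_{A,v}(X)$, $$\mathcal S_{A,v}(X)=PLP-PLP^\perp\,[P^\perp LP^\perp]^{-1}\,P^\perp LP$$ is the Schur complement, $[\,\cdot\,]^{-1}$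 denoting the Moore–Penrose inverse (the Schur complement exists if this inverse exists as a bounded operator). Let $\mathcal H=\bigoplus_{n}\bigoplus_{(A,v)}\mathbb C^n$, the Hilbert space direct sum over all $n$ and all such $(A,v)$, and let $\Psi_F(X)=\bigoplus_{n}\bigoplus_{(A,v)}\mathcal S_{A,v}(X)$, acting on $\mathcal H\otimes E$. For a state $w$ of $\mathcal B(\mathcal H)$ let $w\otimes I:\mathcal B(\mathcal H\otimes E)\to\mathcal B(E)$ be the slice map, $\langle y,(w\otimes I)(T)x\rangle=w(V_y^*TV_x)$ with $V_xh=h\otimes x$. **Proposition 5.6.** Let $w$ be a state of $\mathcal B(\mathcal H)$ such that $F(X)=(w\otimes I)(\Psi_F(X))$ for every finite-dimensional $E$ and every $X\in\mathbb P_{c_1,c_2}(E)^k$. Put $\tilde F(X)=(w\otimes I)(\Psi_F(X))$. Then: * for every Hilbert space $E$ and every $X\in\Sigma^k(E)\cup\Pi^k(E)$ all the Schur complements $\mathcal S_{A,v}(X)$ exist and are uniformly bounded in norm, so that $\tilde F(X)\in\mathcal B(E)$ is defined; * $\tilde F$ is a free function on $\Sigma^k$ and on $\Pi^k$, and for every $E$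 it is analytic on the open set $\Sigma^k(E)\cup\Pi^k(E)$; * $\tilde F$ continues $F$: $\tilde F(X)=F(X)$ for every finite-dimensional $E$ and every $X\in\mathbb P(E)^k$; * for every $E$ and every $X\in\Pi^k(E)$ we have $\Im\tilde F(X)\ge0$, and $\tilde F(X)\in\Pi(E)$ unless $F$ is constant (that is, unless there is a real $c$ with $F(X)=cI$ for all $E$ and all $X\in\mathbb P(E)^k$); * $\tilde F$ maps $\mathbb P(E)^k$ into $\mathbb P(E)$ for every $E$, and it is operator monotone and operator concave on $\mathbb P^k$. -/

import Mathlib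

open scoped TensorProduct ComplexStarModule InnerProductSpace

universe u

noncomputable section

namespace FreeLoewner

/-! ### Operators, order, cones and half-spaces -/

section Cones

variable (k : ℕ) (E : Type u) [NormedAddCommGroup E] [InnerProductSpace ℂ E] [CompleteSpace E]

/-- `A > 0`: the bounded operator `A` is self-adjoint and bounded below by a positive multiple of
the identity (`≤` is the Loewner order; `ε I ≤ A` forces `A` to be self-adjoint). -/
def IsStrictlyPos {E : Type u} [NormedAddCommGroup E] [InnerProductSpace ℂ E] [CompleteSpace E]
    (A : E →L[ℂ] E) : Prop :=
  ∃ ε : ℝ, 0 < ε ∧ (ε : ℂ) • (1 : E →L[ℂ] E) ≤ A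

/-- The `k`-tuples of strictly positive operators on `E`. -/
def posCone : Set (Fin k → E →L[ℂ] E) :=
  {X | ∀ i, IsStrictlyPos (X i)}

/-- The upper operator poly-halfspace: all imaginary parts `(X i - (X i)⋆) / (2i)` are `> 0`. -/
def upperHalf : Set (Fin k → E →L[ℂ] E) :=
  {X | ∀ i, IsStrictlyPos ((ℑ (X i) : selfAdjoint (E →L[ℂ] E)) : E →L[ℂ] E)}

/-- The right operator poly-halfspace: all real parts `(X i + (X i)⋆) / 2` are `> 0`. -/
def rightHalf : Set (Fin k → E →L[ℂ] E) :=
  {X | ∀ i, IsStrictlyPos ((ℜ (X i) : selfAdjoint (E →L[ℂ] E)) : E →L[ℂ] E)}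

/-- The tuples with `c₁ I ≤ X i ≤ c₂ I` for all `i`. -/
def posBox (c₁ c₂ : ℝ) : Set (Fin k → E →L[ℂ] E) :=
  {X | ∀ i, (c₁ : ℂ) • (1 : E →L[ℂ] E) ≤ X i ∧ X i ≤ (c₂ : ℂ) • (1 : E →L[ℂ] E)}

end Cones

/-! ### Graded (free) functions of `k` operators -/

/-- A function of `k` operators, given on every complex Hilbert space `E`. -/
abbrev GradedMap (k : ℕ) : Type (u + 1) :=
  ∀ (E : Type u) [NormedAddCommGroup E] [InnerProductSpace ℂ E] [CompleteSpace E],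
    (Fin k → E →L[ℂ] E) → (E →L[ℂ] E)

/-- A set of `k`-tuples of operators, given on every complex Hilbert space `E`. -/
abbrev GradedSet (k : ℕ) : Type (u + 1) :=
  ∀ (E : Type u) [NormedAddCommGroup E] [InnerProductSpace ℂ E] [CompleteSpace E],
    Set (Fin k → E →L[ℂ] E)

section Basic

variable {E E' : Type u} [NormedAddCommGroup E] [InnerProductSpace ℂ E]
  [NormedAddCommGroup E'] [InnerProductSpace ℂ E']

/-- The operator `U T U⁻¹` on `E'` for a unitary `U : E → E'`. -/
def unitaryConj (U : E ≃ₗᵢ[ℂ] E') (T : E →L[ℂ] E) : E' →L[ℂ] E' :=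
  (U.toContinuousLinearEquiv : E →L[ℂ] E') ∘L T ∘L
    (U.symm.toContinuousLinearEquiv : E' →L[ℂ] E)

/-- The block diagonal operator `S ⊕ T` on the Hilbert space direct sum `E ⊕ E'`. -/
def dirSum (S : E →L[ℂ] E) (T : E' →L[ℂ] E') :
    WithLp 2 (E × E') →L[ℂ] WithLp 2 (E × E') :=
  ((WithLp.prodContinuousLinearEquiv 2 ℂ E E').symm : (E × E') →L[ℂ] WithLp 2 (E × E')) ∘L
    (S.prodMap T) ∘L
    (WithLp.prodContinuousLinearEquiv 2 ℂ E E' : WithLp 2 (E × E') →L[ℂ] (E × E'))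

end Basic

/-- Free (noncommutative) functions on the graded domain `D`: the domain is closed under unitary
conjugation and direct sums, and the function respects both. -/
structure IsFree {k : ℕ} (D : GradedSet.{u} k) (F : GradedMap.{u} k) : Prop where
  unitary_mem : ∀ (E E' : Type u) [NormedAddCommGroup E] [InnerProductSpace ℂ E] [CompleteSpace E]
    [NormedAddCommGroup E'] [InnerProductSpace ℂ E'] [CompleteSpace E']
    (U : E ≃ₗᵢ[ℂ] E') (X : Fin k → E →L[ℂ] E), X ∈ D E →
      (fun i => unitaryConj U (X i)) ∈ D E'
  unitary : ∀ (E E' : Type u) [NormedAddCommGroup E] [InnerProductSpace ℂ E] [CompleteSpace E]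
    [NormedAddCommGroup E'] [InnerProductSpace ℂ E'] [CompleteSpace E']
    (U : E ≃ₗᵢ[ℂ] E') (X : Fin k → E →L[ℂ] E), X ∈ D E →
      F E' (fun i => unitaryConj U (X i)) = unitaryConj U (F E X)
  dirSum_mem : ∀ (E E' : Type u) [NormedAddCommGroup E] [InnerProductSpace ℂ E] [CompleteSpace E]
    [NormedAddCommGroup E'] [InnerProductSpace ℂ E'] [CompleteSpace E']
    (X : Fin k → E →L[ℂ] E) (Y : Fin k → E' →L[ℂ] E'), X ∈ D E → Y ∈ D E' →
      (fun i => dirSum (X i) (Y i)) ∈ D (WithLp 2 (E × E'))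
  dirSum : ∀ (E E' : Type u) [NormedAddCommGroup E] [InnerProductSpace ℂ E] [CompleteSpace E]
    [NormedAddCommGroup E'] [InnerProductSpace ℂ E'] [CompleteSpace E']
    (X : Fin k → E →L[ℂ] E) (Y : Fin k → E' →L[ℂ] E'), X ∈ D E → Y ∈ D E' →
      F (WithLp 2 (E × E')) (fun i => FreeLoewner.dirSum (X i) (Y i)) =
        FreeLoewner.dirSum (F E X) (F E' Y)

/-- `F` maps tuples of strictly positive operators to strictly positive operators. -/
def MapsPosToPos {k : ℕ} (F : GradedMap.{u} k) : Prop :=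
  ∀ (E : Type u) [NormedAddCommGroup E] [InnerProductSpace ℂ E] [CompleteSpace E]
    (X : Fin k → E →L[ℂ] E), X ∈ posCone k E → IsStrictlyPos (F E X)

/-- Operator monotonicity on tuples of strictly positive operators. -/
def IsOperatorMonotone {k : ℕ} (F : GradedMap.{u} k) : Prop :=
  ∀ (E : Type u) [NormedAddCommGroup E] [InnerProductSpace ℂ E] [CompleteSpace E]
    (X Y : Fin k → E →L[ℂ] E), X ∈ posCone k E → Y ∈ posCone k E →
      (∀ i, X i ≤ Y i) → F E X ≤ F E Y

/-- Operator concavity on tuples of strictly positive operators. -/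
def IsOperatorConcave {k : ℕ} (F : GradedMap.{u} k) : Prop :=
  ∀ (E : Type u) [NormedAddCommGroup E] [InnerProductSpace ℂ E] [CompleteSpace E]
    (X Y : Fin k → E →L[ℂ] E), X ∈ posCone k E → Y ∈ posCone k E →
      ∀ t : ℝ, 0 ≤ t → t ≤ 1 →
        ((1 - t : ℝ) : ℂ) • F E X + (t : ℂ) • F E Y ≤
          F E (fun i => ((1 - t : ℝ) : ℂ) • X i + (t : ℂ) • Y i)

/-- `F` is a constant multiple of the identity on tuples of strictly positive operators. -/
def IsConstant {k : ℕ} (F : GradedMap.{u} k) : Prop :=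
  ∃ c : ℝ, ∀ (E : Type u) [NormedAddCommGroup E] [InnerProductSpace ℂ E] [CompleteSpace E]
    (X : Fin k → E →L[ℂ] E), X ∈ posCone k E → F E X = (c : ℂ) • (1 : E →L[ℂ] E)

/-! ### Generalized inverses and Schur complements -/

section Schur

variable {G : Type u} [NormedAddCommGroup G] [InnerProductSpace ℂ G]

/-- `R` is the Moore-Penrose inverse of `T`. If `T` is an invertible operator on a closed subspace,
extended by `0` to the orthogonal complement, then `R` is the inverse on that subspace,
extended by `0`. -/
structure IsMoorePenrose (T R : G →L[ℂ] G) : Prop where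
  left_reg : T * R * T = T
  right_reg : R * T * R = R
  left_symm : ((T * R : G →L[ℂ] G) : G →ₗ[ℂ] G).IsSymmetric
  right_symm : ((R * T : G →L[ℂ] G) : G →ₗ[ℂ] G).IsSymmetric

/-- Moore-Penrose inverses are unique. -/
theorem IsMoorePenrose.unique {T R S : G →L[ℂ] G} (hR : IsMoorePenrose T R)
    (hS : IsMoorePenrose T S) : R = S := by
  have key1 : T * R = T * S := by
    have h1 : (T * R) * (T * S) = T * S := by rw [← mul_assoc, hR.left_reg]
    have h2 : (T * S) * (T * R) = T * R := by rw [← mul_assoc, hS.left_reg]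
    refine ContinuousLinearMap.ext fun x => ext_inner_right ℂ fun y => ?_
    calc ⟪(T * R) x, y⟫_ℂ = ⟪(T * S) ((T * R) x), y⟫_ℂ :=
          congrArg (fun z => ⟪z, y⟫_ℂ) (DFunLike.congr_fun h2 x).symm
      _ = ⟪(T * R) x, (T * S) y⟫_ℂ := hS.left_symm _ _
      _ = ⟪x, (T * R) ((T * S) y)⟫_ℂ := hR.left_symm _ _
      _ = ⟪x, (T * S) y⟫_ℂ := congrArg (fun z => ⟪x, z⟫_ℂ) (DFunLike.congr_fun h1 y)
      _ = ⟪(T * S) x, y⟫_ℂ := (hS.left_symm _ _).symm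
  have key2 : R * T = S * T := by
    have h1 : (R * T) * (S * T) = R * T := by rw [mul_assoc, ← mul_assoc T, hS.left_reg]
    have h2 : (S * T) * (R * T) = S * T := by rw [mul_assoc, ← mul_assoc T, hR.left_reg]
    refine ContinuousLinearMap.ext fun x => ext_inner_right ℂ fun y => ?_
    calc ⟪(R * T) x, y⟫_ℂ = ⟪(R * T) ((S * T) x), y⟫_ℂ :=
          congrArg (fun z => ⟪z, y⟫_ℂ) (DFunLike.congr_fun h1 x).symm
      _ = ⟪(S * T) x, (R * T) y⟫_ℂ := hR.right_symm _ _
      _ = ⟪x, (S * T) ((R * T) y)⟫_ℂ := hS.right_symm _ _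
      _ = ⟪x, (S * T) y⟫_ℂ := congrArg (fun z => ⟪x, z⟫_ℂ) (DFunLike.congr_fun h2 y)
      _ = ⟪(S * T) x, y⟫_ℂ := (hS.right_symm _ _).symm
  calc R = R * T * R := hR.right_reg.symm
    _ = S * T * R := by rw [key2]
    _ = S * (T * R) := mul_assoc _ _ _
    _ = S * (T * S) := by rw [key1]
    _ = S := by rw [← mul_assoc, hS.right_reg]

open Classical in
/-- The Moore-Penrose inverse of `T`; the value is `0` if there is none. -/
def pinv (T : G →L[ℂ] G) : G →L[ℂ] G :=
  if h : ∃ R, IsMoorePenrose T R then h.choose else 0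

/-- The block of `L` that has to be inverted in the Schur complement pivoting on the range of the
orthogonal projection `P`. -/
def pivotBlock (P L : G →L[ℂ] G) : G →L[ℂ] G := (1 - P) * L * (1 - P)

/-- The Schur complement of `L` pivoting on the range of `P` exists. -/
def SchurExists (P L : G →L[ℂ] G) : Prop := ∃ R, IsMoorePenrose (pivotBlock P L) R

/-- The Schur complement `L₁₁ - L₁₂ L₂₂⁻¹ L₂₁` of `L`, with `L₁₁ = P L P`, `L₁₂ = P L (1 - P)`,
`L₂₁ = (1 - P) L P` and `L₂₂ = (1 - P) L (1 - P)`. -/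
def schur (P L : G →L[ℂ] G) : G →L[ℂ] G :=
  P * L * P - (P * L * (1 - P)) * pinv (pivotBlock P L) * ((1 - P) * L * P)

end Schur

/-! ### The linear pencils and the direct sum of their Schur complements -/

/-- The Hilbert space `ℂⁿ` (in the universe `u`). -/
abbrev FinSpace (n : ℕ) : Type u := EuclideanSpace ℂ (ULift.{u} (Fin n))

/-- The index set of the direct sum: a dimension `n`, a tuple `A` of operators on `ℂⁿ` with
`c₁ I ≤ A i ≤ c₂ I`, and a unit vector `v` of `ℂⁿ`. -/
structure PencilIndex (k : ℕ) (c₁ c₂ : ℝ) : Type u where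
  n : ℕ
  A : Fin k → FinSpace.{u} n →L[ℂ] FinSpace.{u} n
  A_mem : A ∈ posBox k (FinSpace.{u} n) c₁ c₂
  v : FinSpace.{u} n
  norm_v : ‖v‖ = 1

/-- The coefficients `B₀(A, v), B₁(A, v), …, B_k(A, v)` of a linear pencil for each `(A, v)`. -/
structure PencilFamily (k : ℕ) (c₁ c₂ : ℝ) : Type u where
  B₀ : ∀ ω : PencilIndex.{u} k c₁ c₂, FinSpace.{u} ω.n →L[ℂ] FinSpace.{u} ω.n
  B : ∀ ω : PencilIndex.{u} k c₁ c₂, Fin k → FinSpace.{u} ω.n →L[ℂ] FinSpace.{u} ω.n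

section Pencil

variable {k : ℕ} {c₁ c₂ : ℝ}

/-- The rank one projection `v v⋆` on `ℂⁿ`. -/
def PencilIndex.proj (ω : PencilIndex.{u} k c₁ c₂) : FinSpace.{u} ω.n →L[ℂ] FinSpace.{u} ω.n :=
  InnerProductSpace.rankOne ℂ ω.v ω.v

/-- The projection `v v⋆ ⊗ I` on `ℂⁿ ⊗ E`. -/
def PencilIndex.tensorProj (ω : PencilIndex.{u} k c₁ c₂) (E : Type u) [NormedAddCommGroup E]
    [InnerProductSpace ℂ E] : FinSpace.{u} ω.n ⊗[ℂ] E →L[ℂ] FinSpace.{u} ω.n ⊗[ℂ] E :=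
  TensorProduct.mapL ω.proj (1 : E →L[ℂ] E)

namespace PencilFamily

variable (𝓑 : PencilFamily.{u} k c₁ c₂)
variable (E : Type u) [NormedAddCommGroup E] [InnerProductSpace ℂ E]

/-- The pencil `B₀(A, v) ⊗ I + ∑ᵢ Bᵢ(A, v) ⊗ (Xᵢ - I)` on `ℂⁿ ⊗ E`. -/
def pencil (ω : PencilIndex.{u} k c₁ c₂) (X : Fin k → E →L[ℂ] E) :
    FinSpace.{u} ω.n ⊗[ℂ] E →L[ℂ] FinSpace.{u} ω.n ⊗[ℂ] E :=
  TensorProduct.mapL (𝓑.B₀ ω) (1 : E →L[ℂ] E) +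
    ∑ i, TensorProduct.mapL (𝓑.B ω i) (X i - 1)

/-- The Schur complement of the pencil for `(A, v)`, pivoting on `ℂ v ⊗ E`. -/
def block (ω : PencilIndex.{u} k c₁ c₂) (X : Fin k → E →L[ℂ] E) :
    FinSpace.{u} ω.n ⊗[ℂ] E →L[ℂ] FinSpace.{u} ω.n ⊗[ℂ] E :=
  schur (ω.tensorProj E) (𝓑.pencil E ω X)

end PencilFamily

/-- The family consists of supporting linear pencils of the hypograph of `F`, with the trace bound
for the box given by `c₁, c₂`, and it reconstructs the values `F(A) v`. -/
structure PencilFamily.Supports (𝓑 : PencilFamily.{u} k c₁ c₂) (F : GradedMap.{u} k) : Prop where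
  nonneg : ∀ ω i, 0 ≤ 𝓑.B ω i
  sum_le : ∀ ω, ∑ i, 𝓑.B ω i ≤ 𝓑.B₀ ω
  /-- `B₀ ⊗ I - v v⋆ ⊗ Y + ∑ᵢ Bᵢ ⊗ (Xᵢ - I) ≥ 0` whenever `Y ≤ F(X)`. -/
  pencil_nonneg : ∀ (ω : PencilIndex.{u} k c₁ c₂) (K : Type u) [NormedAddCommGroup K]
    [InnerProductSpace ℂ K] [CompleteSpace K] (X : Fin k → K →L[ℂ] K) (Y : K →L[ℂ] K),
    X ∈ posCone k K → IsSelfAdjoint Y → Y ≤ F K X →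
      0 ≤ 𝓑.pencil K ω X - TensorProduct.mapL ω.proj Y
  /-- `tr B₀ ≤ F(c₂, …, c₂) / min(1, c₁)`; the positive number `F(c₂, …, c₂)` is the norm of the
  operator `F(c₂ I, …, c₂ I)` on the one-dimensional space. -/
  trace_le : ∀ ω, (LinearMap.trace ℂ (FinSpace.{u} ω.n) (𝓑.B₀ ω)).re ≤
    ‖F (FinSpace.{u} 1) (fun _ => (c₂ : ℂ) • (1 : FinSpace.{u} 1 →L[ℂ] FinSpace.{u} 1))‖ / min 1 c₁
  /-- `F(A) v = (v⋆ ⊗ I) S (v ⊗ I) v`, where `S` is the Schur complement of the pencil at `A`. -/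
  reconstruct : ∀ (ω : PencilIndex.{u} k c₁ c₂) (x : FinSpace.{u} ω.n),
    ⟪ω.v ⊗ₜ[ℂ] x, 𝓑.block (FinSpace.{u} ω.n) ω ω.A (ω.v ⊗ₜ[ℂ] ω.v)⟫_ℂ =
      ⟪x, F (FinSpace.{u} ω.n) ω.A ω.v⟫_ℂ

variable (k c₁ c₂)

/-- The Hilbert space `𝓗 = ⨁ ℂⁿ`, the sum over all indices `(n, A, v)`. -/
abbrev BigSpace : Type u := lp (fun ω : PencilIndex.{u} k c₁ c₂ => FinSpace.{u} ω.n) 2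

/-- The Hilbert space `𝓗 ⊗ E`, written as `⨁ (ℂⁿ ⊗ E)`. -/
abbrev BigTensor (E : Type u) [NormedAddCommGroup E] [InnerProductSpace ℂ E] : Type u :=
  lp (fun ω : PencilIndex.{u} k c₁ c₂ => FinSpace.{u} ω.n ⊗[ℂ] E) 2

variable {k c₁ c₂}

open Classical in
/-- The direct sum of a uniformly bounded family of operators on the spaces `ℂⁿ ⊗ E`; the value is
`0` if the family is not uniformly bounded. -/
def bigDirSum {E : Type u} [NormedAddCommGroup E] [InnerProductSpace ℂ E]
    (T : ∀ ω : PencilIndex.{u} k c₁ c₂,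
      FinSpace.{u} ω.n ⊗[ℂ] E →L[ℂ] FinSpace.{u} ω.n ⊗[ℂ] E) :
    BigTensor.{u} k c₁ c₂ E →L[ℂ] BigTensor.{u} k c₁ c₂ E :=
  if h : ∃ K : ℝ, 0 ≤ K ∧ ∀ ω, ‖T ω‖ ≤ K then
    lp.mapCLM 2 T h.choose_spec.1 h.choose_spec.2
  else 0

/-- `Ψ(X)`: the direct sum over all `(A, v)` of the Schur complements of the pencils at `X`. -/
def PencilFamily.Psi (𝓑 : PencilFamily.{u} k c₁ c₂) (E : Type u) [NormedAddCommGroup E]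
    [InnerProductSpace ℂ E] (X : Fin k → E →L[ℂ] E) :
    BigTensor.{u} k c₁ c₂ E →L[ℂ] BigTensor.{u} k c₁ c₂ E :=
  bigDirSum fun ω => 𝓑.block E ω X

/-! ### States on `B(𝓗)` and the slice maps `w ⊗ I` -/

/-- States of the C⋆-algebra `B(𝓗)` (not necessarily normal). -/
structure IsState (w : (BigSpace.{u} k c₁ c₂ →L[ℂ] BigSpace.{u} k c₁ c₂) →L[ℂ] ℂ) : Prop where
  nonneg : ∀ T : BigSpace.{u} k c₁ c₂ →L[ℂ] BigSpace.{u} k c₁ c₂, 0 ≤ T →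
    0 ≤ (w T).re ∧ (w T).im = 0
  map_one : w 1 = 1

section Slice

variable {E : Type u} [NormedAddCommGroup E] [InnerProductSpace ℂ E]

/-- The map `h ↦ h ⊗ x` from `ℂⁿ` to `ℂⁿ ⊗ E`. -/
def insertFin (n : ℕ) (x : E) : FinSpace.{u} n →L[ℂ] FinSpace.{u} n ⊗[ℂ] E :=
  (TensorProduct.mkL ℂ (FinSpace.{u} n) E).flip x

theorem insertFin_apply (n : ℕ) (x : E) (h : FinSpace.{u} n) : insertFin n x h = h ⊗ₜ[ℂ] x := rfl

theorem norm_insertFin_le (n : ℕ) (x : E) : ‖insertFin.{u} n x‖ ≤ ‖x‖ :=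
  ContinuousLinearMap.opNorm_le_bound _ (norm_nonneg x) fun h => by
    rw [insertFin_apply, TensorProduct.norm_tmul, mul_comm]

/-- The map `h ⊗ x ↦ ⟪y, x⟫ h` from `ℂⁿ ⊗ E` to `ℂⁿ`. -/
def contractFin (n : ℕ) (y : E) : FinSpace.{u} n ⊗[ℂ] E →L[ℂ] FinSpace.{u} n :=
  ((TensorProduct.ridIsometry ℂ (FinSpace.{u} n)).toContinuousLinearEquiv :
    FinSpace.{u} n ⊗[ℂ] ℂ →L[ℂ] FinSpace.{u} n) ∘L
      ContinuousLinearMap.lTensor (FinSpace.{u} n) (innerSL ℂ y)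

theorem contractFin_tmul (n : ℕ) (y x : E) (h : FinSpace.{u} n) :
    contractFin n y (h ⊗ₜ[ℂ] x) = ⟪y, x⟫_ℂ • h := by
  simp [contractFin]

theorem norm_contractFin_le (n : ℕ) (y : E) : ‖contractFin.{u} n y‖ ≤ ‖y‖ := by
  refine ContinuousLinearMap.opNorm_le_bound _ (norm_nonneg y) fun z => ?_
  have h1 : ‖contractFin n y z‖ =
      ‖ContinuousLinearMap.lTensor (FinSpace.{u} n) (innerSL ℂ y) z‖ :=
    (TensorProduct.ridIsometry ℂ (FinSpace.{u} n)).norm_map _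
  rw [h1]
  refine (ContinuousLinearMap.le_opNorm _ _).trans ?_
  gcongr
  exact (ContinuousLinearMap.norm_lTensor_le _ (innerSL ℂ y)).trans (innerSL_apply_norm ℂ y).le

theorem contractFin_add (n : ℕ) (y y' : E) :
    contractFin.{u} n (y + y') = contractFin n y + contractFin n y' := by
  simp [contractFin]

theorem contractFin_smul (n : ℕ) (c : ℂ) (y : E) :
    contractFin.{u} n (c • y) = (starRingEnd ℂ c) • contractFin n y := by
  simp [contractFin]

variable (k c₁ c₂)

/-- The map `h ↦ h ⊗ x` from `𝓗` to `𝓗 ⊗ E`. -/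
def insertVec (x : E) : BigSpace.{u} k c₁ c₂ →L[ℂ] BigTensor.{u} k c₁ c₂ E :=
  lp.mapCLM 2 (fun ω : PencilIndex.{u} k c₁ c₂ => insertFin ω.n x) (norm_nonneg x)
    fun ω => norm_insertFin_le ω.n x

/-- The map `h ⊗ x ↦ ⟪y, x⟫ h` from `𝓗 ⊗ E` to `𝓗`, the adjoint of `h ↦ h ⊗ y`. -/
def contractVec (y : E) : BigTensor.{u} k c₁ c₂ E →L[ℂ] BigSpace.{u} k c₁ c₂ :=
  lp.mapCLM 2 (fun ω : PencilIndex.{u} k c₁ c₂ => contractFin ω.n y) (norm_nonneg y)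
    fun ω => norm_contractFin_le ω.n y

variable {k c₁ c₂}

theorem insertVec_apply (x : E) (h : BigSpace.{u} k c₁ c₂) (ω : PencilIndex.{u} k c₁ c₂) :
    insertVec k c₁ c₂ x h ω = h ω ⊗ₜ[ℂ] x := rfl

theorem contractVec_apply (y : E) (h : BigTensor.{u} k c₁ c₂ E) (ω : PencilIndex.{u} k c₁ c₂) :
    contractVec k c₁ c₂ y h ω = contractFin ω.n y (h ω) := rfl

/-- The sesquilinear form `(y, x) ↦ w (V_y⋆ T V_x)` with `V_x h = h ⊗ x`. -/
def sliceForm (w : (BigSpace.{u} k c₁ c₂ →L[ℂ] BigSpace.{u} k c₁ c₂) →L[ℂ] ℂ)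
    (T : BigTensor.{u} k c₁ c₂ E →L[ℂ] BigTensor.{u} k c₁ c₂ E) : E →L⋆[ℂ] E →L[ℂ] ℂ :=
  LinearMap.mkContinuous₂
    (LinearMap.mk₂'ₛₗ (starRingEnd ℂ) (RingHom.id ℂ)
      (fun y x : E => w (contractVec k c₁ c₂ y ∘L T ∘L insertVec k c₁ c₂ x))
      (fun y y' x => by
        rw [← map_add]; congr 1; ext h ω : 3
        simp [contractVec_apply, contractFin_add])
      (fun c y x => by
        rw [smul_eq_mul, ← smul_eq_mul, ← map_smul]; congr 1; ext h ω : 3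
        simp [contractVec_apply, contractFin_smul])
      (fun y x x' => by
        rw [← map_add]; congr 1; ext h : 1
        have : insertVec k c₁ c₂ (x + x') h = insertVec k c₁ c₂ x h + insertVec k c₁ c₂ x' h := by
          ext ω : 2
          simp [insertVec_apply, TensorProduct.tmul_add]
        simp [this])
      (fun c y x => by
        rw [RingHom.id_apply, ← map_smul]; congr 1; ext h : 1
        have : insertVec k c₁ c₂ (c • x) h = c • insertVec k c₁ c₂ x h := by
          ext ω : 2
          simp [insertVec_apply]
        simp [this]))
    (‖w‖ * ‖T‖)
    (fun y x => by
      rw [LinearMap.mk₂'ₛₗ_apply]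
      have h1 : ‖contractVec k c₁ c₂ y‖ ≤ ‖y‖ := lp.norm_mapCLM_le _ _ _ _
      have h2 : ‖insertVec k c₁ c₂ x‖ ≤ ‖x‖ := lp.norm_mapCLM_le _ _ _ _
      calc ‖w (contractVec k c₁ c₂ y ∘L T ∘L insertVec k c₁ c₂ x)‖
          ≤ ‖w‖ * ‖contractVec k c₁ c₂ y ∘L T ∘L insertVec k c₁ c₂ x‖ := w.le_opNorm _
        _ ≤ ‖w‖ * (‖contractVec k c₁ c₂ y‖ * (‖T‖ * ‖insertVec k c₁ c₂ x‖)) := by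
            gcongr
            refine (ContinuousLinearMap.opNorm_comp_le _ _).trans ?_
            gcongr
            exact ContinuousLinearMap.opNorm_comp_le _ _
        _ ≤ ‖w‖ * (‖y‖ * (‖T‖ * ‖x‖)) := by gcongr
        _ = ‖w‖ * ‖T‖ * ‖y‖ * ‖x‖ := by ring)

/-- The slice map `(w ⊗ I) : B(𝓗 ⊗ E) → B(E)`, given by
`⟪y, (w ⊗ I)(T) x⟫ = w (V_y⋆ T V_x)` with `V_x h = h ⊗ x`. -/
def slice [CompleteSpace E] (w : (BigSpace.{u} k c₁ c₂ →L[ℂ] BigSpace.{u} k c₁ c₂) →L[ℂ] ℂ)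
    (T : BigTensor.{u} k c₁ c₂ E →L[ℂ] BigTensor.{u} k c₁ c₂ E) : E →L[ℂ] E :=
  ContinuousLinearMap.adjoint (InnerProductSpace.continuousLinearMapOfBilin (sliceForm w T))

theorem inner_slice [CompleteSpace E]
    (w : (BigSpace.{u} k c₁ c₂ →L[ℂ] BigSpace.{u} k c₁ c₂) →L[ℂ] ℂ)
    (T : BigTensor.{u} k c₁ c₂ E →L[ℂ] BigTensor.{u} k c₁ c₂ E) (x y : E) :
    ⟪y, slice w T x⟫_ℂ = w (contractVec k c₁ c₂ y ∘L T ∘L insertVec k c₁ c₂ x) := by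
  rw [slice, ContinuousLinearMap.adjoint_inner_right,
    InnerProductSpace.continuousLinearMapOfBilin_apply]
  rfl

end Slice

/-- The function `X ↦ (w ⊗ I)(Ψ(X))`. -/
def PencilFamily.sliceFun (𝓑 : PencilFamily.{u} k c₁ c₂)
    (w : (BigSpace.{u} k c₁ c₂ →L[ℂ] BigSpace.{u} k c₁ c₂) →L[ℂ] ℂ) : GradedMap.{u} k :=
  fun E _ _ _ X => slice w (𝓑.Psi E X)

/-- `Ψ(X)` is defined as a bounded operator: the Schur complements exist and are uniformly
bounded. -/
def PencilFamily.PsiExists (𝓑 : PencilFamily.{u} k c₁ c₂) (E : Type u) [NormedAddCommGroup E]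
    [InnerProductSpace ℂ E] (X : Fin k → E →L[ℂ] E) : Prop :=
  (∀ ω, SchurExists (ω.tensorProj E) (𝓑.pencil E ω X)) ∧ ∃ K : ℝ, ∀ ω, ‖𝓑.block E ω X‖ ≤ K

end Pencil

end FreeLoewner

end

/-!
The pencils are first put into a normalised form. With `G = √B₀` one has
`L(X) = (G ⊗ I) Λ(X) (G ⊗ I)`, where `Λ(X) = s₀⋆ s₀ ⊗ I + ∑ sᵢ⋆ sᵢ ⊗ Xᵢ` and the coefficients
`s₀⋆ s₀, sᵢ⋆ sᵢ` add up to the identity (`PencilFamily.Supports.nonempty_realization`). The Schur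
complement of `L(X)` is a compression of `Λ(X)` shorted by the range of a projection `p ⊗ I` that
does not depend on `X` (`schur_eq`). If for some complex number `c` the operators `c I` and `c Xᵢ`
have real part at least `δ > 0`, then so has `c Λ(X)`, and the block of `Λ(X)` to be inverted has an
inverse bounded by `|c| / δ`, uniformly in the pencil. Such a `c` exists on both poly-halfspaces:
`c = 1` on the right one, and `c = a - i` with a small `a > 0` on the upper one
(`exists_accretiveTuple`). The trace condition bounds `G`. This gives the existence of the Schur
complements, their uniform boundedness, the analyticity of their direct sum, and the compatibility
with intertwiners, which yields freeness.

For `Λ ≥ 0` the quadratic form of the shorted operator at `η` is the minimum of `⟪θ, Λ θ⟫` over the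
vectors `θ` that differ from `η` by a vector in the range of the projection. A minimum of affine
monotone functions is monotone and concave, and the slice map preserves this. For accretive `Λ` the
form still is `⟪θ, Λ θ⟫` for a suitable `θ`, hence its imaginary part is nonnegative on the upper
poly-halfspace; comparing the vectors `θ` at two points gives a Harnack inequality between the
imaginary parts, uniform in the pencil (`Realization.exists_im_inner_sh_le`). It reduces strict
positivity to the scalar function `z ↦ F̃(z I)`: if its imaginary part vanishes at `i`, then it
vanishes on the upper half-plane, the function is constant by the open mapping theorem, and `F`,
being monotone and constant at the positive scalars, is constant.

The values of `F` and `F̃` agree on the box, so near an inner point of it. The set of points of the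
positive cone near which they agree is open, and the cone is connected; that the set is closed
rests on a local comparison (`re_inner_le_of_eqOn`). Let the monotone map `F` agree with a
holomorphic function near `X`, let `Y` be close to `X` compared with the domain of this function,
and put `g(t) = ⟪x, F(X + t (Y - X)) x⟫`, which for small `t` is the real part of a holomorphic
function `φ`. There are a positive contraction `T` of `ℂⁿ⁺¹`, with eigenvalue `1` and all other
eigenvalues in a small interval `[0, r]`, and unit vectors `η`, `w` such that the spectral measure
at `w` of the compression of `T` to `η^⊥` lives on `[0, r]` and has the same moments up to order
`2 n - 1` as that of `T`, as in Gauss quadrature (`KrylovModel`). The operator `X + T (Y - X)` on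
`ℂⁿ⁺¹ ⊗ E` is at most its compressed version plus an arbitrarily small multiple of the identity on
`η^⊥ ⊗ E` (`segOp_le_segCompr`), so monotonicity makes the integral of `g` for `T` at most that for
the compression (`KrylovModel.sum_le`). In this inequality `φ` contributes only a Taylor remainder,
and what is left is the difference `g(1) - Re φ(1)`, weighted with the mass of the atom at `1`. That
mass decays more slowly than the remainder, so `F(Y) ≤ F̃(Y)` in the limit. The reverse inequality
follows by applying this to the monotone map `X ↦ F(X⁻¹)⁻¹` (`invDual`).
-/

noncomputable section

namespace FreeLoewner

open Filter Topology ContinuousLinearMap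

variable {k : ℕ} {c₁ c₂ : ℝ}

/-! ### Accretive operators and shorted operators -/

section Short

variable {H : Type*} [NormedAddCommGroup H] [InnerProductSpace ℂ H]

/-- The real part of the numerical range of `c T` is bounded below by `δ`. -/
def AccretiveBound (c : ℂ) (δ : ℝ) (T : H →L[ℂ] H) : Prop :=
  ∀ x, δ * ‖x‖ ^ 2 ≤ (c * ⟪x, T x⟫_ℂ).re

theorem AccretiveBound.le_norm_apply {c : ℂ} {δ : ℝ} {T : H →L[ℂ] H}
    (h : AccretiveBound c δ T) (x : H) : δ * ‖x‖ ≤ ‖c‖ * ‖T x‖ := by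
  rcases eq_or_ne x 0 with rfl | hx
  · simp
  have hx' : 0 < ‖x‖ := norm_pos_iff.2 hx
  have h1 : δ * ‖x‖ ^ 2 ≤ ‖c‖ * (‖x‖ * ‖T x‖) :=
    (h x).trans <| (Complex.re_le_norm _).trans <| by
      rw [norm_mul]; gcongr; exact norm_inner_le_norm _ _
  nlinarith

/-- The compression of `Λ` to the range of `p`, extended by the identity. -/
def pivot (p Λ : H →L[ℂ] H) : H →L[ℂ] H := p * Λ * p + (1 - p)

/-- The inverse of the compression of `Λ` to the range of `p`, extended by `0`. It is `0` if the
compression is not invertible. -/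
def compInv (p Λ : H →L[ℂ] H) : H →L[ℂ] H := Ring.inverse (pivot p Λ) * p

/-- The operator `Λ` shorted by the range of `p`, that is, its Schur complement pivoting on the
kernel of the orthogonal projection `p`. -/
def short (p Λ : H →L[ℂ] H) : H →L[ℂ] H := Λ - Λ * compInv p Λ * Λ

/-- The vector `(1 - K Λ) η`: it differs from `η` by an element of the range of `p`, and `Λ` maps
it to a vector orthogonal to that range. -/
def shortVec (p Λ : H →L[ℂ] H) (η : H) : H := η - compInv p Λ (Λ η)

theorem short_apply (p Λ : H →L[ℂ] H) (η : H) : short p Λ η = Λ (shortVec p Λ η) := by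
  simp [short, shortVec]

/-- An operator intertwining the data intertwines the shorted operators. -/
theorem short_intertwine {H' : Type*} [NormedAddCommGroup H'] [InnerProductSpace ℂ H']
    {p Λ : H →L[ℂ] H} {p' Λ' : H' →L[ℂ] H'} {J : H →L[ℂ] H'} (hN : IsUnit (pivot p Λ))
    (hN' : IsUnit (pivot p' Λ')) (h1 : p' ∘L J = J ∘L p) (h2 : Λ' ∘L J = J ∘L Λ) :
    short p' Λ' ∘L J = J ∘L short p Λ := by
  have e1 : ∀ x, p' (J x) = J (p x) := fun x => DFunLike.congr_fun h1 x
  have e2 : ∀ x, Λ' (J x) = J (Λ x) := fun x => DFunLike.congr_fun h2 x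
  have e3 : ∀ x, pivot p' Λ' (J x) = J (pivot p Λ x) := fun x => by simp [pivot, e1, e2]
  have e4 : ∀ x, Ring.inverse (pivot p' Λ') (J x) = J (Ring.inverse (pivot p Λ) x) := fun x => by
    have a : pivot p Λ (Ring.inverse (pivot p Λ) x) = x :=
      DFunLike.congr_fun (Ring.mul_inverse_cancel _ hN) x
    have b : ∀ y, Ring.inverse (pivot p' Λ') (pivot p' Λ' y) = y := fun y =>
      DFunLike.congr_fun (Ring.inverse_mul_cancel _ hN') y
    conv_lhs => rw [← a, ← e3, b]
  ext x
  simp [short, compInv, e1, e2, e4]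

variable [CompleteSpace H]

/-- The Lax-Milgram theorem. -/
theorem AccretiveBound.isUnit {c : ℂ} {δ : ℝ} {T : H →L[ℂ] H} (hδ : 0 < δ)
    (h : AccretiveBound c δ T) : IsUnit T := by
  have hu : IsUnit (c • T) := by
    refine isUnit_of_forall_le_norm_inner_map _ (c := ⟨δ, hδ.le⟩) hδ fun x => ?_
    have h1 := (h x).trans (Complex.re_le_norm _)
    rw [← norm_inner_symm]
    change ‖x‖ ^ 2 * δ ≤ _
    simpa [inner_smul_right, mul_comm] using h1
  rcases subsingleton_or_nontrivial H with hH | hH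
  · exact ⟨1, Subsingleton.elim _ _⟩
  have hc : c ≠ 0 := by
    rintro rfl
    obtain ⟨x, hx⟩ := exists_ne (0 : H)
    have := h x
    have hx' : 0 < ‖x‖ := norm_pos_iff.2 hx
    simp only [zero_mul, Complex.zero_re] at this
    have : 0 < δ * ‖x‖ ^ 2 := by positivity
    linarith
  have := (IsUnit.mk0 c hc).map (algebraMap ℂ (H →L[ℂ] H))
  rw [Algebra.smul_def] at hu
  have h2 := this.unit⁻¹.isUnit.mul hu
  rwa [← mul_assoc, IsUnit.val_inv_mul, one_mul] at h2

theorem AccretiveBound.norm_inverse_le {c : ℂ} {δ : ℝ} {T : H →L[ℂ] H} (hδ : 0 < δ)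
    (h : AccretiveBound c δ T) : ‖Ring.inverse T‖ ≤ ‖c‖ / δ := by
  refine opNorm_le_bound _ (by positivity) fun x => ?_
  have h1 := h.le_norm_apply (Ring.inverse T x)
  have h2 : T (Ring.inverse T x) = x :=
    DFunLike.congr_fun (Ring.mul_inverse_cancel T (h.isUnit hδ)) x
  rw [h2] at h1
  rw [div_mul_eq_mul_div, le_div_iff₀ hδ]
  linarith

theorem inner_proj {p : H →L[ℂ] H} (hp : IsStarProjection p) (x y : H) :
    ⟪p x, y⟫_ℂ = ⟪x, p y⟫_ℂ := by
  have h := hp.isSelfAdjoint.star_eq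
  rw [star_eq_adjoint] at h
  conv_rhs => rw [← h, adjoint_inner_right]

theorem AccretiveBound.pivot {c : ℂ} {δ : ℝ} {p Λ : H →L[ℂ] H} (hp : IsStarProjection p)
    (hc : δ ≤ c.re) (h : AccretiveBound c δ Λ) : AccretiveBound c δ (pivot p Λ) := by
  intro x
  have hpp : p (p x) = p x := DFunLike.congr_fun hp.isIdempotentElem.eq x
  have e1 : ⟪x, FreeLoewner.pivot p Λ x⟫_ℂ
      = ⟪p x, Λ (p x)⟫_ℂ + ⟪x - p x, x - p x⟫_ℂ := by
    have : ⟪p x, x - p x⟫_ℂ = 0 := by rw [inner_proj hp]; simp [hpp]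
    rw [inner_sub_left x, this, sub_zero, inner_proj hp]
    simp only [FreeLoewner.pivot, add_apply, sub_apply, one_apply_eq_self, mul_apply_eq_comp,
      inner_add_right]
  have e2 : ‖x‖ ^ 2 = ‖p x‖ ^ 2 + ‖x - p x‖ ^ 2 := by
    have : ⟪p x, x - p x⟫_ℂ = 0 := by rw [inner_proj hp]; simp [hpp]
    have := norm_add_sq_eq_norm_sq_add_norm_sq_of_inner_eq_zero _ _ this
    simpa [sq] using this
  rw [e1, e2, mul_add, mul_add, Complex.add_re]
  gcongr
  · exact h _
  · rw [inner_self_eq_norm_sq_to_K]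
    have : (c * ((‖x - p x‖ : ℂ)) ^ 2).re = c.re * ‖x - p x‖ ^ 2 := by
      rw [← Complex.ofReal_pow, Complex.re_mul_ofReal]
    exact (mul_le_mul_of_nonneg_right hc (by positivity)).trans this.ge

variable {c : ℂ} {δ : ℝ} {p Λ : H →L[ℂ] H}

theorem proj_mul_pivot (hp : IsStarProjection p) : p * pivot p Λ = p * Λ * p := by
  have h := hp.isIdempotentElem.eq
  simp only [pivot, mul_add, mul_sub, mul_one, h, sub_self, add_zero, ← mul_assoc]

theorem pivot_mul_proj (hp : IsStarProjection p) : pivot p Λ * p = p * Λ * p := by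
  have h := hp.isIdempotentElem.eq
  simp only [pivot, add_mul, sub_mul, one_mul, h, sub_self, add_zero, mul_assoc]

theorem compInv_eq (hp : IsStarProjection p) : compInv p Λ = p * Ring.inverse (pivot p Λ) := by
  have : Commute p (pivot p Λ) := (proj_mul_pivot hp).trans (pivot_mul_proj hp).symm
  by_cases hN : IsUnit (pivot p Λ)
  · obtain ⟨v, hv⟩ := hN
    rw [← hv] at this
    rw [compInv, ← hv, Ring.inverse_unit]
    exact this.units_inv_right.eq.symm
  · rw [compInv, Ring.inverse_non_unit _ hN, zero_mul, mul_zero]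

theorem proj_mul_compInv (hp : IsStarProjection p) : p * compInv p Λ = compInv p Λ := by
  rw [compInv_eq hp, ← mul_assoc, hp.isIdempotentElem.eq]

theorem compInv_mul_proj (hp : IsStarProjection p) : compInv p Λ * p = compInv p Λ := by
  rw [compInv, mul_assoc, hp.isIdempotentElem.eq]

theorem compInv_mul_mul (hp : IsStarProjection p) (hN : IsUnit (pivot p Λ)) :
    compInv p Λ * Λ * p = p := by
  rw [compInv, mul_assoc, mul_assoc, ← mul_assoc p, ← pivot_mul_proj hp, ← mul_assoc,
    Ring.inverse_mul_cancel _ hN, one_mul]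

theorem mul_mul_compInv (hp : IsStarProjection p) (hN : IsUnit (pivot p Λ)) :
    p * Λ * compInv p Λ = p := by
  rw [compInv_eq hp, ← mul_assoc, ← proj_mul_pivot hp, mul_assoc, Ring.mul_inverse_cancel _ hN,
    mul_one]

theorem norm_compInv_le (hp : IsStarProjection p) (hδ : 0 < δ) (hc : δ ≤ c.re)
    (h : AccretiveBound c δ Λ) : ‖compInv p Λ‖ ≤ ‖c‖ / δ := by
  have h1 := (h.pivot hp hc).norm_inverse_le hδ
  have h2 : ‖p‖ ≤ 1 := hp.norm_le
  refine (norm_mul_le _ _).trans ?_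
  calc _ ≤ ‖c‖ / δ * 1 := by gcongr
    _ = _ := mul_one _

/-- The operator `Λ` maps the vector `shortVec p Λ η` to the orthogonal complement of the range
of `p`. -/
theorem inner_shortVec_eq_zero (hp : IsStarProjection p) (hN : IsUnit (pivot p Λ)) {z : H}
    (hz : p z = z) (η : H) : ⟪z, Λ (shortVec p Λ η)⟫_ℂ = 0 := by
  rw [← hz, inner_proj hp, shortVec, map_sub, map_sub]
  have := DFunLike.congr_fun (mul_mul_compInv hp hN) (Λ η)
  simp only [mul_apply_eq_comp] at this
  rw [this, sub_self, inner_zero_right]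

theorem proj_sub_shortVec (hp : IsStarProjection p) (η : H) :
    p (η - shortVec p Λ η) = η - shortVec p Λ η := by
  rw [shortVec, sub_sub_cancel]
  exact DFunLike.congr_fun (proj_mul_compInv hp) (Λ η)

theorem inner_short (hp : IsStarProjection p) (hN : IsUnit (pivot p Λ)) (η : H) :
    ⟪η, short p Λ η⟫_ℂ = ⟪shortVec p Λ η, Λ (shortVec p Λ η)⟫_ℂ := by
  have h := inner_shortVec_eq_zero hp hN (proj_sub_shortVec (Λ := Λ) hp η) η
  rw [inner_sub_left, sub_eq_zero] at h
  rw [short_apply, h]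

/-- For a positive `Λ` the shorted operator is given by a minimum. -/
theorem re_inner_short_le (hp : IsStarProjection p) (hN : IsUnit (pivot p Λ)) (hΛ : 0 ≤ Λ)
    {η θ : H} (hθ : p (η - θ) = η - θ) : (⟪η, short p Λ η⟫_ℂ).re ≤ (⟪θ, Λ θ⟫_ℂ).re := by
  rw [nonneg_iff_isPositive] at hΛ
  set θ₀ := shortVec p Λ η
  set z := θ - θ₀ with hz
  have hpz : p z = z := by
    have h1 := proj_sub_shortVec (Λ := Λ) hp η
    have : z = (η - θ₀) - (η - θ) := by rw [hz]; abel
    rw [this, map_sub, h1, hθ]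
  have h0 : ⟪z, Λ θ₀⟫_ℂ = 0 := inner_shortVec_eq_zero hp hN hpz η
  have h0' : ⟪θ₀, Λ z⟫_ℂ = 0 := by
    rw [← hΛ.inner_left_eq_inner_right, ← inner_conj_symm]
    simp [h0]
  rw [inner_short hp hN]
  have : θ = θ₀ + z := by rw [hz]; abel
  rw [this, map_add, inner_add_left, inner_add_right, inner_add_right, h0, h0']
  have := hΛ.re_inner_nonneg_right z
  simp only [RCLike.re_to_complex] at this
  simp only [add_zero, zero_add, Complex.add_re]
  linarith

theorem re_inner_short_mono {Λ' : H →L[ℂ] H} (hp : IsStarProjection p)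
    (hN : IsUnit (pivot p Λ)) (hN' : IsUnit (pivot p Λ')) (hΛ : 0 ≤ Λ) (h : Λ ≤ Λ') (η : H) :
    (⟪η, short p Λ η⟫_ℂ).re ≤ (⟪η, short p Λ' η⟫_ℂ).re := by
  refine (re_inner_short_le hp hN hΛ (proj_sub_shortVec (Λ := Λ') hp η)).trans ?_
  rw [inner_short hp hN']
  have := (le_def _ _ |>.1 h).re_inner_nonneg_right (shortVec p Λ' η)
  simpa [inner_sub_right] using this

theorem re_inner_short_concave {Λ' : H →L[ℂ] H} {s t : ℝ} (hs : 0 ≤ s) (ht : 0 ≤ t)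
    (hp : IsStarProjection p) (hN : IsUnit (pivot p Λ)) (hN' : IsUnit (pivot p Λ'))
    (hN'' : IsUnit (pivot p ((s : ℂ) • Λ + (t : ℂ) • Λ'))) (hΛ : 0 ≤ Λ) (hΛ' : 0 ≤ Λ') (η : H) :
    s * (⟪η, short p Λ η⟫_ℂ).re + t * (⟪η, short p Λ' η⟫_ℂ).re ≤
      (⟪η, short p ((s : ℂ) • Λ + (t : ℂ) • Λ') η⟫_ℂ).re := by
  rw [inner_short hp hN'']
  have hθ := proj_sub_shortVec (Λ := (s : ℂ) • Λ + (t : ℂ) • Λ') hp η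
  set θ := shortVec p ((s : ℂ) • Λ + (t : ℂ) • Λ') η
  have h1 := re_inner_short_le hp hN hΛ hθ
  have h2 := re_inner_short_le hp hN' hΛ' hθ
  simp only [add_apply, smul_apply, inner_add_right, inner_smul_right, Complex.add_re,
    Complex.re_ofReal_mul]
  gcongr

/-- Let `W` be the Moore-Penrose inverse of `M = G (1 - P)` and `p = M W`, the projection onto the
range of `M`. The block of `G Λ G` outside the range of `P` is `M⋆ Λ M`, and it is inverted by
inverting `Λ` on the range of `p`. -/
theorem isMoorePenrose_pivotBlock {P G W q : H →L[ℂ] H} (hP : IsSelfAdjoint P)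
    (hG : IsSelfAdjoint G) (hp : IsStarProjection p) (hq : IsSelfAdjoint q)
    (hN : IsUnit (pivot p Λ)) (h1 : G * (1 - P) * W = p) (h2 : W * (G * (1 - P)) = q)
    (h3 : W * (G * (1 - P)) * W = W) (h4 : G * (1 - P) * W * (G * (1 - P)) = G * (1 - P)) :
    IsMoorePenrose (pivotBlock P (G * Λ * G)) (W * compInv p Λ * star W) := by
  set M := G * (1 - P) with hM
  have hMs : star M = (1 - P) * G := by
    rw [hM, star_mul, hG.star_eq, star_sub, star_one, hP.star_eq]
  have hD : pivotBlock P (G * Λ * G) = star M * Λ * M := by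
    rw [pivotBlock, hMs, hM]; noncomm_ring
  have hpM : p * M = M := by rw [← h1, h4]
  have hWp : W * p = W := by rw [← h1, ← mul_assoc, h3]
  have hMp : star M * p = star M := by
    rw [← hp.isSelfAdjoint.star_eq, ← star_mul, hpM]
  have hpW : p * star W = star W := by
    rw [← hp.isSelfAdjoint.star_eq, ← star_mul, hWp]
  have hMW : star M * star W = q := by rw [← star_mul, h2, hq.star_eq]
  have hWM : star W * star M = p := by rw [← star_mul, h1, hp.isSelfAdjoint.star_eq]
  have hTR : pivotBlock P (G * Λ * G) * (W * compInv p Λ * star W) = q := by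
    calc _ = star M * Λ * (M * W) * compInv p Λ * star W := by rw [hD]; noncomm_ring
      _ = star M * (p * Λ * (p * compInv p Λ)) * star W := by
          rw [h1]
          conv_lhs => rw [← hMp]
          noncomm_ring
      _ = q := by
          rw [proj_mul_compInv hp, mul_mul_compInv hp hN, hMp, hMW]
  have hRT : W * compInv p Λ * star W * pivotBlock P (G * Λ * G) = q := by
    calc _ = W * compInv p Λ * (star W * star M) * Λ * M := by rw [hD]; noncomm_ring
      _ = W * (compInv p Λ * p * Λ * p) * M := by
          rw [hWM]
          conv_lhs => rw [← hpM]
          noncomm_ring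
      _ = q := by
          rw [compInv_mul_proj hp, compInv_mul_mul hp hN, hWp, h2]
  have hqs : ((q : H →L[ℂ] H) : H →ₗ[ℂ] H).IsSymmetric :=
    (isSelfAdjoint_iff_isSymmetric).1 hq
  refine ⟨?_, ?_, ?_, ?_⟩
  · rw [hTR, hD, ← hMW]
    calc _ = star M * (star W * star M) * Λ * M := by noncomm_ring
      _ = _ := by rw [hWM, hMp]
  · rw [hRT, ← h2]
    calc _ = (W * M * W) * compInv p Λ * star W := by noncomm_ring
      _ = _ := by rw [h3]
  · rw [hTR]; exact hqs
  · rw [hRT]; exact hqs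

/-- The Schur complement of `G Λ G` pivoting on the range of `P` is a compression of the operator
`Λ` shorted by the range of `M = G (1 - P)`. -/
theorem schur_eq {P G W q : H →L[ℂ] H} (hP : IsSelfAdjoint P)
    (hG : IsSelfAdjoint G) (hp : IsStarProjection p) (hq : IsSelfAdjoint q)
    (hN : IsUnit (pivot p Λ)) (h1 : G * (1 - P) * W = p) (h2 : W * (G * (1 - P)) = q)
    (h3 : W * (G * (1 - P)) * W = W) (h4 : G * (1 - P) * W * (G * (1 - P)) = G * (1 - P)) :
    schur P (G * Λ * G) = P * G * short p Λ * (G * P) := by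
  have hMP := isMoorePenrose_pivotBlock hP hG hp hq hN h1 h2 h3 h4
  have hpinv : pinv (pivotBlock P (G * Λ * G)) = W * compInv p Λ * star W := by
    have hex : ∃ R, IsMoorePenrose (pivotBlock P (G * Λ * G)) R := ⟨_, hMP⟩
    rw [pinv, dif_pos hex]
    exact hex.choose_spec.unique hMP
  have h1' : star W * ((1 - P) * G) = p := by
    have : star (G * (1 - P) * W) = star W * ((1 - P) * G) := by
      rw [star_mul, star_mul, hG.star_eq, star_sub, star_one, hP.star_eq]
    rw [← this, h1, hp.isSelfAdjoint.star_eq]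
  rw [schur, hpinv]
  calc _ = P * G * Λ * G * P - P * G * Λ * (G * (1 - P) * W) * compInv p Λ *
        (star W * ((1 - P) * G)) * Λ * G * P := by noncomm_ring
    _ = P * G * Λ * G * P - P * G * Λ * (p * compInv p Λ * p) * Λ * G * P := by
        rw [h1, h1']; noncomm_ring
    _ = _ := by rw [proj_mul_compInv hp, compInv_mul_proj hp, short]; noncomm_ring

end Short

/-! ### Operators on finite-dimensional spaces -/

section FiniteDim

variable {N : Type*} [NormedAddCommGroup N] [InnerProductSpace ℂ N] [FiniteDimensional ℂ N]

theorem finite_spectrum_real [CompleteSpace N] (h : N →L[ℂ] N) : (spectrum ℝ h).Finite := by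
  have h1 : (spectrum ℂ h).Finite := by
    have := Module.End.finite_spectrum (K := ℂ) (h : N →ₗ[ℂ] N)
    rwa [← AlgEquiv.spectrum_eq (Module.End.toContinuousLinearMap N)] at this
  have h2 : spectrum ℝ h = algebraMap ℝ ℂ ⁻¹' spectrum ℂ h :=
    (spectrum.preimage_algebraMap (R := ℝ) ℂ).symm
  rw [h2]
  exact h1.preimage (FaithfulSMul.algebraMap_injective ℝ ℂ).injOn

/-- Every operator on a finite-dimensional Hilbert space has a Moore-Penrose inverse. -/
theorem exists_pseudoinverse [CompleteSpace N] (M : N →L[ℂ] N) :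
    ∃ W : N →L[ℂ] N, M * W * M = M ∧ W * M * W = W ∧ IsSelfAdjoint (M * W) ∧
      IsSelfAdjoint (W * M) := by
  -- `W = h⁺ M⋆` with `h = M⋆ M`, and `h⁺` is given by the functional calculus; as `0⁻¹ = 0`, the
  -- function `t ↦ t⁻¹` is continuous on the finite spectrum of `h` and inverts its nonzero part
  set h := star M * M with hh
  have hsa : IsSelfAdjoint h := IsSelfAdjoint.star_mul_self M
  have hc : ∀ f : ℝ → ℝ, ContinuousOn f (spectrum ℝ h) := fun f =>
    (finite_spectrum_real h).continuousOn f
  set r := cfc (fun t : ℝ => t⁻¹) h with hr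
  have hrsa : IsSelfAdjoint r := cfc_predicate _ _
  have hid : cfc (fun t : ℝ => t) h = h := cfc_id' ℝ h
  have hrh : IsSelfAdjoint (r * h) := by
    rw [hr]
    nth_rw 2 [← hid]
    rw [← cfc_mul _ _ h (hc _) (hc _)]
    exact cfc_predicate _ _
  have hhrh : h * (r * h) = h := by
    rw [hr]
    conv_lhs => rw [← hid]
    rw [hid]
    nth_rw 1 3 [← hid]
    rw [← cfc_mul _ _ h (hc _) (hc _), ← cfc_mul _ _ h (hc _) (hc _)]
    conv_rhs => rw [← hid]
    congr 1
    funext t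
    rcases eq_or_ne t 0 with rfl | ht
    · simp
    · field_simp
  have hrhr : r * h * r = r := by
    rw [hr]
    nth_rw 2 [← hid]
    rw [← cfc_mul _ _ h (hc _) (hc _), ← cfc_mul _ _ h (hc _) (hc _)]
    congr 1
    funext t
    rcases eq_or_ne t 0 with rfl | ht
    · simp
    · field_simp
  have hM : M * (1 - r * h) = 0 := by
    rw [← CStarRing.star_mul_self_eq_zero_iff]
    calc star (M * (1 - r * h)) * (M * (1 - r * h))
        = star (1 - r * h) * (h - h * (r * h)) := by
          rw [star_mul, hh]; noncomm_ring
      _ = 0 := by rw [hhrh, sub_self, mul_zero]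
  refine ⟨r * star M, ?_, ?_, ?_, ?_⟩
  · rw [mul_sub, mul_one, sub_eq_zero] at hM
    rw [mul_assoc, mul_assoc, ← hh]
    exact hM.symm
  · calc r * star M * M * (r * star M) = (r * h * r) * star M := by rw [hh]; noncomm_ring
      _ = _ := by rw [hrhr]
  · rw [← mul_assoc]
    exact IsSelfAdjoint.conjugate hrsa M
  · rw [mul_assoc]; exact hrh

/-- The norm of a positive operator is at most its trace. -/
theorem norm_le_re_trace {T : N →L[ℂ] N} [CompleteSpace N] (hT : 0 ≤ T) :
    ‖T‖ ≤ (LinearMap.trace ℂ N T).re := by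
  obtain ⟨g, rfl⟩ := CStarAlgebra.nonneg_iff_eq_star_mul_self.1 hT
  set b := stdOrthonormalBasis ℂ N
  have htr : (LinearMap.trace ℂ N ((star g * g : N →L[ℂ] N) : N →ₗ[ℂ] N)).re
      = ∑ i, ‖g (b i)‖ ^ 2 := by
    rw [LinearMap.trace_eq_sum_inner _ b, Complex.re_sum]
    refine Finset.sum_congr rfl fun i _ => ?_
    have : ⟪b i, (star g * g) (b i)⟫_ℂ = ⟪g (b i), g (b i)⟫_ℂ := by
      rw [star_eq_adjoint, mul_apply_eq_comp, adjoint_inner_right]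
    rw [coe_coe, this, inner_self_eq_norm_sq_to_K]
    norm_cast
  rw [CStarRing.norm_star_mul_self, htr, ← sq]
  set S := ∑ i, ‖g (b i)‖ ^ 2
  have hS : 0 ≤ S := by positivity
  have : ‖g‖ ≤ √S := by
    refine opNorm_le_bound _ (Real.sqrt_nonneg _) fun x => ?_
    have h1 : ‖g x‖ ≤ ∑ i, ‖⟪b i, x⟫_ℂ‖ * ‖g (b i)‖ := by
      conv_lhs => rw [← b.sum_repr' x, map_sum]
      refine (norm_sum_le _ _).trans_eq ?_
      simp [norm_smul]
    have h2 : (∑ i, ‖⟪b i, x⟫_ℂ‖ * ‖g (b i)‖) ^ 2 ≤ ‖x‖ ^ 2 * S := by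
      rw [← b.sum_sq_norm_inner_right x]
      exact Finset.sum_mul_sq_le_sq_mul_sq _ _ _
    refine h1.trans (Real.le_sqrt_of_sq_le h2 |>.trans_eq ?_)
    rw [mul_comm, Real.sqrt_mul hS, Real.sqrt_sq (norm_nonneg _)]
  calc ‖g‖ ^ 2 ≤ √S ^ 2 := by gcongr
    _ = S := Real.sq_sqrt hS

theorem norm_le_one_of_star_mul_self_le {A : Type*} [CStarAlgebra A] [PartialOrder A]
    [StarOrderedRing A] {s : A} (h : star s * s ≤ 1) : ‖s‖ ≤ 1 := by
  have := (CStarAlgebra.norm_le_one_iff_of_nonneg (star s * s) (star_mul_self_nonneg s)).2 h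
  rw [CStarRing.norm_star_mul_self] at this
  nlinarith [norm_nonneg s]

/-- Simultaneous normalisation of a finite family of positive operators with sum `b`: they have the
form `G T G` with `G = √b`, where the positive operators `T` add up to the identity. -/
theorem exists_normalization [CompleteSpace N] {ι : Type*} [Fintype ι] {b : N →L[ℂ] N}
    {C : ι → N →L[ℂ] N} (hC : ∀ i, 0 ≤ C i) (hb : ∑ i, C i ≤ b) :
    ∃ (G s₀ : N →L[ℂ] N) (s : ι → N →L[ℂ] N), IsSelfAdjoint G ∧ G * G = b ∧
      G * (star s₀ * s₀) * G = b - ∑ i, C i ∧ (∀ i, G * (star (s i) * s i) * G = C i) ∧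
      star s₀ * s₀ + ∑ i, star (s i) * s i = 1 := by
  have hb0 : 0 ≤ b := (Finset.sum_nonneg fun i _ => hC i).trans hb
  set G := CFC.sqrt b with hG
  have hGG : G * G = b := CFC.sqrt_mul_sqrt_self b hb0
  have hGsa : IsSelfAdjoint G := (CFC.sqrt_nonneg b).isSelfAdjoint
  obtain ⟨W, h1, h2, h3, h4⟩ := exists_pseudoinverse G
  -- an operator between `0` and `b` vanishes on the kernel of `G`
  have key : ∀ c, 0 ≤ c → c ≤ b → G * (star W * c * W) * G = c := by
    intro c hc hcb
    obtain ⟨d, rfl⟩ := CStarAlgebra.nonneg_iff_eq_star_mul_self.1 hc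
    have hd : d * (1 - W * G) = 0 := by
      rw [← CStarRing.star_mul_self_eq_zero_iff]
      refine le_antisymm ?_ (star_mul_self_nonneg _)
      have := star_left_conjugate_le_conjugate hcb (1 - W * G)
      have e0 : b * (1 - W * G) = 0 := by
        rw [← hGG]
        calc G * G * (1 - W * G) = G * (G - G * W * G) := by noncomm_ring
          _ = 0 := by rw [h1, sub_self, mul_zero]
      rw [mul_assoc _ b, e0, mul_zero] at this
      calc _ = star (1 - W * G) * (star d * d * (1 - W * G)) := by rw [star_mul]; noncomm_ring
        _ = star (1 - W * G) * (star d * d) * (1 - W * G) := by noncomm_ring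
        _ ≤ 0 := this
    rw [mul_sub, mul_one, sub_eq_zero] at hd
    have hGW : G * star W = W * G := by rw [← h4.star_eq, star_mul, hGsa.star_eq]
    have hd' : W * G * star d = star d := by
      have := congrArg star hd.symm
      rwa [star_mul, h4.star_eq] at this
    calc G * (star W * (star d * d) * W) * G = (G * star W) * star d * (d * (W * G)) := by
          noncomm_ring
      _ = star d * d := by rw [hGW, hd', ← hd]
  have hproj : 0 ≤ 1 - G * W := by
    have : 1 - G * W = star (1 - G * W) * (1 - G * W) := by
      rw [star_sub, star_one, h3.star_eq]
      calc 1 - G * W = 1 - G * W - G * W + G * W := by abel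
        _ = 1 - G * W - G * W + (G * W * G) * W := by rw [h1]
        _ = _ := by noncomm_ring
    rw [this]; exact star_mul_self_nonneg _
  have hD : 0 ≤ b - ∑ i, C i := sub_nonneg.2 hb
  have hDb : b - ∑ i, C i ≤ b := sub_le_self _ (Finset.sum_nonneg fun i _ => hC i)
  have hCb : ∀ i, C i ≤ b := fun i =>
    (Finset.single_le_sum (fun j _ => hC j) (Finset.mem_univ i)).trans hb
  -- the projection `1 - G W` onto the kernel of `G` is added in order to get the sum `1`
  obtain ⟨s₀, hs₀⟩ := CStarAlgebra.nonneg_iff_eq_star_mul_self.1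
    (add_nonneg (star_left_conjugate_nonneg hD W) hproj)
  choose s hs using fun i => CStarAlgebra.nonneg_iff_eq_star_mul_self.1
    (star_left_conjugate_nonneg (hC i) W)
  refine ⟨G, s₀, s, hGsa, hGG, ?_, fun i => ?_, ?_⟩
  · rw [← hs₀]
    have : G * (1 - G * W) * G = 0 := by
      calc G * (1 - G * W) * G = G * (G - G * W * G) := by noncomm_ring
        _ = 0 := by rw [h1, sub_self, mul_zero]
    rw [mul_add, add_mul, this, add_zero, key _ hD hDb]
  · rw [← hs i, key _ (hC i) (hCb i)]
  · rw [← hs₀]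
    simp only [← hs]
    rw [← Finset.sum_mul, ← Finset.mul_sum]
    have : star W * b * W = G * W := by
      calc star W * b * W = star (G * W) * (G * W) := by
            rw [← hGG, star_mul, hGsa.star_eq]; noncomm_ring
        _ = (G * W * G) * W := by rw [h3.star_eq]; noncomm_ring
        _ = G * W := by rw [h1]
    calc _ = star W * b * W + (1 - G * W) := by noncomm_ring
      _ = 1 := by rw [this]; abel

end FiniteDim

/-! ### Tensor products with a finite-dimensional Hilbert space -/

section Tensor

variable {E : Type*} [NormedAddCommGroup E] [InnerProductSpace ℂ E]
variable {ι : Type*} [Fintype ι]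

/-- The coordinate `∑ₐ eₐ ⊗ yₐ ↦ yₐ`. -/
def tensorCoord (E : Type*) [NormedAddCommGroup E] [InnerProductSpace ℂ E] (a : ι) :
    EuclideanSpace ℂ ι ⊗[ℂ] E →L[ℂ] E :=
  ((TensorProduct.lidIsometry ℂ E).toContinuousLinearEquiv : ℂ ⊗[ℂ] E →L[ℂ] E) ∘L
    (EuclideanSpace.proj a).rTensor E

theorem tensorCoord_tmul (a : ι) (v : EuclideanSpace ℂ ι) (x : E) :
    tensorCoord E a (v ⊗ₜ[ℂ] x) = v a • x := by
  simp [tensorCoord]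

theorem sum_tensorCoord [DecidableEq ι] (z : EuclideanSpace ℂ ι ⊗[ℂ] E) :
    ∑ a, EuclideanSpace.single a (1 : ℂ) ⊗ₜ[ℂ] tensorCoord E a z = z := by
  induction z with
  | zero => simp
  | add z w hz hw =>
    conv_rhs => rw [← hz, ← hw]
    simp [TensorProduct.tmul_add, Finset.sum_add_distrib]
  | tmul v x =>
    simp only [tensorCoord_tmul, ← TensorProduct.smul_tmul, ← TensorProduct.sum_tmul]
    congr 1
    ext a
    simp [Pi.single_apply]

theorem inner_tensorCoord (z w : EuclideanSpace ℂ ι ⊗[ℂ] E) :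
    ⟪z, w⟫_ℂ = ∑ a, ⟪tensorCoord E a z, tensorCoord E a w⟫_ℂ := by
  classical
  conv_lhs => rw [← sum_tensorCoord z, ← sum_tensorCoord w]
  simp [sum_inner, inner_sum, EuclideanSpace.inner_single_left]

theorem norm_sq_tensorCoord (z : EuclideanSpace ℂ ι ⊗[ℂ] E) :
    ‖z‖ ^ 2 = ∑ a, ‖tensorCoord E a z‖ ^ 2 := by
  have h := congrArg Complex.re (inner_tensorCoord z z)
  rw [Complex.re_sum] at h
  simp only [← RCLike.re_to_complex, inner_self_eq_norm_sq (tensorCoord E _ z)] at h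
  exact (inner_self_eq_norm_sq (𝕜 := ℂ) z).symm.trans h

/-- The tensor product of a finite-dimensional Hilbert space and a Hilbert space needs no
completion. -/
instance completeSpace_tensor [CompleteSpace E] :
    CompleteSpace (EuclideanSpace ℂ ι ⊗[ℂ] E) := by
  classical
  let e : (ι → E) ≃L[ℂ] EuclideanSpace ℂ ι ⊗[ℂ] E :=
    ContinuousLinearEquiv.equivOfInverse
      (∑ a, (TensorProduct.mkL ℂ (EuclideanSpace ℂ ι) E (EuclideanSpace.single a (1 : ℂ))) ∘L
        ContinuousLinearMap.proj a)
      (ContinuousLinearMap.pi fun a => tensorCoord E a)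
      (fun y => by
        ext a
        simp [tensorCoord_tmul])
      (fun z => by
        simpa [sum_apply] using sum_tensorCoord z)
  exact (completeSpace_congr (e := e.toEquiv) e.isUniformEmbedding).1 inferInstance

theorem tensorCoord_mapL_one (a : ι) (T : E →L[ℂ] E) (z : EuclideanSpace ℂ ι ⊗[ℂ] E) :
    tensorCoord E a (TensorProduct.mapL 1 T z) = T (tensorCoord E a z) := by
  have : tensorCoord E a ∘L TensorProduct.mapL 1 T = T ∘L tensorCoord E a := by
    apply ContinuousLinearMap.coe_inj.mp
    ext v x
    simp [tensorCoord_tmul]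
  exact DFunLike.congr_fun this z

theorem AccretiveBound.mapL {c : ℂ} {δ : ℝ} {T : E →L[ℂ] E} (h : AccretiveBound c δ T) :
    AccretiveBound c δ
      (TensorProduct.mapL (1 : EuclideanSpace ℂ ι →L[ℂ] EuclideanSpace ℂ ι) T) := by
  intro z
  rw [norm_sq_tensorCoord, inner_tensorCoord, Finset.mul_sum, Finset.mul_sum, Complex.re_sum]
  refine Finset.sum_le_sum fun a _ => ?_
  rw [tensorCoord_mapL_one]
  exact h _

variable [CompleteSpace E]

theorem inner_mapL_star_mul_self (s : EuclideanSpace ℂ ι →L[ℂ] EuclideanSpace ℂ ι)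
    (T : E →L[ℂ] E) (z w : EuclideanSpace ℂ ι ⊗[ℂ] E) :
    ⟪z, TensorProduct.mapL (star s * s) T w⟫_ℂ =
      ⟪TensorProduct.mapL s 1 z, TensorProduct.mapL 1 T (TensorProduct.mapL s 1 w)⟫_ℂ := by
  have h : TensorProduct.mapL (star s * s) T =
      star (TensorProduct.mapL s (1 : E →L[ℂ] E)) *
        (TensorProduct.mapL 1 T * TensorProduct.mapL s 1) := by
    rw [star_eq_adjoint (TensorProduct.mapL s _), TensorProduct.adjoint_mapL, ← star_eq_adjoint,
      ← star_eq_adjoint, ← TensorProduct.mapL_mul, ← TensorProduct.mapL_mul]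
    simp
  rw [h, mul_apply_eq_comp, star_eq_adjoint, adjoint_inner_right, mul_apply_eq_comp]

end Tensor

/-! ### Normalised pencils -/

theorem opNorm_sum_le {V V' ι : Type*} [NormedAddCommGroup V] [NormedSpace ℂ V]
    [NormedAddCommGroup V'] [NormedSpace ℂ V'] [Fintype ι] (T : ι → V →L[ℂ] V') :
    ‖∑ i, T i‖ ≤ ∑ i, ‖T i‖ :=
  norm_sum_le _ _

theorem opNorm_star_mul_self_le {V : Type*} [NormedAddCommGroup V] [InnerProductSpace ℂ V]
    [CompleteSpace V] {s : V →L[ℂ] V} (h : ‖s‖ ≤ 1) : ‖star s * s‖ ≤ 1 := by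
  rw [CStarRing.norm_star_mul_self]
  exact mul_le_one₀ h (norm_nonneg _) h

/-- The pencils of a family in normalised form: `B₀ ⊗ I + ∑ Bᵢ ⊗ (Xᵢ - I) = G Λ G`, where
`Λ = s₀⋆ s₀ ⊗ I + ∑ sᵢ⋆ sᵢ ⊗ Xᵢ` has coefficients adding up to the identity and `G = √B₀`. The
operator `W` is the Moore-Penrose inverse of `G (1 - v v⋆)`, and `p`, `q` are the projections onto
the range and the coimage of the latter. The operators `G` are uniformly bounded. -/
structure Realization (𝓑 : PencilFamily.{u} k c₁ c₂) where
  G : ∀ ω : PencilIndex.{u} k c₁ c₂, FinSpace.{u} ω.n →L[ℂ] FinSpace.{u} ω.n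
  s₀ : ∀ ω : PencilIndex.{u} k c₁ c₂, FinSpace.{u} ω.n →L[ℂ] FinSpace.{u} ω.n
  s : ∀ ω : PencilIndex.{u} k c₁ c₂, Fin k → FinSpace.{u} ω.n →L[ℂ] FinSpace.{u} ω.n
  W : ∀ ω : PencilIndex.{u} k c₁ c₂, FinSpace.{u} ω.n →L[ℂ] FinSpace.{u} ω.n
  p : ∀ ω : PencilIndex.{u} k c₁ c₂, FinSpace.{u} ω.n →L[ℂ] FinSpace.{u} ω.n
  q : ∀ ω : PencilIndex.{u} k c₁ c₂, FinSpace.{u} ω.n →L[ℂ] FinSpace.{u} ω.n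
  bound : ℝ
  norm_G_le : ∀ ω, ‖G ω‖ ≤ bound
  G_selfAdjoint : ∀ ω, IsSelfAdjoint (G ω)
  coeff_zero : ∀ ω, G ω * (star (s₀ ω) * s₀ ω) * G ω = 𝓑.B₀ ω - ∑ i, 𝓑.B ω i
  coeff : ∀ ω i, G ω * (star (s ω i) * s ω i) * G ω = 𝓑.B ω i
  sum_coeff : ∀ ω, star (s₀ ω) * s₀ ω + ∑ i, star (s ω i) * s ω i = 1
  p_proj : ∀ ω, IsStarProjection (p ω)
  q_selfAdjoint : ∀ ω, IsSelfAdjoint (q ω)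
  mul_W : ∀ ω, G ω * (1 - ω.proj) * W ω = p ω
  W_mul : ∀ ω, W ω * (G ω * (1 - ω.proj)) = q ω
  W_mul_W : ∀ ω, W ω * (G ω * (1 - ω.proj)) * W ω = W ω
  mul_W_mul : ∀ ω, G ω * (1 - ω.proj) * W ω * (G ω * (1 - ω.proj)) = G ω * (1 - ω.proj)

theorem proj_selfAdjoint (ω : PencilIndex.{u} k c₁ c₂) : IsSelfAdjoint ω.proj := by
  rw [PencilIndex.proj, isSelfAdjoint_iff_isSymmetric]
  exact (InnerProductSpace.isPositive_rankOne_self ω.v).isSymmetric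

theorem norm_proj_le (ω : PencilIndex.{u} k c₁ c₂) : ‖ω.proj‖ ≤ 1 := by
  rw [PencilIndex.proj, InnerProductSpace.norm_rankOne, ω.norm_v, one_mul]

theorem PencilFamily.Supports.nonempty_realization {𝓑 : PencilFamily.{u} k c₁ c₂}
    {F : GradedMap.{u} k} (h : 𝓑.Supports F) : Nonempty (Realization 𝓑) := by
  choose G s₀ s hG hGG h0 hs hsum using fun ω =>
    exists_normalization (fun i => h.nonneg ω i) (h.sum_le ω)
  choose W h1 h2 h3 h4 using fun ω => exists_pseudoinverse (G ω * (1 - ω.proj))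
  set β := ‖F (FinSpace.{u} 1)
    (fun _ => (c₂ : ℂ) • (1 : FinSpace.{u} 1 →L[ℂ] FinSpace.{u} 1))‖ / min 1 c₁
  have hB : ∀ ω, ‖𝓑.B₀ ω‖ ≤ β := fun ω =>
    (norm_le_re_trace ((Finset.sum_nonneg fun i _ => h.nonneg ω i).trans (h.sum_le ω))).trans
      (h.trace_le ω)
  refine ⟨{
    G := G
    s₀ := s₀
    s := s
    W := W
    p := fun ω => G ω * (1 - ω.proj) * W ω
    q := fun ω => W ω * (G ω * (1 - ω.proj))
    bound := √β
    norm_G_le := fun ω => ?_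
    G_selfAdjoint := hG
    coeff_zero := h0
    coeff := hs
    sum_coeff := hsum
    p_proj := fun ω => ⟨?_, h3 ω⟩
    q_selfAdjoint := h4
    mul_W := fun ω => rfl
    W_mul := fun ω => rfl
    W_mul_W := h2
    mul_W_mul := h1 }⟩
  · refine Real.le_sqrt_of_sq_le ?_
    rw [sq, ← CStarRing.norm_star_mul_self, (hG ω).star_eq, hGG]
    exact hB ω
  · change G ω * (1 - ω.proj) * W ω * (G ω * (1 - ω.proj) * W ω) = _
    rw [← mul_assoc, h1]

namespace Realization

variable {𝓑 : PencilFamily.{u} k c₁ c₂} (R : Realization 𝓑)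
variable {E : Type u} [NormedAddCommGroup E] [InnerProductSpace ℂ E]

theorem norm_s_le (ω : PencilIndex.{u} k c₁ c₂) (i : Fin k) : ‖R.s ω i‖ ≤ 1 := by
  refine norm_le_one_of_star_mul_self_le ?_
  rw [← R.sum_coeff ω]
  exact (Finset.single_le_sum (fun j _ => star_mul_self_nonneg (R.s ω j)) (Finset.mem_univ i)).trans
    (le_add_of_nonneg_left (star_mul_self_nonneg _))

theorem norm_s₀_le (ω : PencilIndex.{u} k c₁ c₂) : ‖R.s₀ ω‖ ≤ 1 := by
  refine norm_le_one_of_star_mul_self_le ?_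
  rw [← R.sum_coeff ω]
  exact le_add_of_nonneg_right (Finset.sum_nonneg fun i _ => star_mul_self_nonneg _)

/-- The linear part `∑ᵢ sᵢ⋆ sᵢ ⊗ Xᵢ` of the normalised pencil. -/
def lamLin (ω : PencilIndex.{u} k c₁ c₂) (X : Fin k → E →L[ℂ] E) :
    FinSpace.{u} ω.n ⊗[ℂ] E →L[ℂ] FinSpace.{u} ω.n ⊗[ℂ] E :=
  ∑ i, TensorProduct.mapL (star (R.s ω i) * R.s ω i) (X i)

/-- The normalised pencil `s₀⋆ s₀ ⊗ I + ∑ᵢ sᵢ⋆ sᵢ ⊗ Xᵢ`. -/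
def lam (ω : PencilIndex.{u} k c₁ c₂) (X : Fin k → E →L[ℂ] E) :
    FinSpace.{u} ω.n ⊗[ℂ] E →L[ℂ] FinSpace.{u} ω.n ⊗[ℂ] E :=
  TensorProduct.mapL (star (R.s₀ ω) * R.s₀ ω) 1 + R.lamLin ω X

/-- The projection `p ⊗ I`. -/
def tp (E : Type u) [NormedAddCommGroup E] [InnerProductSpace ℂ E]
    (ω : PencilIndex.{u} k c₁ c₂) :
    FinSpace.{u} ω.n ⊗[ℂ] E →L[ℂ] FinSpace.{u} ω.n ⊗[ℂ] E :=
  TensorProduct.mapL (R.p ω) 1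

/-- The operator `G ⊗ I`. -/
def tG (E : Type u) [NormedAddCommGroup E] [InnerProductSpace ℂ E]
    (ω : PencilIndex.{u} k c₁ c₂) :
    FinSpace.{u} ω.n ⊗[ℂ] E →L[ℂ] FinSpace.{u} ω.n ⊗[ℂ] E :=
  TensorProduct.mapL (R.G ω) 1

theorem norm_mapL_one_le {n : ℕ} (T : FinSpace.{u} n →L[ℂ] FinSpace.{u} n) :
    ‖TensorProduct.mapL T (1 : E →L[ℂ] E)‖ ≤ ‖T‖ := by
  refine (TensorProduct.norm_mapL_le _ _).trans ?_
  exact mul_le_of_le_one_right (norm_nonneg _) norm_id_le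

theorem norm_tG_le (ω : PencilIndex.{u} k c₁ c₂) : ‖R.tG E ω‖ ≤ R.bound :=
  (norm_mapL_one_le _).trans (R.norm_G_le ω)

theorem norm_tensorProj_le (ω : PencilIndex.{u} k c₁ c₂) : ‖ω.tensorProj E‖ ≤ 1 :=
  (norm_mapL_one_le _).trans (norm_proj_le ω)

theorem norm_tp_le (ω : PencilIndex.{u} k c₁ c₂) : ‖R.tp E ω‖ ≤ 1 :=
  (norm_mapL_one_le _).trans (R.p_proj ω).norm_le

theorem norm_lamLin_le (ω : PencilIndex.{u} k c₁ c₂) (X : Fin k → E →L[ℂ] E) :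
    ‖R.lamLin ω X‖ ≤ k * ‖X‖ := by
  calc ‖R.lamLin ω X‖ ≤ ∑ i, ‖TensorProduct.mapL (star (R.s ω i) * R.s ω i) (X i)‖ :=
        opNorm_sum_le _
    _ ≤ ∑ _i : Fin k, ‖X‖ := by
        refine Finset.sum_le_sum fun i _ => (TensorProduct.norm_mapL_le _ _).trans ?_
        exact (mul_le_mul (opNorm_star_mul_self_le (R.norm_s_le ω i)) (norm_le_pi_norm X i)
          (norm_nonneg _) zero_le_one).trans_eq (one_mul _)
    _ = _ := by simp

theorem norm_lam_le (ω : PencilIndex.{u} k c₁ c₂) (X : Fin k → E →L[ℂ] E) :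
    ‖R.lam ω X‖ ≤ 1 + k * ‖X‖ := by
  have h : ‖TensorProduct.mapL (star (R.s₀ ω) * R.s₀ ω) (1 : E →L[ℂ] E)‖ ≤ 1 := by
    refine (norm_mapL_one_le _).trans ?_
    exact opNorm_star_mul_self_le (R.norm_s₀_le ω)
  calc ‖R.lam ω X‖ ≤ ‖TensorProduct.mapL (star (R.s₀ ω) * R.s₀ ω) (1 : E →L[ℂ] E)‖ +
          ‖R.lamLin ω X‖ := opNorm_add_le _ _
      _ ≤ _ := add_le_add h (R.norm_lamLin_le ω X)

theorem pencil_eq (ω : PencilIndex.{u} k c₁ c₂) (X : Fin k → E →L[ℂ] E) :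
    𝓑.pencil E ω X = R.tG E ω * R.lam ω X * R.tG E ω := by
  have h : ∀ (T : FinSpace.{u} ω.n →L[ℂ] FinSpace.{u} ω.n) (Y : E →L[ℂ] E),
      R.tG E ω * TensorProduct.mapL T Y * R.tG E ω =
        TensorProduct.mapL (R.G ω * T * R.G ω) Y := fun T Y => by
    rw [tG, ← TensorProduct.mapL_mul, ← TensorProduct.mapL_mul, one_mul, mul_one]
  rw [lam, lamLin, mul_add, add_mul, Finset.mul_sum, Finset.sum_mul]
  simp only [h, R.coeff_zero, R.coeff]
  have e1 : TensorProduct.mapL (𝓑.B₀ ω - ∑ i, 𝓑.B ω i) (1 : E →L[ℂ] E) =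
      TensorProduct.mapL (𝓑.B₀ ω) 1 - ∑ i, TensorProduct.mapL (𝓑.B ω i) 1 := by
    apply ContinuousLinearMap.coe_inj.mp
    ext v x
    simp [TensorProduct.sub_tmul, TensorProduct.sum_tmul]
  have e2 : ∀ i, TensorProduct.mapL (𝓑.B ω i) (X i - 1) =
      TensorProduct.mapL (𝓑.B ω i) (X i) - TensorProduct.mapL (𝓑.B ω i) 1 := fun i => by
    apply ContinuousLinearMap.coe_inj.mp
    ext v x
    simp [TensorProduct.tmul_sub]
  rw [PencilFamily.pencil, e1]
  simp only [e2, Finset.sum_sub_distrib]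
  abel

variable [CompleteSpace E]

theorem isSelfAdjoint_mapL_one {n : ℕ} {T : FinSpace.{u} n →L[ℂ] FinSpace.{u} n}
    (hT : IsSelfAdjoint T) : IsSelfAdjoint (TensorProduct.mapL T (1 : E →L[ℂ] E)) := by
  have h : adjoint T = T := by rw [← star_eq_adjoint, hT.star_eq]
  have h1 : adjoint (1 : E →L[ℂ] E) = 1 := by rw [← star_eq_adjoint, star_one]
  rw [IsSelfAdjoint, star_eq_adjoint, TensorProduct.adjoint_mapL, h, h1]

theorem tp_proj (ω : PencilIndex.{u} k c₁ c₂) : IsStarProjection (R.tp E ω) :=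
  ⟨by
    change TensorProduct.mapL (R.p ω) 1 * TensorProduct.mapL (R.p ω) 1 = _
    rw [← TensorProduct.mapL_mul, (R.p_proj ω).isIdempotentElem.eq, one_mul]; rfl,
   isSelfAdjoint_mapL_one (R.p_proj ω).isSelfAdjoint⟩

theorem tensorProj_selfAdjoint (ω : PencilIndex.{u} k c₁ c₂) : IsSelfAdjoint (ω.tensorProj E) :=
  isSelfAdjoint_mapL_one (proj_selfAdjoint ω)

theorem tG_selfAdjoint (ω : PencilIndex.{u} k c₁ c₂) : IsSelfAdjoint (R.tG E ω) :=
  isSelfAdjoint_mapL_one (R.G_selfAdjoint ω)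

/-- The quadratic form of the linear part is a sum of quadratic forms of the operators `I ⊗ Xᵢ`. -/
theorem inner_lamLin (ω : PencilIndex.{u} k c₁ c₂) (X : Fin k → E →L[ℂ] E)
    (z w : FinSpace.{u} ω.n ⊗[ℂ] E) :
    ⟪z, R.lamLin ω X w⟫_ℂ = ∑ i, ⟪TensorProduct.mapL (R.s ω i) (1 : E →L[ℂ] E) z,
      TensorProduct.mapL 1 (X i) (TensorProduct.mapL (R.s ω i) (1 : E →L[ℂ] E) w)⟫_ℂ := by
  rw [lamLin, sum_apply, inner_sum]
  simp only [inner_mapL_star_mul_self]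

theorem inner_lam (ω : PencilIndex.{u} k c₁ c₂) (X : Fin k → E →L[ℂ] E)
    (z w : FinSpace.{u} ω.n ⊗[ℂ] E) :
    ⟪z, R.lam ω X w⟫_ℂ =
      ⟪TensorProduct.mapL (R.s₀ ω) (1 : E →L[ℂ] E) z,
          TensorProduct.mapL (R.s₀ ω) (1 : E →L[ℂ] E) w⟫_ℂ +
        ⟪z, R.lamLin ω X w⟫_ℂ := by
  rw [lam, add_apply, inner_add_right, inner_mapL_star_mul_self]
  congr 2
  have : TensorProduct.mapL (1 : FinSpace.{u} ω.n →L[ℂ] _) (1 : E →L[ℂ] E) = 1 :=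
    TensorProduct.mapL_id_id
  rw [this, one_apply_eq_self]

/-- The coefficients of the normalised pencil add up to the identity. -/
theorem norm_sq_eq (ω : PencilIndex.{u} k c₁ c₂) (z : FinSpace.{u} ω.n ⊗[ℂ] E) :
    ‖z‖ ^ 2 = ‖TensorProduct.mapL (R.s₀ ω) (1 : E →L[ℂ] E) z‖ ^ 2 +
      ∑ i, ‖TensorProduct.mapL (R.s ω i) (1 : E →L[ℂ] E) z‖ ^ 2 := by
  have h1 : R.lam ω (fun _ => (1 : E →L[ℂ] E)) = 1 := by
    have : TensorProduct.mapL (1 : FinSpace.{u} ω.n →L[ℂ] _) (1 : E →L[ℂ] E) = 1 :=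
      TensorProduct.mapL_id_id
    rw [← this, ← R.sum_coeff ω]
    apply ContinuousLinearMap.coe_inj.mp
    ext v x
    simp [lam, lamLin, TensorProduct.add_tmul, TensorProduct.sum_tmul]
  have h2 := congrArg Complex.re (R.inner_lam ω (fun _ => (1 : E →L[ℂ] E)) z z)
  have h3 : ∀ y : FinSpace.{u} ω.n ⊗[ℂ] E, TensorProduct.mapL 1 (1 : E →L[ℂ] E) y = y := fun y =>
    DFunLike.congr_fun (TensorProduct.mapL_id_id) y
  rw [inner_lamLin, h1, one_apply_eq_self, Complex.add_re, Complex.re_sum] at h2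
  simp only [h3] at h2
  have h4 : ∀ y : FinSpace.{u} ω.n ⊗[ℂ] E, (⟪y, y⟫_ℂ).re = ‖y‖ ^ 2 := fun y =>
    inner_self_eq_norm_sq (𝕜 := ℂ) y
  simpa only [h4] using h2

/-- The normalised pencil inherits lower bounds of the numerical ranges of its arguments. -/
theorem accretiveBound_lam (ω : PencilIndex.{u} k c₁ c₂) {c : ℂ} {δ : ℝ} (hc : δ ≤ c.re)
    {X : Fin k → E →L[ℂ] E} (hX : ∀ i, AccretiveBound c δ (X i)) :
    AccretiveBound c δ (R.lam ω X) := by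
  intro z
  rw [R.norm_sq_eq ω z, inner_lam, inner_lamLin, mul_add, mul_add, Complex.add_re,
    Finset.mul_sum, Finset.mul_sum, Complex.re_sum]
  refine add_le_add ?_ (Finset.sum_le_sum fun i _ => (hX i).mapL _)
  set y := TensorProduct.mapL (R.s₀ ω) (1 : E →L[ℂ] E) z
  have h4 : ⟪y, y⟫_ℂ = ((‖y‖ ^ 2 : ℝ) : ℂ) := by
    rw [Complex.ofReal_pow]; exact inner_self_eq_norm_sq_to_K y
  rw [h4, Complex.re_mul_ofReal]
  gcongr

end Realization

/-! ### The Schur complements of the pencils -/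

/-- After multiplication by `c` all the entries of the tuple `X`, and the identity, have real part
at least `δ > 0`. -/
structure AccretiveTuple {E : Type*} [NormedAddCommGroup E] [InnerProductSpace ℂ E] (c : ℂ) (δ : ℝ)
    (X : Fin k → E →L[ℂ] E) : Prop where
  pos : 0 < δ
  le_re : δ ≤ c.re
  bound : ∀ i, AccretiveBound c δ (X i)

theorem opNorm_mul_le' {V : Type*} [NormedAddCommGroup V] [NormedSpace ℂ V] {S T : V →L[ℂ] V}
    {a b : ℝ} (hS : ‖S‖ ≤ a) (hT : ‖T‖ ≤ b) : ‖S * T‖ ≤ a * b :=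
  (opNorm_comp_le S T).trans
    (mul_le_mul hS hT (opNorm_nonneg _) ((opNorm_nonneg _).trans hS))

theorem norm_short_le {H : Type*} [NormedAddCommGroup H] [InnerProductSpace ℂ H] [CompleteSpace H]
    {c : ℂ} {δ m : ℝ} {p Λ : H →L[ℂ] H} (hp : IsStarProjection p) (hδ : 0 < δ) (hc : δ ≤ c.re)
    (h : AccretiveBound c δ Λ) (hm : ‖Λ‖ ≤ m) : ‖short p Λ‖ ≤ m + m * (‖c‖ / δ) * m :=
  (norm_sub_le _ _).trans <| add_le_add hm <|
    opNorm_mul_le' (opNorm_mul_le' hm (norm_compInv_le hp hδ hc h)) hm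

namespace Realization

variable {𝓑 : PencilFamily.{u} k c₁ c₂} (R : Realization 𝓑)
variable {E : Type u} [NormedAddCommGroup E] [InnerProductSpace ℂ E]

/-- The normalised pencil, shorted by the range of the projection `p ⊗ I`. -/
def sh (ω : PencilIndex.{u} k c₁ c₂) (X : Fin k → E →L[ℂ] E) :
    FinSpace.{u} ω.n ⊗[ℂ] E →L[ℂ] FinSpace.{u} ω.n ⊗[ℂ] E :=
  short (R.tp E ω) (R.lam ω X)

variable (E) in
theorem one_sub_tensorProj (ω : PencilIndex.{u} k c₁ c₂) :
    1 - ω.tensorProj E = TensorProduct.mapL (1 - ω.proj) (1 : E →L[ℂ] E) := by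
  apply ContinuousLinearMap.coe_inj.mp
  ext v x
  simp [PencilIndex.tensorProj, TensorProduct.sub_tmul]

/-- The operator `(v v⋆ ⊗ I) (G ⊗ I)`. -/
def tPG (E : Type u) [NormedAddCommGroup E] [InnerProductSpace ℂ E]
    (ω : PencilIndex.{u} k c₁ c₂) :
    FinSpace.{u} ω.n ⊗[ℂ] E →L[ℂ] FinSpace.{u} ω.n ⊗[ℂ] E :=
  ω.tensorProj E * R.tG E ω

/-- The operator `(G ⊗ I) (v v⋆ ⊗ I)`. -/
def tGP (E : Type u) [NormedAddCommGroup E] [InnerProductSpace ℂ E]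
    (ω : PencilIndex.{u} k c₁ c₂) :
    FinSpace.{u} ω.n ⊗[ℂ] E →L[ℂ] FinSpace.{u} ω.n ⊗[ℂ] E :=
  R.tG E ω * ω.tensorProj E

theorem norm_tPG_le (ω : PencilIndex.{u} k c₁ c₂) : ‖R.tPG E ω‖ ≤ R.bound :=
  (opNorm_mul_le' (norm_tensorProj_le ω) (R.norm_tG_le ω)).trans_eq (one_mul _)

theorem norm_tGP_le (ω : PencilIndex.{u} k c₁ c₂) : ‖R.tGP E ω‖ ≤ R.bound :=
  (opNorm_mul_le' (R.norm_tG_le ω) (norm_tensorProj_le ω)).trans_eq (mul_one _)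

variable (E) in
/-- The relations between `G`, `W`, `p` and `q`, tensored with the identity. -/
theorem tensor_relations (ω : PencilIndex.{u} k c₁ c₂) :
    R.tG E ω * (1 - ω.tensorProj E) * TensorProduct.mapL (R.W ω) (1 : E →L[ℂ] E) = R.tp E ω ∧
    TensorProduct.mapL (R.W ω) (1 : E →L[ℂ] E) * (R.tG E ω * (1 - ω.tensorProj E)) =
      TensorProduct.mapL (R.q ω) (1 : E →L[ℂ] E) ∧
    TensorProduct.mapL (R.W ω) (1 : E →L[ℂ] E) * (R.tG E ω * (1 - ω.tensorProj E)) *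
      TensorProduct.mapL (R.W ω) (1 : E →L[ℂ] E) = TensorProduct.mapL (R.W ω) (1 : E →L[ℂ] E) ∧
    R.tG E ω * (1 - ω.tensorProj E) * TensorProduct.mapL (R.W ω) (1 : E →L[ℂ] E) *
      (R.tG E ω * (1 - ω.tensorProj E)) = R.tG E ω * (1 - ω.tensorProj E) := by
  simp only [one_sub_tensorProj, tG, tp, ← TensorProduct.mapL_mul, one_mul, R.mul_W, R.W_mul]
  refine ⟨trivial, trivial, ?_, ?_⟩
  · rw [← R.W_mul, R.W_mul_W]
  · rw [← R.mul_W, R.mul_W_mul]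

variable [CompleteSpace E]

theorem isUnit_pivot (ω : PencilIndex.{u} k c₁ c₂) {c : ℂ} {δ : ℝ} {X : Fin k → E →L[ℂ] E}
    (hX : AccretiveTuple c δ X) : IsUnit (pivot (R.tp E ω) (R.lam ω X)) :=
  ((R.accretiveBound_lam ω hX.le_re hX.bound).pivot (R.tp_proj ω) hX.le_re).isUnit hX.pos

theorem schurExists (R : Realization 𝓑) (ω : PencilIndex.{u} k c₁ c₂) {c : ℂ} {δ : ℝ}
    {X : Fin k → E →L[ℂ] E} (hX : AccretiveTuple c δ X) :
    SchurExists (ω.tensorProj E) (𝓑.pencil E ω X) := by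
  obtain ⟨h1, h2, h3, h4⟩ := R.tensor_relations E ω
  rw [SchurExists, R.pencil_eq]
  exact ⟨_, isMoorePenrose_pivotBlock (tensorProj_selfAdjoint ω) (R.tG_selfAdjoint ω)
    (R.tp_proj ω) (isSelfAdjoint_mapL_one (R.q_selfAdjoint ω)) (R.isUnit_pivot ω hX) h1 h2 h3 h4⟩

theorem inner_tPG (ω : PencilIndex.{u} k c₁ c₂) (z w : FinSpace.{u} ω.n ⊗[ℂ] E) :
    ⟪z, R.tPG E ω w⟫_ℂ = ⟪R.tGP E ω z, w⟫_ℂ := by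
  have h : R.tPG E ω = adjoint (R.tGP E ω) := by
    rw [← star_eq_adjoint, tGP, star_mul, (R.tG_selfAdjoint ω).star_eq,
      (tensorProj_selfAdjoint ω).star_eq, tPG]
  rw [h, adjoint_inner_right]

theorem block_eq (ω : PencilIndex.{u} k c₁ c₂) {c : ℂ} {δ : ℝ} {X : Fin k → E →L[ℂ] E}
    (hX : AccretiveTuple c δ X) : 𝓑.block E ω X = R.tPG E ω * R.sh ω X * R.tGP E ω := by
  obtain ⟨h1, h2, h3, h4⟩ := R.tensor_relations E ω
  rw [PencilFamily.block, R.pencil_eq]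
  exact schur_eq (tensorProj_selfAdjoint ω) (R.tG_selfAdjoint ω)
    (R.tp_proj ω) (isSelfAdjoint_mapL_one (R.q_selfAdjoint ω)) (R.isUnit_pivot ω hX) h1 h2 h3 h4

theorem inner_block (ω : PencilIndex.{u} k c₁ c₂) {c : ℂ} {δ : ℝ} {X : Fin k → E →L[ℂ] E}
    (hX : AccretiveTuple c δ X) (z : FinSpace.{u} ω.n ⊗[ℂ] E) :
    ⟪z, 𝓑.block E ω X z⟫_ℂ = ⟪R.tGP E ω z, R.sh ω X (R.tGP E ω z)⟫_ℂ := by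
  rw [R.block_eq ω hX, mul_apply_eq_comp, mul_apply_eq_comp, inner_tPG]

theorem norm_sh_le (ω : PencilIndex.{u} k c₁ c₂) {c : ℂ} {δ : ℝ} {X : Fin k → E →L[ℂ] E}
    (hX : AccretiveTuple c δ X) :
    ‖R.sh ω X‖ ≤ (1 + k * ‖X‖) + (1 + k * ‖X‖) * (‖c‖ / δ) * (1 + k * ‖X‖) :=
  norm_short_le (R.tp_proj ω) hX.pos hX.le_re (R.accretiveBound_lam ω hX.le_re hX.bound)
    (R.norm_lam_le ω X)

theorem norm_block_le {c : ℂ} {δ : ℝ} {X : Fin k → E →L[ℂ] E}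
    (hX : AccretiveTuple c δ X) (ω : PencilIndex.{u} k c₁ c₂) :
    ‖𝓑.block E ω X‖ ≤
      R.bound * ((1 + k * ‖X‖) + (1 + k * ‖X‖) * (‖c‖ / δ) * (1 + k * ‖X‖)) * R.bound := by
  rw [R.block_eq ω hX]
  exact opNorm_mul_le' (opNorm_mul_le' (R.norm_tPG_le ω) (R.norm_sh_le ω hX)) (R.norm_tGP_le ω)

theorem psiExists (R : Realization 𝓑) {c : ℂ} {δ : ℝ} {X : Fin k → E →L[ℂ] E}
    (hX : AccretiveTuple c δ X) : 𝓑.PsiExists E X :=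
  ⟨fun ω => R.schurExists ω hX, _, R.norm_block_le hX⟩

/-- An operator intertwining two tuples intertwines the Schur complements of the pencils. -/
theorem block_intertwine (R : Realization 𝓑) {E' : Type u} [NormedAddCommGroup E']
    [InnerProductSpace ℂ E'] [CompleteSpace E'] (ω : PencilIndex.{u} k c₁ c₂) {c c' : ℂ} {δ δ' : ℝ}
    {X : Fin k → E →L[ℂ] E} {X' : Fin k → E' →L[ℂ] E'} (hX : AccretiveTuple c δ X)
    (hX' : AccretiveTuple c' δ' X') (J : E →L[ℂ] E') (h : ∀ i, X' i ∘L J = J ∘L X i) :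
    𝓑.block E' ω X' ∘L TensorProduct.mapL 1 J = TensorProduct.mapL 1 J ∘L 𝓑.block E ω X := by
  have hT : ∀ T : FinSpace.{u} ω.n →L[ℂ] FinSpace.{u} ω.n,
      TensorProduct.mapL T (1 : E' →L[ℂ] E') ∘L TensorProduct.mapL 1 J =
        TensorProduct.mapL 1 J ∘L TensorProduct.mapL T (1 : E →L[ℂ] E) := fun T => by
    rw [← TensorProduct.mapL_comp, ← TensorProduct.mapL_comp]
    rfl
  have hTX : ∀ (T : FinSpace.{u} ω.n →L[ℂ] FinSpace.{u} ω.n) (i : Fin k),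
      TensorProduct.mapL T (X' i) ∘L TensorProduct.mapL 1 J =
        TensorProduct.mapL 1 J ∘L TensorProduct.mapL T (X i) := fun T i => by
    rw [← TensorProduct.mapL_comp, ← TensorProduct.mapL_comp, h]
    rfl
  have hlam : R.lam ω X' ∘L TensorProduct.mapL 1 J =
      TensorProduct.mapL 1 J ∘L R.lam ω X := by
    have e0 := fun z => DFunLike.congr_fun (hT (star (R.s₀ ω) * R.s₀ ω)) z
    have e1 := fun i z => DFunLike.congr_fun (hTX (star (R.s ω i) * R.s ω i) i) z
    simp only [comp_apply] at e0 e1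
    refine ContinuousLinearMap.ext fun z => ?_
    simp only [lam, lamLin, comp_apply, add_apply, sum_apply, map_add, map_sum, e0, e1]
  have hsh := short_intertwine (R.isUnit_pivot ω hX) (R.isUnit_pivot ω hX') (hT (R.p ω)) hlam
  have e1 := fun z => DFunLike.congr_fun hsh z
  have e2 := fun z => DFunLike.congr_fun (hT (R.G ω)) z
  have e3 := fun z => DFunLike.congr_fun (hT ω.proj) z
  simp only [comp_apply] at e1 e2 e3
  rw [R.block_eq ω hX, R.block_eq ω hX']
  refine ContinuousLinearMap.ext fun z => ?_
  simp only [comp_apply, mul_apply_eq_comp, tPG, tGP, tG, sh, PencilIndex.tensorProj, e1, e2, e3]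

end Realization

/-! ### Direct sums of uniformly bounded families -/

section BigDirSum

variable {E : Type u} [NormedAddCommGroup E] [InnerProductSpace ℂ E]

/-- The family `T` is uniformly bounded. -/
def UniformlyBounded (T : ∀ ω : PencilIndex.{u} k c₁ c₂,
    FinSpace.{u} ω.n ⊗[ℂ] E →L[ℂ] FinSpace.{u} ω.n ⊗[ℂ] E) : Prop :=
  ∃ K : ℝ, ∀ ω, ‖T ω‖ ≤ K

variable {S T : ∀ ω : PencilIndex.{u} k c₁ c₂,
    FinSpace.{u} ω.n ⊗[ℂ] E →L[ℂ] FinSpace.{u} ω.n ⊗[ℂ] E}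

theorem bigDirSum_apply (hT : UniformlyBounded T) (h : BigTensor.{u} k c₁ c₂ E)
    (ω : PencilIndex.{u} k c₁ c₂) : bigDirSum T h ω = T ω (h ω) := by
  obtain ⟨K, hK⟩ := hT
  have hex : ∃ K : ℝ, 0 ≤ K ∧ ∀ ω, ‖T ω‖ ≤ K :=
    ⟨max K 0, le_max_right _ _, fun ω => (hK ω).trans (le_max_left _ _)⟩
  rw [bigDirSum, dif_pos hex]
  rfl

theorem norm_bigDirSum_le {K : ℝ} (hK : 0 ≤ K) (hT : ∀ ω, ‖T ω‖ ≤ K) : ‖bigDirSum T‖ ≤ K := by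
  have h : bigDirSum T = lp.mapCLM 2 T hK hT := by
    refine ContinuousLinearMap.ext fun h => ?_
    ext ω : 2
    rw [bigDirSum_apply ⟨K, hT⟩]
    rfl
  rw [h]
  exact lp.norm_mapCLM_le _ _ _ _

theorem bigDirSum_ext {A : BigTensor.{u} k c₁ c₂ E →L[ℂ] BigTensor.{u} k c₁ c₂ E}
    (hT : UniformlyBounded T) (h : ∀ h ω, A h ω = T ω (h ω)) : A = bigDirSum T := by
  refine ContinuousLinearMap.ext fun x => ?_
  ext ω : 2
  rw [bigDirSum_apply hT, h]

theorem UniformlyBounded.mul (hS : UniformlyBounded S) (hT : UniformlyBounded T) :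
    UniformlyBounded fun ω => S ω * T ω := by
  obtain ⟨K, hK⟩ := hS
  obtain ⟨L, hL⟩ := hT
  exact ⟨K * L, fun ω => opNorm_mul_le' (hK ω) (hL ω)⟩

theorem UniformlyBounded.add (hS : UniformlyBounded S) (hT : UniformlyBounded T) :
    UniformlyBounded fun ω => S ω + T ω := by
  obtain ⟨K, hK⟩ := hS
  obtain ⟨L, hL⟩ := hT
  exact ⟨K + L, fun ω => (opNorm_add_le _ _).trans (add_le_add (hK ω) (hL ω))⟩

theorem UniformlyBounded.smul (a : ℂ) (hT : UniformlyBounded T) :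
    UniformlyBounded fun ω => a • T ω := by
  obtain ⟨L, hL⟩ := hT
  exact ⟨‖a‖ * L, fun ω => (opNorm_smul_le a _).trans
    (mul_le_mul_of_nonneg_left (hL ω) (norm_nonneg a))⟩

theorem UniformlyBounded.one : UniformlyBounded fun ω : PencilIndex.{u} k c₁ c₂ =>
    (1 : FinSpace.{u} ω.n ⊗[ℂ] E →L[ℂ] FinSpace.{u} ω.n ⊗[ℂ] E) :=
  ⟨1, fun _ => norm_id_le⟩

theorem bigDirSum_mul (hS : UniformlyBounded S) (hT : UniformlyBounded T) :
    bigDirSum S * bigDirSum T = bigDirSum fun ω => S ω * T ω :=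
  bigDirSum_ext (hS.mul hT) fun h ω => by
    rw [mul_apply_eq_comp, bigDirSum_apply hS, bigDirSum_apply hT, mul_apply_eq_comp]

theorem bigDirSum_add (hS : UniformlyBounded S) (hT : UniformlyBounded T) :
    bigDirSum S + bigDirSum T = bigDirSum fun ω => S ω + T ω :=
  bigDirSum_ext (hS.add hT) fun h ω => by
    rw [add_apply, lp.coeFn_add, Pi.add_apply, bigDirSum_apply hS, bigDirSum_apply hT, add_apply]

theorem bigDirSum_smul (a : ℂ) (hT : UniformlyBounded T) :
    a • bigDirSum T = bigDirSum fun ω => a • T ω :=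
  bigDirSum_ext (hT.smul a) fun h ω => by
    rw [smul_apply, lp.coeFn_smul, Pi.smul_apply, bigDirSum_apply hT, smul_apply]

theorem bigDirSum_one : bigDirSum (fun ω : PencilIndex.{u} k c₁ c₂ =>
    (1 : FinSpace.{u} ω.n ⊗[ℂ] E →L[ℂ] FinSpace.{u} ω.n ⊗[ℂ] E)) = 1 :=
  (bigDirSum_ext .one fun _ _ => rfl).symm

end BigDirSum

/-! ### Real and imaginary parts of an operator as quadratic forms -/

section Parts

variable {V : Type*} [NormedAddCommGroup V] [InnerProductSpace ℂ V] [CompleteSpace V]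

theorem inner_selfAdjoint_im {T : V →L[ℂ] V} (hT : IsSelfAdjoint T) (x : V) :
    (⟪x, T x⟫_ℂ).im = 0 := by
  have h := (isSelfAdjoint_iff_isSymmetric.1 hT).im_inner_self_apply x
  exact h

theorem re_inner_realPart (T : V →L[ℂ] V) (x : V) :
    (⟪x, (ℜ T : V →L[ℂ] V) x⟫_ℂ).re = (⟪x, T x⟫_ℂ).re := by
  have h := inner_selfAdjoint_im (ℑ T).2 x
  conv_rhs => rw [← realPart_add_I_smul_imaginaryPart T]
  rw [add_apply, smul_apply, inner_add_right, inner_smul_right]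
  simp [h]

theorem re_inner_imaginaryPart (T : V →L[ℂ] V) (x : V) :
    (⟪x, (ℑ T : V →L[ℂ] V) x⟫_ℂ).re = (⟪x, T x⟫_ℂ).im := by
  have h := inner_selfAdjoint_im (ℜ T).2 x
  conv_rhs => rw [← realPart_add_I_smul_imaginaryPart T]
  rw [add_apply, smul_apply, inner_add_right, inner_smul_right]
  simp [h]

theorem nonneg_iff_re_inner {T : V →L[ℂ] V} (hT : IsSelfAdjoint T) :
    0 ≤ T ↔ ∀ x, 0 ≤ (⟪x, T x⟫_ℂ).re := by
  rw [nonneg_iff_isPositive, isPositive_def']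
  refine ⟨fun h x => ?_, fun h => ⟨hT, fun x => ?_⟩⟩
  · have := h.2 x
    rwa [reApplyInnerSelf_apply, inner_re_symm] at this
  · rw [reApplyInnerSelf_apply, inner_re_symm]
    exact h x

theorem le_iff_re_inner {S T : V →L[ℂ] V} (hT : IsSelfAdjoint (T - S)) :
    S ≤ T ↔ ∀ x, (⟪x, S x⟫_ℂ).re ≤ (⟪x, T x⟫_ℂ).re := by
  rw [← sub_nonneg, nonneg_iff_re_inner hT]
  refine forall_congr' fun x => ?_
  rw [sub_apply, inner_sub_right, Complex.sub_re, sub_nonneg]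

theorem realPart_nonneg_of_re_inner {T : V →L[ℂ] V} (h : ∀ x, 0 ≤ (⟪x, T x⟫_ℂ).re) :
    0 ≤ (ℜ T : V →L[ℂ] V) :=
  (nonneg_iff_re_inner (ℜ T).2).2 fun x => (re_inner_realPart T x).symm ▸ h x

end Parts

/-! ### Analyticity of the direct sum -/

theorem opSmul_sum {V V' ι : Type*} [NormedAddCommGroup V] [NormedSpace ℂ V]
    [NormedAddCommGroup V'] [NormedSpace ℂ V'] [Fintype ι] (a : ℂ) (T : ι → V →L[ℂ] V') :
    a • ∑ i, T i = ∑ i, a • T i :=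
  Finset.smul_sum

theorem pivot_eq_add {H : Type*} [NormedAddCommGroup H] [InnerProductSpace ℂ H] [CompleteSpace H]
    (p Λ : H →L[ℂ] H) : pivot p Λ = p * Λ * p + (1 + (-1 : ℂ) • p) := by
  rw [pivot, neg_one_smul, sub_eq_add_neg]

namespace Realization

variable {𝓑 : PencilFamily.{u} k c₁ c₂} (R : Realization 𝓑)
variable {E : Type u} [NormedAddCommGroup E] [InnerProductSpace ℂ E]

theorem uniformlyBounded_lam (X : Fin k → E →L[ℂ] E) : UniformlyBounded fun ω => R.lam ω X :=
  ⟨_, fun ω => R.norm_lam_le ω X⟩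

theorem uniformlyBounded_lamLin (X : Fin k → E →L[ℂ] E) :
    UniformlyBounded fun ω => R.lamLin ω X :=
  ⟨_, fun ω => R.norm_lamLin_le ω X⟩

theorem uniformlyBounded_const : UniformlyBounded fun ω =>
    TensorProduct.mapL (star (R.s₀ ω) * R.s₀ ω) (1 : E →L[ℂ] E) :=
  ⟨1, fun ω => (norm_mapL_one_le _).trans (opNorm_star_mul_self_le (R.norm_s₀_le ω))⟩

theorem uniformlyBounded_tp : UniformlyBounded fun ω => R.tp E ω := ⟨1, R.norm_tp_le⟩

theorem uniformlyBounded_tPG : UniformlyBounded fun ω => R.tPG E ω := ⟨_, R.norm_tPG_le⟩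

theorem uniformlyBounded_tGP : UniformlyBounded fun ω => R.tGP E ω := ⟨_, R.norm_tGP_le⟩

theorem lamLin_add (ω : PencilIndex.{u} k c₁ c₂) (X Y : Fin k → E →L[ℂ] E) :
    R.lamLin ω (X + Y) = R.lamLin ω X + R.lamLin ω Y := by
  simp only [lamLin, Pi.add_apply, TensorProduct.mapL_add_right, Finset.sum_add_distrib]

theorem lamLin_smul (ω : PencilIndex.{u} k c₁ c₂) (a : ℂ) (X : Fin k → E →L[ℂ] E) :
    R.lamLin ω (a • X) = a • R.lamLin ω X := by
  rw [lamLin, lamLin, opSmul_sum]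
  exact Finset.sum_congr rfl fun i _ => TensorProduct.mapL_smul_right _ _ _

theorem lam_convexComb (ω : PencilIndex.{u} k c₁ c₂) (X Y : Fin k → E →L[ℂ] E) {s t : ℝ}
    (hst : s + t = 1) : R.lam ω (fun i => (s : ℂ) • X i + (t : ℂ) • Y i) =
      (s : ℂ) • R.lam ω X + (t : ℂ) • R.lam ω Y := by
  have h : R.lamLin ω (fun i => (s : ℂ) • X i + (t : ℂ) • Y i) =
      (s : ℂ) • R.lamLin ω X + (t : ℂ) • R.lamLin ω Y := by
    rw [← R.lamLin_smul ω, ← R.lamLin_smul ω, ← R.lamLin_add ω]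
    rfl
  have hst' : (s : ℂ) + t = 1 := by exact_mod_cast hst
  rw [lam, lam, lam, h]
  refine ContinuousLinearMap.ext fun z => ?_
  simp only [add_apply, smul_apply, smul_add]
  rw [add_add_add_comm, ← add_smul, hst', one_smul]

variable (E) in
/-- The direct sum of the linear parts of the normalised pencils, as a linear map. -/
def bigLamLin : (Fin k → E →L[ℂ] E) →L[ℂ]
    (BigTensor.{u} k c₁ c₂ E →L[ℂ] BigTensor.{u} k c₁ c₂ E) :=
  LinearMap.mkContinuous
    { toFun := fun X => bigDirSum fun ω => R.lamLin ω X
      map_add' := fun X Y => by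
        rw [bigDirSum_add (R.uniformlyBounded_lamLin X) (R.uniformlyBounded_lamLin Y)]
        simp only [lamLin_add]
      map_smul' := fun a X => by
        rw [RingHom.id_apply, bigDirSum_smul a (R.uniformlyBounded_lamLin X)]
        simp only [lamLin_smul] }
    k fun X => norm_bigDirSum_le (by positivity) fun ω => R.norm_lamLin_le ω X

variable (E) in
theorem analyticAt_bigLam (X : Fin k → E →L[ℂ] E) :
    AnalyticAt ℂ (fun Y : Fin k → E →L[ℂ] E => bigDirSum fun ω => R.lam ω Y) X := by
  have h : (fun Y : Fin k → E →L[ℂ] E => bigDirSum fun ω => R.lam ω Y) = fun Y =>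
      bigDirSum (fun ω => TensorProduct.mapL (star (R.s₀ ω) * R.s₀ ω) (1 : E →L[ℂ] E)) +
        R.bigLamLin E Y := funext fun Y =>
    (bigDirSum_add R.uniformlyBounded_const (R.uniformlyBounded_lamLin Y)).symm
  rw [h]
  exact analyticAt_const.add (ContinuousLinearMap.analyticAt _ _)

variable [CompleteSpace E]

theorem bigDirSum_pivot (X : Fin k → E →L[ℂ] E) :
    pivot (bigDirSum fun ω => R.tp E ω) (bigDirSum fun ω => R.lam ω X) =
      bigDirSum fun ω => pivot (R.tp E ω) (R.lam ω X) := by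
  have h1 := R.uniformlyBounded_tp (E := E)
  have h2 := R.uniformlyBounded_lam X
  have e : ∀ ω, pivot (R.tp E ω) (R.lam ω X) =
      R.tp E ω * R.lam ω X * R.tp E ω + (1 + (-1 : ℂ) • R.tp E ω) := fun ω => pivot_eq_add _ _
  simp only [e]
  rw [← bigDirSum_add ((h1.mul h2).mul h1) (UniformlyBounded.one.add (h1.smul _)),
    ← bigDirSum_add UniformlyBounded.one (h1.smul _), ← bigDirSum_mul (h1.mul h2) h1,
    ← bigDirSum_mul h1 h2, ← bigDirSum_smul _ h1, bigDirSum_one]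
  exact pivot_eq_add _ _

/-- The pivots of the pencils have uniformly bounded inverses, so they can be inverted in the direct
sum. -/
theorem bigDirSum_inverse {c : ℂ} {δ : ℝ} {X : Fin k → E →L[ℂ] E} (hX : AccretiveTuple c δ X) :
    UniformlyBounded (fun ω => Ring.inverse (pivot (R.tp E ω) (R.lam ω X))) ∧
    IsUnit (pivot (bigDirSum fun ω => R.tp E ω) (bigDirSum fun ω => R.lam ω X)) ∧
    Ring.inverse (pivot (bigDirSum fun ω => R.tp E ω) (bigDirSum fun ω => R.lam ω X)) =
      bigDirSum fun ω => Ring.inverse (pivot (R.tp E ω) (R.lam ω X)) := by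
  have hb : UniformlyBounded (fun ω => Ring.inverse (pivot (R.tp E ω) (R.lam ω X))) :=
    ⟨_, fun ω => ((R.accretiveBound_lam ω hX.le_re hX.bound).pivot (R.tp_proj ω)
      hX.le_re).norm_inverse_le hX.pos⟩
  have h1 := R.uniformlyBounded_tp (E := E)
  have h2 := R.uniformlyBounded_lam X
  have hN : UniformlyBounded fun ω => pivot (R.tp E ω) (R.lam ω X) := by
    have e : ∀ ω, pivot (R.tp E ω) (R.lam ω X) =
        R.tp E ω * R.lam ω X * R.tp E ω + (1 + (-1 : ℂ) • R.tp E ω) := fun ω => pivot_eq_add _ _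
    simp only [e]
    exact ((h1.mul h2).mul h1).add (UniformlyBounded.one.add (h1.smul _))
  rw [bigDirSum_pivot]
  let N : (BigTensor.{u} k c₁ c₂ E →L[ℂ] BigTensor.{u} k c₁ c₂ E)ˣ :=
    { val := bigDirSum fun ω => pivot (R.tp E ω) (R.lam ω X)
      inv := bigDirSum fun ω => Ring.inverse (pivot (R.tp E ω) (R.lam ω X))
      val_inv := by
        rw [bigDirSum_mul hN hb, ← bigDirSum_one]
        congr 1
        funext ω
        exact Ring.mul_inverse_cancel _ (R.isUnit_pivot ω hX)
      inv_val := by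
        rw [bigDirSum_mul hb hN, ← bigDirSum_one]
        congr 1
        funext ω
        exact Ring.inverse_mul_cancel _ (R.isUnit_pivot ω hX) }
  exact ⟨hb, N.isUnit, Ring.inverse_unit N⟩

/-- The direct sum of the Schur complements is a rational expression in the direct sum of the
normalised pencils, which is affine in `X`. -/
theorem psi_eq {c : ℂ} {δ : ℝ} {X : Fin k → E →L[ℂ] E} (hX : AccretiveTuple c δ X) :
    𝓑.Psi E X = (bigDirSum fun ω => R.tPG E ω) *
      short (bigDirSum fun ω => R.tp E ω) (bigDirSum fun ω => R.lam ω X) *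
        bigDirSum fun ω => R.tGP E ω := by
  obtain ⟨hb, -, hinv⟩ := R.bigDirSum_inverse hX
  refine (bigDirSum_ext ⟨_, R.norm_block_le hX⟩ fun h ω => ?_).symm
  rw [R.block_eq ω hX]
  simp only [short, compInv, hinv, mul_apply_eq_comp, sub_apply, sh]
  rw [bigDirSum_apply R.uniformlyBounded_tPG, lp.coeFn_sub, Pi.sub_apply,
    bigDirSum_apply (R.uniformlyBounded_lam X), bigDirSum_apply (R.uniformlyBounded_lam X),
    bigDirSum_apply hb, bigDirSum_apply R.uniformlyBounded_tp,
    bigDirSum_apply (R.uniformlyBounded_lam X), bigDirSum_apply R.uniformlyBounded_tGP]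

theorem analyticAt_psi (R : Realization 𝓑) {X : Fin k → E →L[ℂ] E} {c : ℂ} {δ : ℝ}
    (hX : AccretiveTuple c δ X) (h : ∀ᶠ Y in 𝓝 X, ∃ c δ, AccretiveTuple c δ Y) :
    AnalyticAt ℂ (𝓑.Psi E) X := by
  have hL := R.analyticAt_bigLam E X
  obtain ⟨-, ⟨N, hN⟩, -⟩ := R.bigDirSum_inverse hX
  set P := bigDirSum fun ω => R.tp E ω
  have hpiv : AnalyticAt ℂ (fun Y : Fin k → E →L[ℂ] E =>
      pivot P (bigDirSum fun ω => R.lam ω Y)) X :=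
    ((analyticAt_const.mul hL).mul analyticAt_const).add analyticAt_const
  have hinv : AnalyticAt ℂ (fun Y : Fin k → E →L[ℂ] E =>
      Ring.inverse (pivot P (bigDirSum fun ω => R.lam ω Y))) X :=
    AnalyticAt.fun_comp (g := Ring.inverse) (by
      rw [← hN]; exact analyticAt_inverse N) hpiv
  have hsh : AnalyticAt ℂ (fun Y : Fin k → E →L[ℂ] E =>
      short P (bigDirSum fun ω => R.lam ω Y)) X :=
    hL.sub ((hL.mul (hinv.mul analyticAt_const)).mul hL)
  refine ((analyticAt_const.mul hsh).mul analyticAt_const).congr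
    (h.mono fun Y ⟨c', δ', hY⟩ => (R.psi_eq hY).symm)

end Realization

/-! ### Slice maps -/

section Slice

variable {E : Type u} [NormedAddCommGroup E] [InnerProductSpace ℂ E]

theorem inner_contractFin (n : ℕ) (x : E) (h : FinSpace.{u} n) (z : FinSpace.{u} n ⊗[ℂ] E) :
    ⟪h, contractFin n x z⟫_ℂ = ⟪h ⊗ₜ[ℂ] x, z⟫_ℂ := by
  induction z with
  | zero => simp
  | add z w hz hw => rw [map_add, inner_add_right, inner_add_right, hz, hw]
  | tmul v y => rw [contractFin_tmul, TensorProduct.inner_tmul, inner_smul_right, mul_comm]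

theorem inner_contractVec (x : E) (h : BigSpace.{u} k c₁ c₂) (z : BigTensor.{u} k c₁ c₂ E) :
    ⟪h, contractVec k c₁ c₂ x z⟫_ℂ = ⟪insertVec k c₁ c₂ x h, z⟫_ℂ := by
  rw [lp.inner_eq_tsum, lp.inner_eq_tsum]
  exact tsum_congr fun ω => inner_contractFin _ _ _ _

variable {w : (BigSpace.{u} k c₁ c₂ →L[ℂ] BigSpace.{u} k c₁ c₂) →L[ℂ] ℂ}

theorem IsState.im_eq_zero (hw : IsState w) {T : BigSpace.{u} k c₁ c₂ →L[ℂ] BigSpace.{u} k c₁ c₂}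
    (hT : IsSelfAdjoint T) : (w T).im = 0 := by
  have h1 : 0 ≤ algebraMap ℝ _ ‖T‖ - T := sub_nonneg.2 hT.le_algebraMap_norm_self
  have h2 := (hw.nonneg _ h1).2
  have h3 : algebraMap ℝ (BigSpace.{u} k c₁ c₂ →L[ℂ] BigSpace.{u} k c₁ c₂) ‖T‖ =
      (‖T‖ : ℂ) • 1 := by
    rw [Algebra.algebraMap_eq_smul_one]; rfl
  rw [map_sub, h3, map_smul, hw.map_one] at h2
  simpa using h2

/-- A state maps accretive operators, self-adjoint or not, to numbers with nonnegative real part. -/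
theorem IsState.re_nonneg (hw : IsState w) {T : BigSpace.{u} k c₁ c₂ →L[ℂ] BigSpace.{u} k c₁ c₂}
    (hT : ∀ h, 0 ≤ (⟪h, T h⟫_ℂ).re) : 0 ≤ (w T).re := by
  have h1 := realPart_nonneg_of_re_inner hT
  have h2 := (hw.nonneg _ h1).1
  have h3 := hw.im_eq_zero (ℑ T).2
  rw [← realPart_add_I_smul_imaginaryPart T, map_add, map_smul, Complex.add_re]
  simp [h3, h2]

variable [CompleteSpace E]

theorem re_inner_slice_nonneg (hw : IsState w)
    {T : BigTensor.{u} k c₁ c₂ E →L[ℂ] BigTensor.{u} k c₁ c₂ E}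
    (hT : ∀ h, 0 ≤ (⟪h, T h⟫_ℂ).re) (x : E) : 0 ≤ (⟪x, slice w T x⟫_ℂ).re := by
  rw [inner_slice]
  refine hw.re_nonneg fun h => ?_
  rw [comp_apply, inner_contractVec]
  exact hT _

theorem slice_add (S T : BigTensor.{u} k c₁ c₂ E →L[ℂ] BigTensor.{u} k c₁ c₂ E) :
    slice w (S + T) = slice w S + slice w T := by
  refine ContinuousLinearMap.ext fun x => ext_inner_left ℂ fun y => ?_
  rw [add_apply, inner_add_right]
  simp only [inner_slice]
  rw [← map_add]
  congr 1
  ext h : 1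
  simp

theorem slice_smul (a : ℂ) (T : BigTensor.{u} k c₁ c₂ E →L[ℂ] BigTensor.{u} k c₁ c₂ E) :
    slice w (a • T) = a • slice w T := by
  refine ContinuousLinearMap.ext fun x => ext_inner_left ℂ fun y => ?_
  rw [smul_apply, inner_smul_right]
  simp only [inner_slice]
  rw [← smul_eq_mul, ← map_smul]
  congr 1
  ext h : 1
  simp

theorem norm_slice_le (T : BigTensor.{u} k c₁ c₂ E →L[ℂ] BigTensor.{u} k c₁ c₂ E) :
    ‖slice w T‖ ≤ ‖w‖ * ‖T‖ := by
  have hwT : 0 ≤ ‖w‖ * ‖T‖ := mul_nonneg (opNorm_nonneg _) (opNorm_nonneg _)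
  refine opNorm_le_bound _ hwT fun x => ?_
  have key : ∀ y : E, ‖⟪y, slice w T x⟫_ℂ‖ ≤ ‖w‖ * ‖T‖ * ‖x‖ * ‖y‖ := fun y => by
    rw [inner_slice]
    have h1 : ‖contractVec k c₁ c₂ y‖ ≤ ‖y‖ := lp.norm_mapCLM_le _ _ _ _
    have h2 : ‖insertVec k c₁ c₂ x‖ ≤ ‖x‖ := lp.norm_mapCLM_le _ _ _ _
    calc ‖w (contractVec k c₁ c₂ y ∘L T ∘L insertVec k c₁ c₂ x)‖
        ≤ ‖w‖ * ‖contractVec k c₁ c₂ y ∘L T ∘L insertVec k c₁ c₂ x‖ := w.le_opNorm _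
      _ ≤ ‖w‖ * (‖contractVec k c₁ c₂ y‖ * (‖T‖ * ‖insertVec k c₁ c₂ x‖)) := by
          gcongr
          refine (ContinuousLinearMap.opNorm_comp_le _ _).trans ?_
          gcongr
          exact ContinuousLinearMap.opNorm_comp_le _ _
      _ ≤ ‖w‖ * (‖y‖ * (‖T‖ * ‖x‖)) := by gcongr
      _ = _ := by ring
  have h := key (slice w T x)
  generalize slice w T x = u at h ⊢
  generalize ‖w‖ * ‖T‖ = m at h hwT ⊢
  rw [inner_self_eq_norm_sq_to_K, norm_pow, RCLike.norm_ofReal, abs_norm, sq] at h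
  rcases (norm_nonneg u).eq_or_lt with h0 | h0
  · rw [← h0]
    exact mul_nonneg hwT (norm_nonneg x)
  · exact le_of_mul_le_mul_right h h0

variable (E w) in
theorem isLinearMap_slice : IsLinearMap ℂ
    (fun T : BigTensor.{u} k c₁ c₂ E →L[ℂ] BigTensor.{u} k c₁ c₂ E => slice w T) :=
  { map_add := fun S T => slice_add S T
    map_smul := fun a T => slice_smul a T }

variable (E w) in
/-- The slice map as a continuous linear map. -/
def sliceL : (BigTensor.{u} k c₁ c₂ E →L[ℂ] BigTensor.{u} k c₁ c₂ E) →L[ℂ] (E →L[ℂ] E) :=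
  LinearMap.mkContinuous (isLinearMap_slice E w).mk' ‖w‖ fun T => norm_slice_le T

theorem slice_intertwine {E' : Type u} [NormedAddCommGroup E'] [InnerProductSpace ℂ E']
    [CompleteSpace E'] {T : ∀ ω : PencilIndex.{u} k c₁ c₂,
      FinSpace.{u} ω.n ⊗[ℂ] E →L[ℂ] FinSpace.{u} ω.n ⊗[ℂ] E}
    {T' : ∀ ω : PencilIndex.{u} k c₁ c₂,
      FinSpace.{u} ω.n ⊗[ℂ] E' →L[ℂ] FinSpace.{u} ω.n ⊗[ℂ] E'}
    (hT : UniformlyBounded T) (hT' : UniformlyBounded T') (J : E →L[ℂ] E')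
    (h : ∀ ω, T' ω ∘L TensorProduct.mapL 1 J = TensorProduct.mapL 1 J ∘L T ω) :
    slice w (bigDirSum T') ∘L J = J ∘L slice w (bigDirSum T) := by
  refine ContinuousLinearMap.ext fun x => ext_inner_left ℂ fun y => ?_
  rw [comp_apply, comp_apply, ← adjoint_inner_left J (slice w (bigDirSum T) x) y, inner_slice,
    inner_slice]
  congr 1
  refine ContinuousLinearMap.ext fun v => ?_
  ext ω : 2
  simp only [comp_apply]
  rw [contractVec_apply, contractVec_apply, bigDirSum_apply hT, bigDirSum_apply hT',
    insertVec_apply, insertVec_apply]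
  have h1 := DFunLike.congr_fun (h ω) (v ω ⊗ₜ[ℂ] x)
  simp only [comp_apply, TensorProduct.mapL_tmul, one_apply_eq_self] at h1
  rw [h1]
  refine ext_inner_left ℂ fun g => ?_
  have h2 : ∀ z : FinSpace.{u} ω.n ⊗[ℂ] E, contractFin ω.n y (TensorProduct.mapL 1 J z) =
      contractFin ω.n (adjoint J y) z := fun z => by
    induction z with
    | zero => simp
    | add z z' hz hz' => rw [map_add, map_add, map_add, hz, hz']
    | tmul v' x' =>
      rw [TensorProduct.mapL_tmul, contractFin_tmul, contractFin_tmul, adjoint_inner_left,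
        one_apply_eq_self]
  rw [h2]

end Slice

/-! ### The positive cone and the poly-halfspaces -/

section Forms

variable {E E' : Type u} [NormedAddCommGroup E] [InnerProductSpace ℂ E]
  [NormedAddCommGroup E'] [InnerProductSpace ℂ E']

/-- The accretive tuples form an open set. -/
theorem AccretiveTuple.eventually {c : ℂ} {δ : ℝ} {X : Fin k → E →L[ℂ] E}
    (hX : AccretiveTuple c δ X) : ∀ᶠ Y in 𝓝 X, ∃ c δ, AccretiveTuple c δ Y := by
  have hc : 0 < ‖c‖ := norm_pos_iff.2 fun h => by
    have := hX.pos.trans_le hX.le_re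
    simp [h] at this
  have hr : 0 < δ / (2 * ‖c‖) := by have := hX.pos; positivity
  filter_upwards [Metric.ball_mem_nhds X hr] with Y hY
  refine ⟨c, δ / 2, half_pos hX.pos, (half_le_self hX.pos.le).trans hX.le_re, fun i x => ?_⟩
  have h1 : ‖Y i - X i‖ ≤ δ / (2 * ‖c‖) :=
    (norm_le_pi_norm (Y - X) i).trans (mem_ball_iff_norm.1 hY).le
  have h2 : ‖c * ⟪x, (Y i - X i) x⟫_ℂ‖ ≤ δ / 2 * ‖x‖ ^ 2 := by
    calc ‖c * ⟪x, (Y i - X i) x⟫_ℂ‖ ≤ ‖c‖ * (‖x‖ * (δ / (2 * ‖c‖) * ‖x‖)) := by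
          rw [norm_mul]
          gcongr
          refine (norm_inner_le_norm _ _).trans ?_
          gcongr
          exact (Y i - X i).le_of_opNorm_le h1 x
      _ = _ := by field_simp
  have h3 := neg_le_of_abs_le ((Complex.abs_re_le_norm _).trans h2)
  have h4 : c * ⟪x, Y i x⟫_ℂ = c * ⟪x, X i x⟫_ℂ + c * ⟪x, (Y i - X i) x⟫_ℂ := by
    rw [← mul_add, ← inner_add_right, sub_apply, add_sub_cancel]
  have h5 := hX.bound i x
  rw [h4, Complex.add_re]
  linarith

theorem unitaryConj_apply (U : E ≃ₗᵢ[ℂ] E') (T : E →L[ℂ] E) (y : E') :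
    unitaryConj U T y = U (T (U.symm y)) := rfl

theorem inner_unitaryConj (U : E ≃ₗᵢ[ℂ] E') (T : E →L[ℂ] E) (y : E') :
    ⟪y, unitaryConj U T y⟫_ℂ = ⟪U.symm y, T (U.symm y)⟫_ℂ := by
  rw [unitaryConj_apply, ← U.symm.inner_map_map, U.symm_apply_apply]

theorem inner_dirSum (S : E →L[ℂ] E) (T : E' →L[ℂ] E') (z : WithLp 2 (E × E')) :
    ⟪z, dirSum S T z⟫_ℂ = ⟪z.fst, S z.fst⟫_ℂ + ⟪z.snd, T z.snd⟫_ℂ := rfl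

end Forms

section Halfspaces

variable {E E' : Type u} [NormedAddCommGroup E] [InnerProductSpace ℂ E] [CompleteSpace E]
  [NormedAddCommGroup E'] [InnerProductSpace ℂ E'] [CompleteSpace E']

theorem isSelfAdjoint_real_smul_one (ε : ℝ) : IsSelfAdjoint ((ε : ℂ) • (1 : E →L[ℂ] E)) := by
  rw [IsSelfAdjoint, star_smul, star_one, RCLike.star_def, Complex.conj_ofReal]

theorem real_smul_one_le_iff {A : E →L[ℂ] E} (hA : IsSelfAdjoint A) (ε : ℝ) :
    (ε : ℂ) • (1 : E →L[ℂ] E) ≤ A ↔ ∀ x, ε * ‖x‖ ^ 2 ≤ (⟪x, A x⟫_ℂ).re := by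
  rw [le_iff_re_inner (hA.sub (isSelfAdjoint_real_smul_one ε))]
  refine forall_congr' fun x => ?_
  rw [smul_apply, one_apply_eq_self, inner_smul_right, Complex.re_ofReal_mul]
  have : (⟪x, x⟫_ℂ).re = ‖x‖ ^ 2 := inner_self_eq_norm_sq (𝕜 := ℂ) x
  rw [this]

theorem IsStrictlyPos.isSelfAdjoint {A : E →L[ℂ] E} (h : IsStrictlyPos A) : IsSelfAdjoint A := by
  obtain ⟨ε, -, h⟩ := h
  have h1 := (IsSelfAdjoint.of_nonneg (sub_nonneg.2 h)).add (isSelfAdjoint_real_smul_one (E := E) ε)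
  rwa [sub_add_cancel] at h1

theorem isStrictlyPos_iff {A : E →L[ℂ] E} (hA : IsSelfAdjoint A) :
    IsStrictlyPos A ↔ ∃ ε : ℝ, 0 < ε ∧ ∀ x, ε * ‖x‖ ^ 2 ≤ (⟪x, A x⟫_ℂ).re :=
  exists_congr fun _ => and_congr_right fun _ => real_smul_one_le_iff hA _

theorem mem_rightHalf_iff {X : Fin k → E →L[ℂ] E} : X ∈ rightHalf k E ↔
    ∀ i, ∃ ε : ℝ, 0 < ε ∧ ∀ x, ε * ‖x‖ ^ 2 ≤ (⟪x, X i x⟫_ℂ).re :=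
  forall_congr' fun i => by
    rw [isStrictlyPos_iff (ℜ (X i)).2]
    simp only [re_inner_realPart]

theorem mem_upperHalf_iff {X : Fin k → E →L[ℂ] E} : X ∈ upperHalf k E ↔
    ∀ i, ∃ ε : ℝ, 0 < ε ∧ ∀ x, ε * ‖x‖ ^ 2 ≤ (⟪x, X i x⟫_ℂ).im :=
  forall_congr' fun i => by
    rw [isStrictlyPos_iff (ℑ (X i)).2]
    simp only [re_inner_imaginaryPart]

theorem mem_posCone_iff {X : Fin k → E →L[ℂ] E} : X ∈ posCone k E ↔
    ∀ i, IsSelfAdjoint (X i) ∧ ∃ ε : ℝ, 0 < ε ∧ ∀ x, ε * ‖x‖ ^ 2 ≤ (⟪x, X i x⟫_ℂ).re :=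
  forall_congr' fun _ => ⟨fun h => ⟨h.isSelfAdjoint, (isStrictlyPos_iff h.isSelfAdjoint).1 h⟩,
    fun h => (isStrictlyPos_iff h.1).2 h.2⟩

theorem posCone_subset_rightHalf : posCone k E ⊆ rightHalf k E := fun _ hX =>
  mem_rightHalf_iff.2 fun i => (mem_posCone_iff.1 hX i).2

theorem exists_common_bound {ε : Fin k → ℝ} (hε : ∀ i, 0 < ε i) :
    ∃ δ : ℝ, 0 < δ ∧ δ ≤ 1 ∧ ∀ i, δ ≤ ε i := by
  have h : ∀ᶠ δ : ℝ in 𝓝[>] 0, 0 < δ ∧ δ ≤ 1 ∧ ∀ i, δ ≤ ε i := by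
    refine (eventually_mem_nhdsWithin).and (Eventually.and ?_ (eventually_all.2 fun i => ?_))
    · exact nhdsWithin_le_nhds (eventually_le_nhds zero_lt_one)
    · exact nhdsWithin_le_nhds (eventually_le_nhds (hε i))
  exact h.exists

theorem exists_bound_of_mem_rightHalf {X : Fin k → E →L[ℂ] E} (hX : X ∈ rightHalf k E) :
    ∃ ε : ℝ, 0 < ε ∧ ε ≤ 1 ∧ ∀ i x, ε * ‖x‖ ^ 2 ≤ (⟪x, X i x⟫_ℂ).re := by
  choose ε hε h using mem_rightHalf_iff.1 hX
  obtain ⟨δ, hδ, hδ1, hδε⟩ := exists_common_bound hε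
  exact ⟨δ, hδ, hδ1, fun i x =>
    (mul_le_mul_of_nonneg_right (hδε i) (sq_nonneg _)).trans (h i x)⟩

theorem exists_bound_of_mem_upperHalf {X : Fin k → E →L[ℂ] E} (hX : X ∈ upperHalf k E) :
    ∃ ε : ℝ, 0 < ε ∧ ∀ i x, ε * ‖x‖ ^ 2 ≤ (⟪x, X i x⟫_ℂ).im := by
  choose ε hε h using mem_upperHalf_iff.1 hX
  obtain ⟨δ, hδ, -, hδε⟩ := exists_common_bound hε
  exact ⟨δ, hδ, fun i x =>
    (mul_le_mul_of_nonneg_right (hδε i) (sq_nonneg _)).trans (h i x)⟩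

/-- On both poly-halfspaces the entries become accretive after multiplication by a number with
positive real part. -/
theorem exists_accretiveTuple {X : Fin k → E →L[ℂ] E}
    (hX : X ∈ rightHalf k E ∪ upperHalf k E) : ∃ c δ, AccretiveTuple c δ X := by
  rcases hX with hX | hX
  · obtain ⟨ε, hε, hε1, h⟩ := exists_bound_of_mem_rightHalf hX
    exact ⟨1, ε, hε, by simpa using hε1, fun i x => by simpa using h i x⟩
  · obtain ⟨ε, hε, h⟩ := exists_bound_of_mem_upperHalf hX
    -- rotating by `a - i` with `a` small makes all the entries accretive
    set a := ε / (‖X‖ + 1) with ha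
    have hX0 := norm_nonneg X
    have ha0 : 0 < a := by positivity
    refine ⟨a - Complex.I, a, ha0, by simp, fun i x => ?_⟩
    have h1 : |(⟪x, X i x⟫_ℂ).re| ≤ ‖X‖ * ‖x‖ ^ 2 := by
      calc |(⟪x, X i x⟫_ℂ).re| ≤ ‖⟪x, X i x⟫_ℂ‖ := Complex.abs_re_le_norm _
        _ ≤ ‖x‖ * ‖X i x‖ := norm_inner_le_norm _ _
        _ ≤ ‖x‖ * (‖X‖ * ‖x‖) := by
          gcongr
          exact (X i).le_of_opNorm_le (norm_le_pi_norm X i) x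
        _ = _ := by ring
    have h2 := h i x
    have h3 : a * (‖X‖ + 1) = ε := by rw [ha]; field_simp
    have h4 : ((a - Complex.I) * ⟪x, X i x⟫_ℂ).re = a * (⟪x, X i x⟫_ℂ).re + (⟪x, X i x⟫_ℂ).im := by
      simp
    rw [h4]
    have h5 := mul_le_mul_of_nonneg_left (neg_le_of_abs_le h1) ha0.le
    rw [← h3] at h2
    linarith

theorem unitaryConj_mem_rightHalf (U : E ≃ₗᵢ[ℂ] E') {X : Fin k → E →L[ℂ] E}
    (hX : X ∈ rightHalf k E) : (fun i => unitaryConj U (X i)) ∈ rightHalf k E' := by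
  refine mem_rightHalf_iff.2 fun i => ?_
  obtain ⟨ε, hε, h⟩ := mem_rightHalf_iff.1 hX i
  refine ⟨ε, hε, fun x => ?_⟩
  rw [inner_unitaryConj, ← U.symm.norm_map]
  exact h _

theorem unitaryConj_mem_upperHalf (U : E ≃ₗᵢ[ℂ] E') {X : Fin k → E →L[ℂ] E}
    (hX : X ∈ upperHalf k E) : (fun i => unitaryConj U (X i)) ∈ upperHalf k E' := by
  refine mem_upperHalf_iff.2 fun i => ?_
  obtain ⟨ε, hε, h⟩ := mem_upperHalf_iff.1 hX i
  refine ⟨ε, hε, fun x => ?_⟩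
  rw [inner_unitaryConj, ← U.symm.norm_map]
  exact h _

theorem dirSum_mem_rightHalf {X : Fin k → E →L[ℂ] E} {Y : Fin k → E' →L[ℂ] E'}
    (hX : X ∈ rightHalf k E) (hY : Y ∈ rightHalf k E') :
    (fun i => dirSum (X i) (Y i)) ∈ rightHalf k (WithLp 2 (E × E')) := by
  refine mem_rightHalf_iff.2 fun i => ?_
  obtain ⟨ε, hε, h⟩ := mem_rightHalf_iff.1 hX i
  obtain ⟨δ, hδ, h'⟩ := mem_rightHalf_iff.1 hY i
  refine ⟨min ε δ, lt_min hε hδ, fun z => ?_⟩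
  rw [inner_dirSum, WithLp.prod_norm_sq_eq_of_L2, mul_add, Complex.add_re]
  refine add_le_add ((mul_le_mul_of_nonneg_right (min_le_left _ _) (sq_nonneg _)).trans (h _))
    ((mul_le_mul_of_nonneg_right (min_le_right _ _) (sq_nonneg _)).trans (h' _))

theorem dirSum_mem_upperHalf {X : Fin k → E →L[ℂ] E} {Y : Fin k → E' →L[ℂ] E'}
    (hX : X ∈ upperHalf k E) (hY : Y ∈ upperHalf k E') :
    (fun i => dirSum (X i) (Y i)) ∈ upperHalf k (WithLp 2 (E × E')) := by
  refine mem_upperHalf_iff.2 fun i => ?_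
  obtain ⟨ε, hε, h⟩ := mem_upperHalf_iff.1 hX i
  obtain ⟨δ, hδ, h'⟩ := mem_upperHalf_iff.1 hY i
  refine ⟨min ε δ, lt_min hε hδ, fun z => ?_⟩
  rw [inner_dirSum, WithLp.prod_norm_sq_eq_of_L2, mul_add, Complex.add_im]
  refine add_le_add ((mul_le_mul_of_nonneg_right (min_le_left _ _) (sq_nonneg _)).trans (h _))
    ((mul_le_mul_of_nonneg_right (min_le_right _ _) (sq_nonneg _)).trans (h' _))

end Halfspaces

/-- A graded map that respects all intertwiners between tuples of the domain is free. -/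
theorem isFree_of_intertwine {D : GradedSet.{u} k} {F : GradedMap.{u} k}
    (h1 : ∀ (E E' : Type u) [NormedAddCommGroup E] [InnerProductSpace ℂ E] [CompleteSpace E]
      [NormedAddCommGroup E'] [InnerProductSpace ℂ E'] [CompleteSpace E']
      (U : E ≃ₗᵢ[ℂ] E') (X : Fin k → E →L[ℂ] E), X ∈ D E → (fun i => unitaryConj U (X i)) ∈ D E')
    (h2 : ∀ (E E' : Type u) [NormedAddCommGroup E] [InnerProductSpace ℂ E] [CompleteSpace E]
      [NormedAddCommGroup E'] [InnerProductSpace ℂ E'] [CompleteSpace E']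
      (X : Fin k → E →L[ℂ] E) (Y : Fin k → E' →L[ℂ] E'), X ∈ D E → Y ∈ D E' →
        (fun i => dirSum (X i) (Y i)) ∈ D (WithLp 2 (E × E')))
    (h3 : ∀ (E E' : Type u) [NormedAddCommGroup E] [InnerProductSpace ℂ E] [CompleteSpace E]
      [NormedAddCommGroup E'] [InnerProductSpace ℂ E'] [CompleteSpace E']
      (X : Fin k → E →L[ℂ] E) (X' : Fin k → E' →L[ℂ] E') (J : E →L[ℂ] E'), X ∈ D E → X' ∈ D E' →
        (∀ i, X' i ∘L J = J ∘L X i) → F E' X' ∘L J = J ∘L F E X) : IsFree D F where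
  unitary_mem E E' _ _ _ _ _ _ U X hX := h1 E E' U X hX
  unitary E E' _ _ _ _ _ _ U X hX := by
    have h := h3 E E' X _ (U.toContinuousLinearEquiv : E →L[ℂ] E') hX (h1 E E' U X hX) fun i => by
      refine ContinuousLinearMap.ext fun x => ?_
      change U (X i (U.symm (U x))) = U (X i x)
      rw [U.symm_apply_apply]
    refine ContinuousLinearMap.ext fun y => ?_
    have h' := DFunLike.congr_fun h (U.symm y)
    change F E' (fun i => unitaryConj U (X i)) (U (U.symm y)) = U (F E X (U.symm y)) at h'
    rwa [U.apply_symm_apply] at h'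
  dirSum_mem E E' _ _ _ _ _ _ X Y hX hY := h2 E E' X Y hX hY
  dirSum E E' _ _ _ _ _ _ X Y hX hY := by
    set e := ((WithLp.prodContinuousLinearEquiv 2 ℂ E E').symm : (E × E') →L[ℂ] WithLp 2 (E × E'))
    have hl := h3 E _ X _ (e ∘L ContinuousLinearMap.inl ℂ E E') hX (h2 E E' X Y hX hY) fun i => by
      refine ContinuousLinearMap.ext fun x => ?_
      change WithLp.toLp 2 (X i x, Y i 0) = WithLp.toLp 2 (X i x, 0)
      rw [map_zero]
    have hr := h3 E' _ Y _ (e ∘L ContinuousLinearMap.inr ℂ E E') hY (h2 E E' X Y hX hY) fun i => by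
      refine ContinuousLinearMap.ext fun x => ?_
      change WithLp.toLp 2 (X i 0, Y i x) = WithLp.toLp 2 (0, Y i x)
      rw [map_zero]
    refine ContinuousLinearMap.ext fun z => ?_
    have hl' := DFunLike.congr_fun hl z.fst
    have hr' := DFunLike.congr_fun hr z.snd
    have hz : z = e (z.fst, 0) + e (0, z.snd) := by
      rw [← map_add, Prod.mk_add_mk, add_zero, zero_add]
      rfl
    have hd : FreeLoewner.dirSum (F E X) (F E' Y) z = e (F E X z.fst, 0) + e (0, F E' Y z.snd) := by
      rw [← map_add, Prod.mk_add_mk, add_zero, zero_add]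
      rfl
    rw [hd]
    conv_lhs => rw [hz, map_add]
    exact congrArg₂ (· + ·) hl' hr'

/-! ### Order properties of the slice function -/

namespace Realization

variable {𝓑 : PencilFamily.{u} k c₁ c₂}
variable {E E' : Type u} [NormedAddCommGroup E] [InnerProductSpace ℂ E] [CompleteSpace E]
  [NormedAddCommGroup E'] [InnerProductSpace ℂ E'] [CompleteSpace E']
variable {w : (BigSpace.{u} k c₁ c₂ →L[ℂ] BigSpace.{u} k c₁ c₂) →L[ℂ] ℂ}

theorem uniformlyBounded_block (R : Realization 𝓑) {c : ℂ} {δ : ℝ} {X : Fin k → E →L[ℂ] E}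
    (hX : AccretiveTuple c δ X) : UniformlyBounded fun ω => 𝓑.block E ω X :=
  ⟨_, R.norm_block_le hX⟩

theorem sliceFun_intertwine (R : Realization 𝓑) {X : Fin k → E →L[ℂ] E}
    {X' : Fin k → E' →L[ℂ] E'} (hX : ∃ c δ, AccretiveTuple c δ X)
    (hX' : ∃ c δ, AccretiveTuple c δ X') (J : E →L[ℂ] E') (h : ∀ i, X' i ∘L J = J ∘L X i) :
    𝓑.sliceFun w E' X' ∘L J = J ∘L 𝓑.sliceFun w E X := by
  obtain ⟨c, δ, hX⟩ := hX
  obtain ⟨c', δ', hX'⟩ := hX'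
  exact slice_intertwine (R.uniformlyBounded_block hX) (R.uniformlyBounded_block hX') J
    fun ω => R.block_intertwine ω hX hX' J h

theorem analyticAt_sliceFun (R : Realization 𝓑) {X : Fin k → E →L[ℂ] E}
    (hX : ∃ c δ, AccretiveTuple c δ X) : AnalyticAt ℂ (𝓑.sliceFun w E) X := by
  obtain ⟨c, δ, hX⟩ := hX
  exact ((sliceL E w).analyticAt _).comp (R.analyticAt_psi hX hX.eventually)

/-- Inequalities between the quadratic forms of the shorted pencils carry over to the slice
function. -/
theorem re_sum_sliceFun_nonneg (R : Realization 𝓑) (hw : IsState w) {ι : Type*} (s : Finset ι)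
    (a : ι → ℂ) {X : ι → Fin k → E →L[ℂ] E} {c : ι → ℂ} {δ : ι → ℝ}
    (hX : ∀ j, AccretiveTuple (c j) (δ j) (X j))
    (h : ∀ ω η, 0 ≤ (∑ j ∈ s, a j * ⟪η, R.sh ω (X j) η⟫_ℂ).re) (x : E) :
    0 ≤ (∑ j ∈ s, a j * ⟪x, 𝓑.sliceFun w E (X j) x⟫_ℂ).re := by
  have h1 : ∀ y, 0 ≤ (⟪y, (∑ j ∈ s, a j • 𝓑.Psi E (X j)) y⟫_ℂ).re := fun y => by
    have e : ⟪y, (∑ j ∈ s, a j • 𝓑.Psi E (X j)) y⟫_ℂ = ∑ j ∈ s, a j * ⟪y, 𝓑.Psi E (X j) y⟫_ℂ := by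
      rw [sum_apply, inner_sum]
      exact Finset.sum_congr rfl fun j _ => inner_smul_right _ _ _
    have hs := hasSum_sum (s := s) fun j _ =>
      (lp.hasSum_inner (𝕜 := ℂ) y (𝓑.Psi E (X j) y)).mul_left (a j)
    rw [e]
    refine (hs.mapL Complex.reCLM).nonneg fun ω => ?_
    have e2 : ∀ j ∈ s, a j * ⟪y ω, 𝓑.Psi E (X j) y ω⟫_ℂ =
        a j * ⟪R.tGP E ω (y ω), R.sh ω (X j) (R.tGP E ω (y ω))⟫_ℂ := fun j _ => by
      rw [PencilFamily.Psi, bigDirSum_apply (R.uniformlyBounded_block (hX j)),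
        R.inner_block ω (hX j)]
    rw [Finset.sum_congr rfl e2]
    exact h ω _
  have h2 := re_inner_slice_nonneg hw h1 x
  have e : slice w (∑ j ∈ s, a j • 𝓑.Psi E (X j)) = ∑ j ∈ s, a j • 𝓑.sliceFun w E (X j) := by
    have := map_sum (sliceL E w) (fun j => a j • 𝓑.Psi E (X j)) s
    refine this.trans (Finset.sum_congr rfl fun j _ => ?_)
    exact map_smul (sliceL E w) (a j) (𝓑.Psi E (X j))
  rw [e, sum_apply, inner_sum] at h2
  simpa only [smul_apply, inner_smul_right] using h2

theorem re_sliceFun_nonneg (R : Realization 𝓑) (hw : IsState w) (a : ℂ) {X : Fin k → E →L[ℂ] E}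
    (hX : ∃ c δ, AccretiveTuple c δ X) (h : ∀ ω η, 0 ≤ (a * ⟪η, R.sh ω X η⟫_ℂ).re) (x : E) :
    0 ≤ (a * ⟪x, 𝓑.sliceFun w E X x⟫_ℂ).re := by
  obtain ⟨c, δ, hX⟩ := hX
  have := R.re_sum_sliceFun_nonneg hw {()} (fun _ => a) (fun _ => hX)
    (fun ω η => by simpa using h ω η) x
  simpa using this

variable {X Y : Fin k → E →L[ℂ] E}

theorem adjoint_mapL_star_mul_self {n : ℕ} (T : FinSpace.{u} n →L[ℂ] FinSpace.{u} n)
    {A : E →L[ℂ] E} (hA : IsSelfAdjoint A) :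
    adjoint (TensorProduct.mapL (star T * T) A) = TensorProduct.mapL (star T * T) A := by
  rw [TensorProduct.adjoint_mapL, ← star_eq_adjoint, ← star_eq_adjoint, star_mul, star_star,
    hA.star_eq]

theorem adjoint_lamLin (R : Realization 𝓑) (ω : PencilIndex.{u} k c₁ c₂)
    (hX : ∀ i, IsSelfAdjoint (X i)) : adjoint (R.lamLin ω X) = R.lamLin ω X := by
  rw [lamLin, map_sum]
  exact Finset.sum_congr rfl fun i _ => adjoint_mapL_star_mul_self _ (hX i)

theorem lamLin_nonneg (R : Realization 𝓑) (ω : PencilIndex.{u} k c₁ c₂) (hX : ∀ i, 0 ≤ X i) :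
    0 ≤ R.lamLin ω X := by
  refine (nonneg_iff_re_inner (R.adjoint_lamLin ω fun i => .of_nonneg (hX i))).2 fun z => ?_
  rw [inner_lamLin, Complex.re_sum]
  refine Finset.sum_nonneg fun i _ => ?_
  have h0 : AccretiveBound 1 0 (X i) := fun x => by
    simpa using (nonneg_iff_re_inner (.of_nonneg (hX i))).1 (hX i) x
  simpa using h0.mapL (TensorProduct.mapL (R.s ω i) (1 : E →L[ℂ] E) z)

theorem lam_nonneg (R : Realization 𝓑) (ω : PencilIndex.{u} k c₁ c₂) (hX : ∀ i, 0 ≤ X i) :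
    0 ≤ R.lam ω X := by
  have hsa : adjoint (R.lam ω X) = R.lam ω X := by
    rw [lam, map_add, adjoint_mapL_star_mul_self _ (.one _),
      R.adjoint_lamLin ω fun i => .of_nonneg (hX i)]
  refine (nonneg_iff_re_inner hsa).2 fun z => ?_
  have h0 : AccretiveBound 1 0 (R.lam ω X) := R.accretiveBound_lam ω (by simp) fun i x => by
    simpa using (nonneg_iff_re_inner (.of_nonneg (hX i))).1 (hX i) x
  simpa using h0 z

theorem lam_mono (R : Realization 𝓑) (ω : PencilIndex.{u} k c₁ c₂) (hXY : ∀ i, X i ≤ Y i) :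
    R.lam ω X ≤ R.lam ω Y := by
  have h := R.lamLin_nonneg (X := Y - X) ω fun i => sub_nonneg.2 (hXY i)
  have e : R.lam ω Y = R.lam ω X + R.lamLin ω (Y - X) := by
    rw [lam, lam, add_assoc, ← R.lamLin_add, add_sub_cancel]
  rw [e]
  exact le_add_of_nonneg_right h

theorem nonneg_of_mem_posCone (hX : X ∈ posCone k E) (i : Fin k) : 0 ≤ X i := by
  obtain ⟨hsa, ε, hε, h⟩ := mem_posCone_iff.1 hX i
  exact (nonneg_iff_re_inner hsa).2 fun x => (by positivity : 0 ≤ ε * ‖x‖ ^ 2).trans (h x)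

theorem exists_accretiveTuple_posCone (hX : X ∈ posCone k E) : ∃ c δ, AccretiveTuple c δ X :=
  exists_accretiveTuple (Or.inl (posCone_subset_rightHalf hX))

theorem inner_sh (R : Realization 𝓑) (ω : PencilIndex.{u} k c₁ c₂)
    (hX : ∃ c δ, AccretiveTuple c δ X) (η : FinSpace.{u} ω.n ⊗[ℂ] E) :
    ⟪η, R.sh ω X η⟫_ℂ = ⟪shortVec (R.tp E ω) (R.lam ω X) η,
      R.lam ω X (shortVec (R.tp E ω) (R.lam ω X) η)⟫_ℂ := by
  obtain ⟨c, δ, hX⟩ := hX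
  exact inner_short (R.tp_proj ω) (R.isUnit_pivot ω hX) η

theorem inner_sh_nonneg (R : Realization 𝓑) (ω : PencilIndex.{u} k c₁ c₂) (hX : X ∈ posCone k E)
    (η : FinSpace.{u} ω.n ⊗[ℂ] E) : 0 ≤ (⟪η, R.sh ω X η⟫_ℂ).re ∧ (⟪η, R.sh ω X η⟫_ℂ).im = 0 := by
  rw [R.inner_sh ω (exists_accretiveTuple_posCone hX)]
  have h := R.lam_nonneg ω (nonneg_of_mem_posCone hX)
  exact ⟨(nonneg_iff_re_inner (.of_nonneg h)).1 h _, inner_selfAdjoint_im (.of_nonneg h) _⟩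

theorem isSelfAdjoint_sliceFun (R : Realization 𝓑) (hw : IsState w) (hX : X ∈ posCone k E) :
    IsSelfAdjoint (𝓑.sliceFun w E X) := by
  have hX' := exists_accretiveTuple_posCone hX
  rw [isSelfAdjoint_iff_isSymmetric, LinearMap.isSymmetric_iff_inner_map_self_real]
  intro x
  rw [coe_coe, Complex.conj_eq_iff_im, ← inner_conj_symm, Complex.conj_im, neg_eq_zero]
  -- the forms of the shorted pencils are real, so inequalities with the factors `i` and `-i` hold
  have h : ∀ a : ℂ, a.re = 0 → 0 ≤ (a * ⟪x, 𝓑.sliceFun w E X x⟫_ℂ).re := fun a ha =>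
    R.re_sliceFun_nonneg hw a hX' (fun ω η => by
      rw [Complex.mul_re, ha, (R.inner_sh_nonneg ω hX η).2]; simp) x
  have h1 := h Complex.I (by simp)
  have h2 := h (-Complex.I) (by simp)
  simp only [Complex.mul_re, Complex.neg_re, Complex.neg_im, Complex.I_re, Complex.I_im] at h1 h2
  linarith

theorem sliceFun_mono (R : Realization 𝓑) (hw : IsState w) (hX : X ∈ posCone k E)
    (hY : Y ∈ posCone k E) (hXY : ∀ i, X i ≤ Y i) : 𝓑.sliceFun w E X ≤ 𝓑.sliceFun w E Y := by
  rw [le_iff_re_inner ((R.isSelfAdjoint_sliceFun hw hY).sub (R.isSelfAdjoint_sliceFun hw hX))]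
  intro x
  obtain ⟨c, δ, hX'⟩ := exists_accretiveTuple_posCone hX
  obtain ⟨c', δ', hY'⟩ := exists_accretiveTuple_posCone hY
  have := R.re_sum_sliceFun_nonneg hw Finset.univ ![1, -1] (X := ![Y, X]) (c := ![c', c])
    (δ := ![δ', δ]) (fun j => by fin_cases j <;> assumption) (fun ω η => by
      have := re_inner_short_mono (R.tp_proj ω) (R.isUnit_pivot ω hX') (R.isUnit_pivot ω hY')
        (R.lam_nonneg ω (nonneg_of_mem_posCone hX)) (R.lam_mono ω hXY) η
      simpa [Fin.sum_univ_two, sh] using this) x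
  simpa [Fin.sum_univ_two] using this

theorem posCone_convexComb (hX : X ∈ posCone k E) (hY : Y ∈ posCone k E) {s t : ℝ} (hs : 0 ≤ s)
    (ht : 0 ≤ t) (hst : s + t = 1) : (fun i => (s : ℂ) • X i + (t : ℂ) • Y i) ∈ posCone k E := by
  refine mem_posCone_iff.2 fun i => ?_
  obtain ⟨hXs, ε, hε, h⟩ := mem_posCone_iff.1 hX i
  obtain ⟨hYs, δ, hδ, h'⟩ := mem_posCone_iff.1 hY i
  refine ⟨?_, min ε δ, lt_min hε hδ, fun x => ?_⟩
  · rw [IsSelfAdjoint, star_add, star_smul, star_smul, hXs.star_eq, hYs.star_eq]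
    simp
  · rw [add_apply, inner_add_right, smul_apply, smul_apply, inner_smul_right, inner_smul_right,
      Complex.add_re, Complex.re_ofReal_mul, Complex.re_ofReal_mul]
    have h1 := mul_le_mul_of_nonneg_left
      ((mul_le_mul_of_nonneg_right (min_le_left ε δ) (sq_nonneg ‖x‖)).trans (h x)) hs
    have h2 := mul_le_mul_of_nonneg_left
      ((mul_le_mul_of_nonneg_right (min_le_right ε δ) (sq_nonneg ‖x‖)).trans (h' x)) ht
    calc min ε δ * ‖x‖ ^ 2 = s * (min ε δ * ‖x‖ ^ 2) + t * (min ε δ * ‖x‖ ^ 2) := by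
          rw [← add_mul, hst, one_mul]
      _ ≤ _ := add_le_add h1 h2

theorem sliceFun_concave (R : Realization 𝓑) (hw : IsState w) (hX : X ∈ posCone k E)
    (hY : Y ∈ posCone k E) {s t : ℝ} (hs : 0 ≤ s) (ht : 0 ≤ t) (hst : s + t = 1) :
    (s : ℂ) • 𝓑.sliceFun w E X + (t : ℂ) • 𝓑.sliceFun w E Y ≤
      𝓑.sliceFun w E (fun i => (s : ℂ) • X i + (t : ℂ) • Y i) := by
  have hZ := posCone_convexComb hX hY hs ht hst
  have hsa := (R.isSelfAdjoint_sliceFun hw hX)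
  have hsb := (R.isSelfAdjoint_sliceFun hw hY)
  have hsc : IsSelfAdjoint ((s : ℂ) • 𝓑.sliceFun w E X + (t : ℂ) • 𝓑.sliceFun w E Y) := by
    rw [IsSelfAdjoint, star_add, star_smul, star_smul, hsa.star_eq, hsb.star_eq]
    simp
  rw [le_iff_re_inner ((R.isSelfAdjoint_sliceFun hw hZ).sub hsc)]
  intro x
  obtain ⟨c, δ, hX'⟩ := exists_accretiveTuple_posCone hX
  obtain ⟨c', δ', hY'⟩ := exists_accretiveTuple_posCone hY
  obtain ⟨c'', δ'', hZ'⟩ := exists_accretiveTuple_posCone hZ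
  have := R.re_sum_sliceFun_nonneg hw Finset.univ ![1, -s, -t]
    (X := ![fun i => (s : ℂ) • X i + (t : ℂ) • Y i, X, Y]) (c := ![c'', c, c'])
    (δ := ![δ'', δ, δ']) (fun j => by fin_cases j <;> assumption) (fun ω η => by
      have hN := R.isUnit_pivot ω hZ'
      rw [R.lam_convexComb ω X Y hst] at hN
      have := re_inner_short_concave hs ht (R.tp_proj ω) (R.isUnit_pivot ω hX')
        (R.isUnit_pivot ω hY') hN (R.lam_nonneg ω (nonneg_of_mem_posCone hX))
        (R.lam_nonneg ω (nonneg_of_mem_posCone hY)) η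
      simp only [Fin.sum_univ_three, sh, Matrix.cons_val_zero, Matrix.cons_val_one,
        Matrix.cons_val, R.lam_convexComb ω X Y hst, Complex.add_re, neg_mul, Complex.neg_re,
        Complex.re_ofReal_mul, one_mul]
      linarith) x
  rw [add_apply, inner_add_right, smul_apply, smul_apply, inner_smul_right, inner_smul_right,
    Complex.add_re, Complex.re_ofReal_mul, Complex.re_ofReal_mul]
  simp only [Fin.sum_univ_three, Matrix.cons_val_zero, Matrix.cons_val_one,
    Matrix.cons_val, Complex.add_re, neg_mul, Complex.neg_re, Complex.re_ofReal_mul,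
    one_mul] at this
  linarith

/-! ### The imaginary part on the upper poly-halfspace -/

/-- On the upper poly-halfspace the imaginary part of the normalised pencil controls the parts of
its argument on which the linear coefficients act. -/
theorem lower_im_lam (R : Realization 𝓑) (ω : PencilIndex.{u} k c₁ c₂) {ε : ℝ}
    (h : ∀ i x, ε * ‖x‖ ^ 2 ≤ (⟪x, X i x⟫_ℂ).im) (z : FinSpace.{u} ω.n ⊗[ℂ] E) :
    ε * ∑ i, ‖TensorProduct.mapL (R.s ω i) (1 : E →L[ℂ] E) z‖ ^ 2 ≤ (⟪z, R.lam ω X z⟫_ℂ).im := by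
  rw [inner_lam, inner_lamLin, Complex.add_im, Complex.im_sum, Finset.mul_sum]
  have h0 : (⟪TensorProduct.mapL (R.s₀ ω) (1 : E →L[ℂ] E) z,
      TensorProduct.mapL (R.s₀ ω) (1 : E →L[ℂ] E) z⟫_ℂ).im = 0 := inner_self_im (𝕜 := ℂ) _
  rw [h0, zero_add]
  refine Finset.sum_le_sum fun i _ => ?_
  have h1 : AccretiveBound (-Complex.I) ε (X i) := fun x => by simpa using h i x
  simpa using h1.mapL (TensorProduct.mapL (R.s ω i) (1 : E →L[ℂ] E) z)

theorem norm_inner_lamLin_le (R : Realization 𝓑) (ω : PencilIndex.{u} k c₁ c₂)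
    (z w : FinSpace.{u} ω.n ⊗[ℂ] E) :
    ‖⟪z, R.lamLin ω X w⟫_ℂ‖ ≤ ∑ i, ‖X‖ * (‖TensorProduct.mapL (R.s ω i) (1 : E →L[ℂ] E) z‖ *
      ‖TensorProduct.mapL (R.s ω i) (1 : E →L[ℂ] E) w‖) := by
  rw [inner_lamLin]
  refine (norm_sum_le _ _).trans (Finset.sum_le_sum fun i _ => ?_)
  generalize TensorProduct.mapL (R.s ω i) (1 : E →L[ℂ] E) z = z'
  generalize TensorProduct.mapL (R.s ω i) (1 : E →L[ℂ] E) w = w'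
  have h1 : ‖TensorProduct.mapL (1 : FinSpace.{u} ω.n →L[ℂ] FinSpace.{u} ω.n) (X i)‖ ≤ ‖X‖ :=
    (TensorProduct.norm_mapL_le _ _).trans <|
      (mul_le_of_le_one_left (norm_nonneg _) norm_id_le).trans (norm_le_pi_norm X i)
  calc _ ≤ ‖z'‖ * ‖TensorProduct.mapL 1 (X i) w'‖ := norm_inner_le_norm _ _
    _ ≤ ‖z'‖ * (‖X‖ * ‖w'‖) :=
      mul_le_mul_of_nonneg_left (le_of_opNorm_le _ h1 w') (norm_nonneg _)
    _ = _ := by ring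

theorem im_inner_sh_nonneg (R : Realization 𝓑) (ω : PencilIndex.{u} k c₁ c₂)
    (hX : X ∈ upperHalf k E) (η : FinSpace.{u} ω.n ⊗[ℂ] E) : 0 ≤ (⟪η, R.sh ω X η⟫_ℂ).im := by
  obtain ⟨ε, hε, h⟩ := exists_bound_of_mem_upperHalf hX
  rw [R.inner_sh ω (exists_accretiveTuple (Or.inr hX))]
  refine le_trans ?_ (R.lower_im_lam ω h _)
  have : 0 ≤ ∑ i, ‖TensorProduct.mapL (R.s ω i) (1 : E →L[ℂ] E)
      (shortVec (R.tp E ω) (R.lam ω X) η)‖ ^ 2 := Finset.sum_nonneg fun i _ => sq_nonneg _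
  exact mul_nonneg hε.le this

/-- A Harnack type inequality: the imaginary parts of the shorted pencils at two points of the
upper poly-halfspace are comparable, uniformly in the pencil. -/
theorem exists_im_inner_sh_le (R : Realization 𝓑) (hX : X ∈ upperHalf k E)
    (hY : Y ∈ upperHalf k E) : ∃ C : ℝ, 0 ≤ C ∧ ∀ ω (η : FinSpace.{u} ω.n ⊗[ℂ] E),
      (⟪η, R.sh ω Y η⟫_ℂ).im ≤ C * (⟪η, R.sh ω X η⟫_ℂ).im := by
  obtain ⟨ε, hε, h⟩ := exists_bound_of_mem_upperHalf hX
  obtain ⟨ε', hε', h'⟩ := exists_bound_of_mem_upperHalf hY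
  obtain ⟨c, δ, hX'⟩ := exists_accretiveTuple (Or.inr hX)
  obtain ⟨c', δ', hY'⟩ := exists_accretiveTuple (Or.inr hY)
  set m := ‖X - Y‖
  have hm : 0 ≤ m := norm_nonneg _
  refine ⟨‖Y‖ * (2 + 2 * (m / ε') ^ 2) / ε, by positivity, fun ω η => ?_⟩
  rw [R.inner_sh ω ⟨c, δ, hX'⟩, R.inner_sh ω ⟨c', δ', hY'⟩]
  have z1 := fun z hz => inner_shortVec_eq_zero (R.tp_proj ω) (R.isUnit_pivot ω hX') (z := z) hz η
  have z2 := fun z hz => inner_shortVec_eq_zero (R.tp_proj ω) (R.isUnit_pivot ω hY') (z := z) hz η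
  have p1 := proj_sub_shortVec (Λ := R.lam ω X) (R.tp_proj ω) η
  have p2 := proj_sub_shortVec (Λ := R.lam ω Y) (R.tp_proj ω) η
  generalize shortVec (R.tp E ω) (R.lam ω X) η = θ at *
  generalize shortVec (R.tp E ω) (R.lam ω Y) η = θ' at *
  have hd : R.tp E ω (θ' - θ) = θ' - θ := by
    have : θ' - θ = (η - θ) - (η - θ') := by abel
    rw [this, map_sub, p1, p2]
  have hz1 := z1 _ hd
  have hz2 := z2 _ hd
  set d := θ' - θ with hd'
  -- `Λ(X) θ` and `Λ(Y) θ'` are both orthogonal to `d = θ' - θ`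
  have e : ⟪d, R.lam ω Y d⟫_ℂ = ⟪d, R.lamLin ω (X - Y) θ⟫_ℂ := by
    have e1 : R.lam ω X θ = R.lam ω Y θ + R.lamLin ω (X - Y) θ := by
      rw [← add_apply, lam, lam, add_assoc, ← R.lamLin_add, add_sub_cancel]
    rw [e1, inner_add_right] at hz1
    conv_lhs => rw [hd', map_sub, ← hd', inner_sub_right, hz2, zero_sub]
    exact neg_eq_of_add_eq_zero_right hz1
  set a : FinSpace.{u} ω.n ⊗[ℂ] E → Fin k → ℝ := fun z i =>
    ‖TensorProduct.mapL (R.s ω i) (1 : E →L[ℂ] E) z‖ with ha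
  have b1 : ε' * ∑ i, a d i ^ 2 ≤ ∑ i, m * (a d i * a θ i) := by
    refine (R.lower_im_lam ω h' d).trans ?_
    rw [e]
    exact ((Complex.abs_im_le_norm _).trans' (le_abs_self _)).trans (R.norm_inner_lamLin_le ω d θ)
  have b2 : ∑ i, a d i ^ 2 ≤ (m / ε') ^ 2 * ∑ i, a θ i ^ 2 := by
    have : ∑ i, m * (a d i * a θ i) ≤ ∑ i, (ε' / 2 * a d i ^ 2 +
        ε' / 2 * ((m / ε') ^ 2 * a θ i ^ 2)) := Finset.sum_le_sum fun i _ => by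
      have e2 : m = ε' * (m / ε') := by field_simp
      have := mul_nonneg hε'.le (sq_nonneg (a d i - m / ε' * a θ i))
      conv_lhs => rw [e2]
      linarith
    have h3 := b1.trans this
    rw [Finset.sum_add_distrib, ← Finset.mul_sum, ← Finset.mul_sum, ← Finset.mul_sum] at h3
    have h4 : ε' * (∑ i, a d i ^ 2) ≤ ε' * ((m / ε') ^ 2 * ∑ i, a θ i ^ 2) := by linarith
    exact le_of_mul_le_mul_left h4 hε'
  have b3 : ∑ i, a θ' i ^ 2 ≤ (2 + 2 * (m / ε') ^ 2) * ∑ i, a θ i ^ 2 := by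
    have : ∑ i, a θ' i ^ 2 ≤ ∑ i, (2 * a d i ^ 2 + 2 * a θ i ^ 2) :=
      Finset.sum_le_sum fun i _ => by
        have h5 : a θ' i ≤ a d i + a θ i := by
          have : θ' = d + θ := by rw [hd', sub_add_cancel]
          rw [ha]
          dsimp only
          rw [this, map_add]
          exact norm_add_le _ _
        have h6 : 0 ≤ a θ' i := norm_nonneg _
        nlinarith [sq_nonneg (a d i - a θ i)]
    rw [Finset.sum_add_distrib, ← Finset.mul_sum, ← Finset.mul_sum] at this
    linarith
  have b4 : (⟪θ', R.lam ω Y θ'⟫_ℂ).im ≤ ‖Y‖ * ∑ i, a θ' i ^ 2 := by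
    rw [inner_lam, Complex.add_im]
    have h0 : (⟪TensorProduct.mapL (R.s₀ ω) (1 : E →L[ℂ] E) θ',
      TensorProduct.mapL (R.s₀ ω) (1 : E →L[ℂ] E) θ'⟫_ℂ).im = 0 := inner_self_im (𝕜 := ℂ) _
    rw [h0, zero_add]
    refine ((Complex.abs_im_le_norm _).trans' (le_abs_self _)).trans ?_
    refine (R.norm_inner_lamLin_le ω θ' θ').trans_eq ?_
    rw [Finset.mul_sum]
    exact Finset.sum_congr rfl fun i _ => by rw [sq]
  have b5 := R.lower_im_lam ω h θ
  calc _ ≤ ‖Y‖ * ∑ i, a θ' i ^ 2 := b4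
    _ ≤ ‖Y‖ * ((2 + 2 * (m / ε') ^ 2) * ∑ i, a θ i ^ 2) := by gcongr
    _ = ‖Y‖ * (2 + 2 * (m / ε') ^ 2) / ε * (ε * ∑ i, a θ i ^ 2) := by field_simp
    _ ≤ _ := by gcongr

theorem im_sliceFun_nonneg (R : Realization 𝓑) (hw : IsState w) (hX : X ∈ upperHalf k E) (x : E) :
    0 ≤ (⟪x, 𝓑.sliceFun w E X x⟫_ℂ).im := by
  have := R.re_sliceFun_nonneg hw (-Complex.I) (exists_accretiveTuple (Or.inr hX))
    (fun ω η => by simpa using R.im_inner_sh_nonneg ω hX η) x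
  simpa using this

theorem exists_im_sliceFun_le (R : Realization 𝓑) (hw : IsState w) (hX : X ∈ upperHalf k E)
    (hY : Y ∈ upperHalf k E) : ∃ C : ℝ, 0 ≤ C ∧ ∀ x,
      (⟪x, 𝓑.sliceFun w E Y x⟫_ℂ).im ≤ C * (⟪x, 𝓑.sliceFun w E X x⟫_ℂ).im := by
  obtain ⟨C, hC, h⟩ := R.exists_im_inner_sh_le hX hY
  obtain ⟨c, δ, hX'⟩ := exists_accretiveTuple (Or.inr hX)
  obtain ⟨c', δ', hY'⟩ := exists_accretiveTuple (Or.inr hY)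
  refine ⟨C, hC, fun x => ?_⟩
  have := R.re_sum_sliceFun_nonneg hw Finset.univ ![-(C * Complex.I), Complex.I] (X := ![X, Y])
    (c := ![c, c']) (δ := ![δ, δ']) (fun j => by fin_cases j <;> assumption) (fun ω η => by
      have := h ω η
      simpa [Fin.sum_univ_two] using this) x
  simpa [Fin.sum_univ_two] using this

end Realization

/-! ### Inverses of strictly positive operators -/

section Inverse

theorem inverse_apply_of_intertwine {V V' : Type*} [NormedAddCommGroup V] [NormedSpace ℂ V]
    [NormedAddCommGroup V'] [NormedSpace ℂ V'] {A : V →L[ℂ] V} {A' : V' →L[ℂ] V'}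
    (hA : IsUnit A) (hA' : IsUnit A') {J : V → V'}
    (h : ∀ x, A' (J x) = J (A x)) (x : V) : Ring.inverse A' (J x) = J (Ring.inverse A x) := by
  have h1 : A (Ring.inverse A x) = x := DFunLike.congr_fun (Ring.mul_inverse_cancel A hA) x
  have h2 : ∀ y, Ring.inverse A' (A' y) = y := fun y =>
    DFunLike.congr_fun (Ring.inverse_mul_cancel A' hA') y
  conv_lhs => rw [← h1, ← h, h2]

theorem inverse_inverse_of_isUnit {V : Type*} [NormedAddCommGroup V] [NormedSpace ℂ V]
    {A : V →L[ℂ] V} (hA : IsUnit A) : Ring.inverse (Ring.inverse A) = A := by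
  obtain ⟨u, rfl⟩ := hA
  simp

variable {E : Type u} [NormedAddCommGroup E] [InnerProductSpace ℂ E] [CompleteSpace E]
variable {A B : E →L[ℂ] E}

theorem IsStrictlyPos.isStrictlyPositive (hA : IsStrictlyPos A) : IsStrictlyPositive A := by
  obtain ⟨ε, hε, h⟩ := (isStrictlyPos_iff hA.isSelfAdjoint).1 hA
  refine ⟨(nonneg_iff_re_inner hA.isSelfAdjoint).2 fun x =>
    (by positivity : 0 ≤ ε * ‖x‖ ^ 2).trans (h x), ?_⟩
  exact AccretiveBound.isUnit (c := 1) hε fun x => by simpa using h x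

theorem isStrictlyPos_of_isStrictlyPositive (hA : IsStrictlyPositive A) : IsStrictlyPos A := by
  rcases subsingleton_or_nontrivial (E →L[ℂ] E) with hE | hE
  · exact ⟨1, one_pos, (Subsingleton.elim _ _).le⟩
  · have hsa : IsSelfAdjoint A := .of_nonneg hA.nonneg
    obtain ⟨r, hr, h⟩ := (CFC.exists_pos_algebraMap_le_iff hsa).2 fun x hx =>
      hA.spectrum_pos hx
    refine ⟨r, hr, ?_⟩
    rwa [Algebra.algebraMap_eq_smul_one] at h

theorem IsStrictlyPos.inverse (hA : IsStrictlyPos A) : IsStrictlyPos (Ring.inverse A) :=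
  isStrictlyPos_of_isStrictlyPositive hA.isStrictlyPositive.ringInverse

theorem IsStrictlyPos.isUnit (hA : IsStrictlyPos A) : IsUnit A := hA.isStrictlyPositive.isUnit

theorem IsStrictlyPos.inverse_le_inverse (hA : IsStrictlyPos A) (h : A ≤ B) :
    Ring.inverse B ≤ Ring.inverse A :=
  CStarAlgebra.ringInverse_le_ringInverse h hA.isStrictlyPositive

theorem IsStrictlyPos.of_le (hA : IsStrictlyPos A) (h : A ≤ B) : IsStrictlyPos B := by
  obtain ⟨ε, hε, h'⟩ := hA
  exact ⟨ε, hε, h'.trans h⟩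

/-- Entrywise inversion of a tuple of operators. -/
def invTuple (X : Fin k → E →L[ℂ] E) : Fin k → E →L[ℂ] E := fun i => Ring.inverse (X i)

theorem invTuple_mem {X : Fin k → E →L[ℂ] E} (hX : X ∈ posCone k E) : invTuple X ∈ posCone k E :=
  fun i => (hX i).inverse

theorem invTuple_invTuple {X : Fin k → E →L[ℂ] E} (hX : X ∈ posCone k E) :
    invTuple (invTuple X) = X :=
  funext fun i => inverse_inverse_of_isUnit (hX i).isUnit

theorem analyticAt_invTuple {X : Fin k → E →L[ℂ] E} (hX : X ∈ posCone k E) :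
    AnalyticAt ℂ (invTuple : (Fin k → E →L[ℂ] E) → _) X := by
  refine AnalyticAt.pi fun i => ?_
  obtain ⟨u, hu⟩ := (hX i).isUnit
  refine AnalyticAt.fun_comp (g := Ring.inverse) (f := fun Y : Fin k → E →L[ℂ] E => Y i) ?_
    ((ContinuousLinearMap.proj (R := ℂ) (φ := fun _ : Fin k => E →L[ℂ] E) i).analyticAt X)
  rw [← hu]
  exact analyticAt_inverse u

end Inverse

/-! ### Free maps and isometric intertwiners -/

/-- The graded map respects isometric intertwiners between tuples of strictly positive operators. -/
def RespectsIsometries (G : GradedMap.{u} k) : Prop :=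
  ∀ (E E' : Type u) [NormedAddCommGroup E] [InnerProductSpace ℂ E] [CompleteSpace E]
    [NormedAddCommGroup E'] [InnerProductSpace ℂ E'] [CompleteSpace E']
    (X : Fin k → E →L[ℂ] E) (X' : Fin k → E' →L[ℂ] E') (J : E →ₗᵢ[ℂ] E'), X ∈ posCone k E →
      X' ∈ posCone k E' → (∀ i x, X' i (J x) = J (X i x)) → ∀ x, G E' X' (J x) = J (G E X x)

section Dilation

variable {E E' : Type u} [NormedAddCommGroup E] [InnerProductSpace ℂ E] [CompleteSpace E]
  [NormedAddCommGroup E'] [InnerProductSpace ℂ E'] [CompleteSpace E']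

theorem adjoint_apply_isometry (J : E →ₗᵢ[ℂ] E') (x : E) :
    adjoint J.toContinuousLinearMap (J x) = x := by
  refine ext_inner_left ℂ fun y => ?_
  rw [adjoint_inner_right]
  exact J.inner_map_map y x

/-- The linear map `(x, y) ↦ (J⋆ y, J x + (1 - J J⋆) y)` for an isometry `J`. -/
def swapLin (J : E →ₗᵢ[ℂ] E') : WithLp 2 (E × E') →ₗ[ℂ] WithLp 2 (E × E') where
  toFun z := WithLp.toLp 2 (adjoint J.toContinuousLinearMap z.snd,
    J z.fst + (z.snd - J (adjoint J.toContinuousLinearMap z.snd)))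
  map_add' z w := by
    change WithLp.toLp 2 (adjoint J.toContinuousLinearMap (z.snd + w.snd), J (z.fst + w.fst) +
      (z.snd + w.snd - J (adjoint J.toContinuousLinearMap (z.snd + w.snd)))) =
      WithLp.toLp 2 (adjoint J.toContinuousLinearMap z.snd + adjoint J.toContinuousLinearMap w.snd,
        J z.fst + (z.snd - J (adjoint J.toContinuousLinearMap z.snd)) +
          (J w.fst + (w.snd - J (adjoint J.toContinuousLinearMap w.snd))))
    simp only [map_add]
    congr 2
    abel
  map_smul' a z := by
    change WithLp.toLp 2 (adjoint J.toContinuousLinearMap (a • z.snd), J (a • z.fst) +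
      (a • z.snd - J (adjoint J.toContinuousLinearMap (a • z.snd)))) =
      WithLp.toLp 2 (a • adjoint J.toContinuousLinearMap z.snd,
        a • (J z.fst + (z.snd - J (adjoint J.toContinuousLinearMap z.snd))))
    simp only [map_smul, smul_add, smul_sub]

theorem swapLin_swapLin (J : E →ₗᵢ[ℂ] E') (z : WithLp 2 (E × E')) :
    swapLin J (swapLin J z) = z := by
  have h : ∀ x, adjoint J.toContinuousLinearMap (J x) = x := adjoint_apply_isometry J
  change WithLp.toLp 2 (adjoint J.toContinuousLinearMap (J z.fst + (z.snd -
    J (adjoint J.toContinuousLinearMap z.snd))), J (adjoint J.toContinuousLinearMap z.snd) +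
    ((J z.fst + (z.snd - J (adjoint J.toContinuousLinearMap z.snd))) -
      J (adjoint J.toContinuousLinearMap (J z.fst + (z.snd -
        J (adjoint J.toContinuousLinearMap z.snd)))))) = WithLp.toLp 2 (z.fst, z.snd)
  simp only [map_add, map_sub, h]
  congr 2 <;> abel

theorem norm_swapLin (J : E →ₗᵢ[ℂ] E') (z : WithLp 2 (E × E')) : ‖swapLin J z‖ = ‖z‖ := by
  have h : ∀ x, adjoint J.toContinuousLinearMap (J x) = x := adjoint_apply_isometry J
  have h' : ∀ x y, ⟪J x, y⟫_ℂ = ⟪x, adjoint J.toContinuousLinearMap y⟫_ℂ := fun x y =>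
    (adjoint_inner_right J.toContinuousLinearMap x y).symm
  refine (sq_eq_sq₀ (norm_nonneg _) (norm_nonneg _)).1 ?_
  rw [WithLp.prod_norm_sq_eq_of_L2, WithLp.prod_norm_sq_eq_of_L2]
  change ‖adjoint J.toContinuousLinearMap z.snd‖ ^ 2 +
    ‖J z.fst + (z.snd - J (adjoint J.toContinuousLinearMap z.snd))‖ ^ 2 = _
  generalize z.fst = x
  generalize z.snd = y
  set v := adjoint J.toContinuousLinearMap y with hv
  have e1 : ‖J x + (y - J v)‖ ^ 2 = ‖J x‖ ^ 2 + ‖y - J v‖ ^ 2 := by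
    rw [@norm_add_sq ℂ, h', map_sub, h, ← hv, sub_self, inner_zero_right]
    simp
  have e2 : ‖y‖ ^ 2 = ‖J v‖ ^ 2 + ‖y - J v‖ ^ 2 := by
    have : y = J v + (y - J v) := by abel
    conv_lhs => rw [this]
    rw [@norm_add_sq ℂ, h', map_sub, h, ← hv, sub_self, inner_zero_right]
    simp
  rw [e1, e2, J.norm_map, J.norm_map]
  ring

/-- An isometry `J : E → E'` dilates to the unitary `(x, y) ↦ (J⋆ y, J x + (1 - J J⋆) y)` of
`E ⊕ E'`. -/
def swapUnitary (J : E →ₗᵢ[ℂ] E') : WithLp 2 (E × E') ≃ₗᵢ[ℂ] WithLp 2 (E × E') where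
  toLinearEquiv := LinearEquiv.ofInvolutive (swapLin J) (swapLin_swapLin J)
  norm_map' := norm_swapLin J

theorem unitaryConj_swapUnitary {J : E →ₗᵢ[ℂ] E'} {X : E →L[ℂ] E} {X' : E' →L[ℂ] E'}
    (hX : IsSelfAdjoint X) (hX' : IsSelfAdjoint X') (h : ∀ x, X' (J x) = J (X x)) :
    unitaryConj (swapUnitary J) (dirSum X X') = dirSum X X' := by
  have h2 : ∀ y, adjoint J.toContinuousLinearMap (X' y) = X (adjoint J.toContinuousLinearMap y) :=
    fun y => by
      refine ext_inner_left ℂ fun x => ?_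
      have e1 := (isSelfAdjoint_iff_isSymmetric.1 hX') (J x) y
      have e2 := (isSelfAdjoint_iff_isSymmetric.1 hX) x (adjoint J.toContinuousLinearMap y)
      rw [coe_coe] at e1 e2
      rw [adjoint_inner_right, ← e2, adjoint_inner_right]
      change ⟪J x, X' y⟫_ℂ = ⟪J (X x), y⟫_ℂ
      rw [← e1, h]
  have key : ∀ z, dirSum X X' (swapLin J z) = swapLin J (dirSum X X' z) := fun z => by
    change WithLp.toLp 2 (X (adjoint J.toContinuousLinearMap z.snd),
      X' (J z.fst + (z.snd - J (adjoint J.toContinuousLinearMap z.snd)))) =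
      WithLp.toLp 2 (adjoint J.toContinuousLinearMap (X' z.snd),
        J (X z.fst) + (X' z.snd - J (adjoint J.toContinuousLinearMap (X' z.snd))))
    rw [map_add, map_sub, h, h, h2]
  refine ContinuousLinearMap.ext fun z => ?_
  change swapLin J (dirSum X X' (swapLin J z)) = _
  rw [key, swapLin_swapLin]

end Dilation

/-- A free map respects an isometric intertwiner `J`, because the unitary dilation of `J` commutes
with `X ⊕ X'`. -/
theorem IsFree.respectsIsometries {F : GradedMap.{u} k} (hF : IsFree (posCone k) F) :
    RespectsIsometries F := by
  intro E E' _ _ _ _ _ _ X X' J hX hX' h x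
  have hmem := hF.dirSum_mem E E' X X' hX hX'
  have h1 := hF.unitary _ _ (swapUnitary J) _ hmem
  have h2 : (fun i => unitaryConj (swapUnitary J) (FreeLoewner.dirSum (X i) (X' i))) =
      fun i => FreeLoewner.dirSum (X i) (X' i) := funext fun i =>
    unitaryConj_swapUnitary (hX i).isSelfAdjoint (hX' i).isSelfAdjoint (h i)
  rw [h2, hF.dirSum E E' X X' hX hX'] at h1
  have h3 := DFunLike.congr_fun h1 (swapLin J (WithLp.toLp 2 (x, 0)))
  rw [unitaryConj_apply] at h3
  have h4 : (swapUnitary J).symm (swapLin J (WithLp.toLp 2 (x, 0))) = WithLp.toLp 2 (x, 0) :=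
    (swapUnitary J).symm_apply_apply _
  rw [h4] at h3
  have h5 := congrArg (fun z : WithLp 2 (E × E') => z.snd) h3
  change F E' X' (J x + ((0 : E') - J (adjoint J.toContinuousLinearMap 0))) =
    J (F E X x) + (F E' X' 0 - J (adjoint J.toContinuousLinearMap (F E' X' 0))) at h5
  simpa using h5

/-- The map `X ↦ F(X⁻¹)⁻¹`. -/
def invDual (F : GradedMap.{u} k) : GradedMap.{u} k :=
  fun E _ _ _ X => Ring.inverse (F E (invTuple X))

theorem RespectsIsometries.invDual {F : GradedMap.{u} k} (hF : RespectsIsometries F)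
    (hpos : MapsPosToPos F) : RespectsIsometries (invDual F) := by
  intro E E' _ _ _ _ _ _ X X' J hX hX' h x
  refine inverse_apply_of_intertwine (J := J) (hpos E _ (invTuple_mem hX)).isUnit
    (hpos E' _ (invTuple_mem hX')).isUnit ?_ x
  exact hF E E' _ _ J (invTuple_mem hX) (invTuple_mem hX') fun i =>
    inverse_apply_of_intertwine (hX i).isUnit (hX' i).isUnit (h i)

theorem IsOperatorMonotone.invDual {F : GradedMap.{u} k} (hF : IsOperatorMonotone F)
    (hpos : MapsPosToPos F) : IsOperatorMonotone (invDual F) := fun E _ _ _ _ _ hX hY h =>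
  (hpos E _ (invTuple_mem hY)).inverse_le_inverse <|
    hF E _ _ (invTuple_mem hY) (invTuple_mem hX) fun i => (hX i).inverse_le_inverse (h i)

theorem MapsPosToPos.invDual {F : GradedMap.{u} k} (hpos : MapsPosToPos F) :
    MapsPosToPos (invDual F) := fun E _ _ _ _ hX => (hpos E _ (invTuple_mem hX)).inverse

/-! ### A tridiagonal model operator -/

section Model

variable {n : ℕ}

/-- The bidiagonal operator `x ↦ (x_i - l x_{i+1})_i` from `ℂⁿ⁺¹` to `ℂⁿ`. -/
def bidiag (n : ℕ) (l : ℝ) : EuclideanSpace ℂ (Fin (n + 1)) →L[ℂ] EuclideanSpace ℂ (Fin n) :=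
  LinearMap.toContinuousLinearMap
    { toFun := fun x => WithLp.toLp 2 fun i => x i.castSucc - l * x i.succ
      map_add' := fun x y => by ext i; simp; ring
      map_smul' := fun a x => by ext i; simp; ring }

theorem bidiag_apply (l : ℝ) (x : EuclideanSpace ℂ (Fin (n + 1))) (i : Fin n) :
    bidiag n l x i = x i.castSucc - l * x i.succ := rfl

theorem norm_sq_castSucc (x : EuclideanSpace ℂ (Fin (n + 1))) :
    ‖x‖ ^ 2 = ‖(WithLp.toLp 2 fun i : Fin n => x i.castSucc : EuclideanSpace ℂ (Fin n))‖ ^ 2 +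
      ‖x (Fin.last n)‖ ^ 2 := by
  rw [EuclideanSpace.norm_sq_eq, EuclideanSpace.norm_sq_eq, Fin.sum_univ_castSucc]

theorem norm_sq_succ (x : EuclideanSpace ℂ (Fin (n + 1))) :
    ‖x‖ ^ 2 = ‖x 0‖ ^ 2 +
      ‖(WithLp.toLp 2 fun i : Fin n => x i.succ : EuclideanSpace ℂ (Fin n))‖ ^ 2 := by
  rw [EuclideanSpace.norm_sq_eq, EuclideanSpace.norm_sq_eq, Fin.sum_univ_succ]

theorem bidiag_eq (l : ℝ) (x : EuclideanSpace ℂ (Fin (n + 1))) :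
    bidiag n l x = (WithLp.toLp 2 fun i : Fin n => x i.castSucc : EuclideanSpace ℂ (Fin n)) -
      (l : ℂ) • (WithLp.toLp 2 fun i : Fin n => x i.succ : EuclideanSpace ℂ (Fin n)) := rfl

theorem norm_succ_le (x : EuclideanSpace ℂ (Fin (n + 1))) :
    ‖(WithLp.toLp 2 fun i : Fin n => x i.succ : EuclideanSpace ℂ (Fin n))‖ ≤ ‖x‖ := by
  refine (sq_le_sq₀ (norm_nonneg _) (norm_nonneg _)).1 ?_
  rw [norm_sq_succ x]
  exact le_add_of_nonneg_left (sq_nonneg _)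

theorem norm_bidiag_le {l : ℝ} (hl : 0 ≤ l) (x : EuclideanSpace ℂ (Fin (n + 1))) :
    ‖bidiag n l x‖ ≤ (1 + l) * ‖x‖ := by
  have h1 : ‖(WithLp.toLp 2 fun i : Fin n => x i.castSucc : EuclideanSpace ℂ (Fin n))‖ ≤ ‖x‖ := by
    refine (sq_le_sq₀ (norm_nonneg _) (norm_nonneg _)).1 ?_
    rw [norm_sq_castSucc x]
    exact le_add_of_nonneg_right (sq_nonneg _)
  have h2 := mul_le_mul_of_nonneg_left (norm_succ_le x) hl
  rw [bidiag_eq]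
  refine (norm_sub_le _ _).trans ?_
  rw [norm_smul, Complex.norm_real, Real.norm_of_nonneg hl]
  linarith

theorem le_norm_bidiag {l : ℝ} (hl : 0 ≤ l) {x : EuclideanSpace ℂ (Fin (n + 1))}
    (hx : x (Fin.last n) = 0) : (1 - l) * ‖x‖ ≤ ‖bidiag n l x‖ := by
  have h1 : ‖(WithLp.toLp 2 fun i : Fin n => x i.castSucc : EuclideanSpace ℂ (Fin n))‖ = ‖x‖ := by
    refine (sq_eq_sq₀ (norm_nonneg _) (norm_nonneg _)).1 ?_
    rw [norm_sq_castSucc x, hx]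
    simp
  have h2 := mul_le_mul_of_nonneg_left (norm_succ_le x) hl
  rw [bidiag_eq]
  refine le_trans ?_ (norm_sub_norm_le _ _)
  rw [norm_smul, Complex.norm_real, Real.norm_of_nonneg hl, h1]
  linarith

/-- The tridiagonal operator `1 - (1 - 3 l) D⋆ D`, with `D` bidiagonal. The kernel of `D` gives the
eigenvalue `1`; the factor `1 - 3 l` makes the operator positive for `l ≤ 1 / 5` while keeping it
at most `5 l` on the vectors with vanishing last coordinate. -/
def tridiag (n : ℕ) (l : ℝ) :
    EuclideanSpace ℂ (Fin (n + 1)) →L[ℂ] EuclideanSpace ℂ (Fin (n + 1)) :=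
  1 - ((1 - 3 * l : ℝ) : ℂ) • (adjoint (bidiag n l) ∘L bidiag n l)

theorem inner_tridiag (l : ℝ) (x y : EuclideanSpace ℂ (Fin (n + 1))) :
    ⟪x, tridiag n l y⟫_ℂ = ⟪x, y⟫_ℂ - ((1 - 3 * l : ℝ) : ℂ) * ⟪bidiag n l x, bidiag n l y⟫_ℂ := by
  rw [tridiag, sub_apply, inner_sub_right, smul_apply, inner_smul_right, comp_apply,
    adjoint_inner_right, one_apply_eq_self]

theorem re_inner_tridiag (l : ℝ) (x : EuclideanSpace ℂ (Fin (n + 1))) :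
    (⟪x, tridiag n l x⟫_ℂ).re = ‖x‖ ^ 2 - (1 - 3 * l) * ‖bidiag n l x‖ ^ 2 := by
  have h : ∀ {m : ℕ} (y : EuclideanSpace ℂ (Fin m)), (⟪y, y⟫_ℂ).re = ‖y‖ ^ 2 := fun y =>
    inner_self_eq_norm_sq (𝕜 := ℂ) y
  rw [inner_tridiag, Complex.sub_re, Complex.re_ofReal_mul, h, h]

theorem isSelfAdjoint_tridiag (l : ℝ) : IsSelfAdjoint (tridiag n l) := by
  rw [isSelfAdjoint_iff_isSymmetric]
  intro x y
  rw [coe_coe, inner_tridiag, ← inner_conj_symm, inner_tridiag, map_sub, map_mul, inner_conj_symm,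
    inner_conj_symm, Complex.conj_ofReal]

theorem tridiag_nonneg {l : ℝ} (hl : 0 ≤ l) (hl1 : l ≤ 1 / 5) : 0 ≤ tridiag n l := by
  refine (nonneg_iff_re_inner (isSelfAdjoint_tridiag l)).2 fun x => ?_
  have h1 : ‖bidiag n l x‖ ^ 2 ≤ ((1 + l) * ‖x‖) ^ 2 :=
    pow_le_pow_left₀ (norm_nonneg _) (norm_bidiag_le hl x) 2
  have h2 := mul_le_mul_of_nonneg_left h1 (by linarith : 0 ≤ 1 - 3 * l)
  have h3 : 0 ≤ (l + 5 * l ^ 2 + 3 * l ^ 3) * ‖x‖ ^ 2 := by positivity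
  rw [re_inner_tridiag]
  linarith

theorem isSelfAdjoint_one_sub {V : Type*} [NormedAddCommGroup V] [InnerProductSpace ℂ V]
    [CompleteSpace V] {T : V →L[ℂ] V} (hT : IsSelfAdjoint T) : IsSelfAdjoint (1 - T) :=
  (IsSelfAdjoint.one _).sub hT

theorem tridiag_le_one {l : ℝ} (hl1 : l ≤ 1 / 5) : tridiag n l ≤ 1 := by
  refine (le_iff_re_inner (isSelfAdjoint_one_sub (isSelfAdjoint_tridiag l))).2 fun x => ?_
  rw [re_inner_tridiag]
  have h : (⟪x, x⟫_ℂ).re = ‖x‖ ^ 2 := inner_self_eq_norm_sq (𝕜 := ℂ) x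
  rw [one_apply_eq_self, h, sub_le_self_iff]
  exact mul_nonneg (by linarith) (sq_nonneg _)

theorem re_inner_tridiag_le {l : ℝ} (hl : 0 ≤ l) (hl1 : l ≤ 1 / 5)
    {x : EuclideanSpace ℂ (Fin (n + 1))} (hx : x (Fin.last n) = 0) :
    (⟪x, tridiag n l x⟫_ℂ).re ≤ 5 * l * ‖x‖ ^ 2 := by
  have h1 : ((1 - l) * ‖x‖) ^ 2 ≤ ‖bidiag n l x‖ ^ 2 :=
    pow_le_pow_left₀ (mul_nonneg (by linarith) (norm_nonneg _)) (le_norm_bidiag hl hx) 2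
  have h2 := mul_le_mul_of_nonneg_left h1 (by linarith : 0 ≤ 1 - 3 * l)
  have h3 : 0 ≤ l ^ 2 * (7 - 3 * l) * ‖x‖ ^ 2 :=
    mul_nonneg (mul_nonneg (sq_nonneg _) (by linarith)) (sq_nonneg _)
  rw [re_inner_tridiag]
  linarith

/-- The vector of powers `(l ^ (n - i))_i`, which spans the kernel of the bidiagonal operator. -/
def powVec (n : ℕ) (l : ℝ) : EuclideanSpace ℂ (Fin (n + 1)) :=
  WithLp.toLp 2 fun i => (l : ℂ) ^ (n - i : ℕ)

theorem tridiag_powVec (l : ℝ) : tridiag n l (powVec n l) = powVec n l := by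
  have h : bidiag n l (powVec n l) = 0 := by
    ext i
    have hi : n - (i : ℕ) = n - (i + 1 : ℕ) + 1 := by omega
    rw [bidiag_apply]
    simp only [powVec, Fin.val_castSucc, Fin.val_succ, PiLp.zero_apply]
    rw [hi, pow_succ]
    ring
  rw [tridiag, sub_apply, smul_apply, comp_apply, h]
  simp

theorem norm_sq_powVec_le {l : ℝ} (hl : 0 ≤ l) (hl1 : l ≤ 1) : ‖powVec n l‖ ^ 2 ≤ n + 1 := by
  rw [EuclideanSpace.norm_sq_eq]
  calc ∑ i, ‖powVec n l i‖ ^ 2 ≤ ∑ _i : Fin (n + 1), (1 : ℝ) := Finset.sum_le_sum fun i _ => by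
        refine pow_le_one₀ (norm_nonneg _) ?_
        simp only [powVec, norm_pow, Complex.norm_real, Real.norm_of_nonneg hl]
        exact pow_le_one₀ hl hl1
    _ = n + 1 := by simp

theorem tridiag_apply_eq_zero {l : ℝ} {m : ℕ} {x : EuclideanSpace ℂ (Fin (n + 1))}
    (hx : ∀ j : Fin (n + 1), m < j → x j = 0) (j : Fin (n + 1)) (hj : m + 1 < j) :
    tridiag n l x j = 0 := by
  have h1 : tridiag n l x j = ⟪EuclideanSpace.single j (1 : ℂ), tridiag n l x⟫_ℂ := by
    rw [EuclideanSpace.inner_single_left]; simp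
  rw [h1, inner_tridiag, EuclideanSpace.inner_single_left, hx j (by omega), PiLp.inner_apply,
    Finset.sum_eq_zero, mul_zero, mul_zero, sub_zero]
  intro i _
  by_cases hi : m < i
  · have : bidiag n l x i = 0 := by
      rw [bidiag_apply, hx _ (by simpa using hi), hx _ (by simp; omega)]
      simp
    rw [this, inner_zero_right]
  · have : bidiag n l (EuclideanSpace.single j (1 : ℂ)) i = 0 := by
      have e1 : i.castSucc ≠ j := fun h => by rw [← h] at hj; simp at hj; omega
      have e2 : i.succ ≠ j := fun h => by rw [← h] at hj; simp at hj; omega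
      rw [bidiag_apply]
      simp [e1, e2]
    rw [this, inner_zero_left]

theorem tridiag_pow_apply_eq_zero (l : ℝ) (m : ℕ) (j : Fin (n + 1)) (hj : m < j) :
    (tridiag n l ^ m) (EuclideanSpace.single 0 (1 : ℂ)) j = 0 := by
  induction m generalizing j with
  | zero =>
    have : j ≠ 0 := fun h => by simp [h] at hj
    simp [this]
  | succ m ih =>
    rw [pow_succ', mul_apply_eq_comp]
    exact tridiag_apply_eq_zero ih j hj

end Model

/-! ### Spectral data of the model -/

/-- A positive contraction `T` with fixed vector `p`, which is at most `r` on the orthogonal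
complement of the unit vector `η`; the first `n` vectors of the Krylov sequence of the unit vector
`w` are orthogonal to `η`. Then the spectral measure of `T` at `w` lives on `[0, r] ∪ {1}`, and the
compression of `T` to the orthogonal complement of `η` has the same moments at `w` up to the order
`2 n - 1`, but no spectrum outside `[0, r]` there. -/
structure KrylovModel {V : Type*} [NormedAddCommGroup V] [InnerProductSpace ℂ V] [CompleteSpace V]
    (r : ℝ) (n : ℕ) (T : V →L[ℂ] V) (p η w : V) : Prop where
  nonneg : 0 ≤ T
  le_one : T ≤ 1
  fixed : T p = p
  norm_η : ‖η‖ = 1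
  norm_w : ‖w‖ = 1
  inner_η_p : ⟪η, p⟫_ℂ ≠ 0
  le_r : ∀ x, ⟪η, x⟫_ℂ = 0 → (⟪x, T x⟫_ℂ).re ≤ r * ‖x‖ ^ 2
  krylov : ∀ i < n, ⟪η, (T ^ i) w⟫_ℂ = 0

theorem krylovModel_tridiag {l : ℝ} (hl : 0 ≤ l) (hl1 : l ≤ 1 / 5) (n : ℕ) :
    KrylovModel (5 * l) n (tridiag n l) (powVec n l)
      (EuclideanSpace.single (Fin.last n) (1 : ℂ)) (EuclideanSpace.single 0 (1 : ℂ)) where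
  nonneg := tridiag_nonneg hl hl1
  le_one := tridiag_le_one hl1
  fixed := tridiag_powVec l
  norm_η := by simp
  norm_w := by simp
  inner_η_p := by rw [EuclideanSpace.inner_single_left]; simp [powVec]
  le_r x hx := re_inner_tridiag_le hl hl1 (by
    rw [EuclideanSpace.inner_single_left] at hx; simpa using hx)
  krylov i hi := by
    rw [EuclideanSpace.inner_single_left,
      tridiag_pow_apply_eq_zero l i _ (by simpa using hi), mul_zero]

theorem norm_inner_single_powVec {l : ℝ} (hl : 0 ≤ l) (n : ℕ) :
    ‖⟪EuclideanSpace.single 0 (1 : ℂ), powVec n l⟫_ℂ‖ = l ^ n := by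
  rw [EuclideanSpace.inner_single_left]
  simp [powVec, abs_of_nonneg hl]

namespace KrylovModel

theorem one_sub_rankOne_apply {V : Type*} [NormedAddCommGroup V] [InnerProductSpace ℂ V]
    (η v : V) : (1 - InnerProductSpace.rankOne ℂ η η) v = v - ⟪η, v⟫_ℂ • η := rfl

theorem one_sub_rankOne_apply_of_inner_eq_zero {V : Type*} [NormedAddCommGroup V]
    [InnerProductSpace ℂ V] {η v : V} (h : ⟪η, v⟫_ℂ = 0) :
    (1 - InnerProductSpace.rankOne ℂ η η) v = v := by
  rw [one_sub_rankOne_apply, h, zero_smul, sub_zero]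

variable {V : Type*} [NormedAddCommGroup V] [InnerProductSpace ℂ V] [CompleteSpace V]
  {r : ℝ} {n : ℕ} {T : V →L[ℂ] V} {p η w : V}

theorem selfAdjoint (h : KrylovModel r n T p η w) : IsSelfAdjoint T := .of_nonneg h.nonneg

theorem inner_comm (h : KrylovModel r n T p η w) (x y : V) : ⟪T x, y⟫_ℂ = ⟪x, T y⟫_ℂ :=
  (isSelfAdjoint_iff_isSymmetric.1 h.selfAdjoint) x y

theorem eigenvalue_eq_one (h : KrylovModel r n T p η w) {v : V} {t : ℝ} (hv : T v = (t : ℂ) • v)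
    (hpv : ⟪p, v⟫_ℂ ≠ 0) : t = 1 := by
  have h1 := h.inner_comm p v
  rw [h.fixed, hv, inner_smul_right] at h1
  have h2 : (t : ℂ) = 1 := by
    refine mul_right_cancel₀ hpv ?_
    rw [← h1, one_mul]
  exact_mod_cast h2

/-- The spectrum of `T` is contained in `[0, r] ∪ {1}`. -/
theorem eigenvalue_mem (h : KrylovModel r n T p η w) (hr : r ≤ 1) {v : V} {t : ℝ} (hv0 : ‖v‖ = 1)
    (hv : T v = (t : ℂ) • v) : 0 ≤ t ∧ (t = 1 ∨ t ≤ r) := by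
  have hvv : (⟪v, v⟫_ℂ).re = 1 := by
    have : (⟪v, v⟫_ℂ).re = ‖v‖ ^ 2 := inner_self_eq_norm_sq (𝕜 := ℂ) v
    rw [this, hv0, one_pow]
  constructor
  · have := (nonneg_iff_re_inner h.selfAdjoint).1 h.nonneg v
    rwa [hv, inner_smul_right, Complex.re_ofReal_mul, hvv, mul_one] at this
  · by_cases hpv : ⟪p, v⟫_ℂ = 0
    swap
    · exact Or.inl (h.eigenvalue_eq_one hv hpv)
    right
    have hvp : ⟪v, p⟫_ℂ = 0 := by rw [← inner_conj_symm, hpv, map_zero]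
    have ha := h.inner_η_p
    set a := ⟪η, p⟫_ℂ with ha'
    set b := ⟪η, v⟫_ℂ with hb'
    have hpp : (⟪p, p⟫_ℂ).re = ‖p‖ ^ 2 := inner_self_eq_norm_sq (𝕜 := ℂ) p
    -- the eigenvector is moved into the orthogonal complement of `η` along the fixed vector
    have h1 := h.le_r (a • v - b • p) (by
      rw [inner_sub_right, inner_smul_right, inner_smul_right, ← ha', ← hb', mul_comm, sub_self])
    have e1 : (⟪a • v - b • p, T (a • v - b • p)⟫_ℂ).re = t * ‖a‖ ^ 2 + ‖b‖ ^ 2 * ‖p‖ ^ 2 := by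
      have : ⟪a • v - b • p, T (a • v - b • p)⟫_ℂ = (t : ℂ) * ((starRingEnd ℂ a * a) * ⟪v, v⟫_ℂ) +
          (starRingEnd ℂ b * b) * ⟪p, p⟫_ℂ := by
        rw [map_sub, map_smul, map_smul, hv, h.fixed]
        simp only [inner_sub_left, inner_sub_right, inner_smul_left, inner_smul_right, hpv, hvp]
        ring
      rw [this, ← Complex.normSq_eq_conj_mul_self, ← Complex.normSq_eq_conj_mul_self,
        Complex.add_re, Complex.re_ofReal_mul, Complex.re_ofReal_mul, Complex.re_ofReal_mul, hvv,
        hpp, Complex.normSq_eq_norm_sq, Complex.normSq_eq_norm_sq, mul_one]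
    have e2 : ‖a • v - b • p‖ ^ 2 = ‖a‖ ^ 2 + ‖b‖ ^ 2 * ‖p‖ ^ 2 := by
      rw [@norm_sub_sq ℂ, inner_smul_left, inner_smul_right, hvp, norm_smul, norm_smul, hv0]
      simp [mul_pow]
    rw [e1, e2] at h1
    have ha2 : 0 < ‖a‖ ^ 2 := by positivity
    have hb2 : 0 ≤ ‖b‖ ^ 2 * ‖p‖ ^ 2 := by positivity
    nlinarith

/-- The operator `(1 - N) T (1 - N) + 2 N`, where `N` is the projection onto `ℂ η`. The term `2 N`
separates `η` from the eigenvectors of the compression, as the eigenvalue `2` is larger than all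
the others. -/
def compression (T : V →L[ℂ] V) (η : V) : V →L[ℂ] V :=
  (1 - InnerProductSpace.rankOne ℂ η η) * T * (1 - InnerProductSpace.rankOne ℂ η η) +
    (2 : ℂ) • InnerProductSpace.rankOne ℂ η η

theorem isSelfAdjoint_rankOne (η : V) : IsSelfAdjoint (InnerProductSpace.rankOne ℂ η η) := by
  rw [isSelfAdjoint_iff_isSymmetric]
  exact (InnerProductSpace.isPositive_rankOne_self η).isSymmetric

theorem isSelfAdjoint_one_sub_rankOne (η : V) :
    IsSelfAdjoint (1 - InnerProductSpace.rankOne ℂ η η) :=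
  (IsSelfAdjoint.one _).sub (isSelfAdjoint_rankOne η)

theorem isSelfAdjoint_compression (h : KrylovModel r n T p η w) :
    IsSelfAdjoint (compression T η) := by
  have h1 := isSelfAdjoint_one_sub_rankOne η
  rw [IsSelfAdjoint, compression, star_add, star_mul, star_mul, star_smul, h1.star_eq,
    h.selfAdjoint.star_eq, (isSelfAdjoint_rankOne η).star_eq, mul_assoc]
  simp

theorem inner_one_sub_rankOne (h : KrylovModel r n T p η w) (v : V) :
    ⟪η, (1 - InnerProductSpace.rankOne ℂ η η) v⟫_ℂ = 0 := by
  rw [one_sub_rankOne_apply, inner_sub_right, inner_smul_right, inner_self_eq_norm_sq_to_K,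
    h.norm_η]
  simp

theorem compression_apply_of_inner_eq_zero {V : Type*} [NormedAddCommGroup V]
    [InnerProductSpace ℂ V] {T : V →L[ℂ] V} {η v : V} (hv : ⟪η, v⟫_ℂ = 0) :
    compression T η v = (1 - InnerProductSpace.rankOne ℂ η η) (T v) := by
  rw [compression, add_apply, mul_apply_eq_comp, mul_apply_eq_comp,
    one_sub_rankOne_apply_of_inner_eq_zero hv, smul_apply, InnerProductSpace.rankOne_apply, hv]
  simp

theorem compression_η (h : KrylovModel r n T p η w) : compression T η η = (2 : ℂ) • η := by
  have hηη : ⟪η, η⟫_ℂ = 1 := by rw [inner_self_eq_norm_sq_to_K, h.norm_η]; simp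
  rw [compression, add_apply, mul_apply_eq_comp, one_sub_rankOne_apply η η, hηη, one_smul,
    sub_self, map_zero, smul_apply, InnerProductSpace.rankOne_apply, hηη, one_smul, zero_add]

/-- The eigenvectors of the compression that are not orthogonal to `w` are orthogonal to `η`, with
eigenvalue at most `r`. -/
theorem compression_eigenvalue (h : KrylovModel r n T p η w) (hn : 0 < n) (hr : r ≤ 1) {v : V}
    {t : ℝ} (hv0 : ‖v‖ = 1) (hv : compression T η v = (t : ℂ) • v) (hvw : ⟪v, w⟫_ℂ ≠ 0) :
    ⟪η, v⟫_ℂ = 0 ∧ 0 ≤ t ∧ t ≤ r := by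
  have hvv : (⟪v, v⟫_ℂ).re = 1 := by
    have : (⟪v, v⟫_ℂ).re = ‖v‖ ^ 2 := inner_self_eq_norm_sq (𝕜 := ℂ) v
    rw [this, hv0, one_pow]
  have hsym := isSelfAdjoint_iff_isSymmetric.1 h.isSelfAdjoint_compression
  have hQsym := isSelfAdjoint_iff_isSymmetric.1 (isSelfAdjoint_one_sub_rankOne η)
  have hηv : ⟪η, v⟫_ℂ = 0 := by
    by_contra hne
    have h1 := hsym η v
    rw [coe_coe, h.compression_η, hv, inner_smul_left, inner_smul_right] at h1
    have ht : (t : ℂ) = 2 := by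
      have := mul_right_cancel₀ hne h1
      exact this.symm.trans (by apply Complex.ext <;> simp)
    set u := (1 - InnerProductSpace.rankOne ℂ η η) v with hu
    have h2 := h.le_r u (h.inner_one_sub_rankOne v)
    have h3 : (1 - InnerProductSpace.rankOne ℂ η η) (T u) = (2 : ℂ) • u := by
      have e : compression T η v = (1 - InnerProductSpace.rankOne ℂ η η) (T u) +
        (2 : ℂ) • (⟪η, v⟫_ℂ • η) := rfl
      rw [hv, ht] at e
      rw [← sub_eq_iff_eq_add, ← smul_sub, ← one_sub_rankOne_apply] at e
      exact e.symm
    have h4 : ⟪u, T u⟫_ℂ = 2 * ⟪u, u⟫_ℂ := by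
      have e := hQsym u (T u)
      rw [coe_coe, h3, one_sub_rankOne_apply_of_inner_eq_zero (h.inner_one_sub_rankOne v),
        inner_smul_right] at e
      exact e
    have h5 : (⟪u, u⟫_ℂ).re = ‖u‖ ^ 2 := inner_self_eq_norm_sq (𝕜 := ℂ) u
    have h6 : u = 0 := by
      rw [h4] at h2
      have h7 : (2 * ⟪u, u⟫_ℂ).re = 2 * ‖u‖ ^ 2 := by
        rw [← h5]; simp
      rw [h7] at h2
      have : ‖u‖ ^ 2 = 0 := by nlinarith [sq_nonneg ‖u‖]
      simpa using this
    apply hvw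
    have h8 : v = ⟪η, v⟫_ℂ • η := by
      rw [one_sub_rankOne_apply] at hu
      exact sub_eq_zero.1 (hu.symm.trans h6)
    have h9 : ⟪η, w⟫_ℂ = 0 := by simpa using h.krylov 0 hn
    rw [h8, inner_smul_left, h9, mul_zero]
  rw [compression_apply_of_inner_eq_zero hηv] at hv
  have h1 : ⟪v, T v⟫_ℂ = t * ⟪v, v⟫_ℂ := by
    have e := hQsym v (T v)
    rw [coe_coe, hv, one_sub_rankOne_apply_of_inner_eq_zero hηv, inner_smul_right] at e
    exact e
  have h2 : (⟪v, T v⟫_ℂ).re = t := by rw [h1, Complex.re_ofReal_mul, hvv, mul_one]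
  refine ⟨hηv, ?_, ?_⟩
  · exact ((nonneg_iff_re_inner h.selfAdjoint).1 h.nonneg v).trans_eq h2
  · have := h.le_r v hηv
    rwa [h2, hv0, one_pow, mul_one] at this

theorem compression_pow_apply (h : KrylovModel r n T p η w) {i : ℕ} (hi : i < n) :
    (compression T η ^ i) w = (T ^ i) w := by
  induction i with
  | zero => rfl
  | succ i ih =>
    have h1 := h.krylov (i + 1) hi
    rw [pow_succ', mul_apply_eq_comp] at h1
    rw [pow_succ', mul_apply_eq_comp, ih (by omega), pow_succ', mul_apply_eq_comp,
      compression_apply_of_inner_eq_zero (h.krylov i (by omega)),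
      one_sub_rankOne_apply_of_inner_eq_zero h1]

/-- The moments at `w` of `T` and of its compression agree up to the order `2 n - 1`. -/
theorem moment_eq (h : KrylovModel r n T p η w) (hn : 0 < n) {m : ℕ} (hm : m < 2 * n) :
    ⟪w, (compression T η ^ m) w⟫_ℂ = ⟪w, (T ^ m) w⟫_ℂ := by
  rcases m with - | m
  · rfl
  obtain ⟨i, j, hi, hj, rfl⟩ : ∃ i j, i < n ∧ j < n ∧ m = i + j :=
    ⟨min m (n - 1), m - min m (n - 1), by omega, by omega, by omega⟩
  have hp : ∀ S : V →L[ℂ] V, IsSelfAdjoint S →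
      ⟪w, (S ^ (i + j + 1)) w⟫_ℂ = ⟪(S ^ i) w, S ((S ^ j) w)⟫_ℂ := fun S hS => by
    have e := (isSelfAdjoint_iff_isSymmetric.1 (hS.pow i)) w (S ((S ^ j) w))
    rw [coe_coe] at e
    rw [e, add_assoc, pow_add, pow_succ', mul_apply_eq_comp, mul_apply_eq_comp]
  rw [hp _ h.isSelfAdjoint_compression, hp _ h.selfAdjoint, h.compression_pow_apply hi,
    h.compression_pow_apply hj, compression_apply_of_inner_eq_zero (h.krylov j hj)]
  have e := (isSelfAdjoint_iff_isSymmetric.1 (isSelfAdjoint_one_sub_rankOne η)) ((T ^ i) w)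
    (T ((T ^ j) w))
  rw [coe_coe, one_sub_rankOne_apply_of_inner_eq_zero (h.krylov i hi)] at e
  exact e.symm

end KrylovModel

/-! ### Spectral measures -/

section SpectralMeasure

variable {V : Type*} [NormedAddCommGroup V] [InnerProductSpace ℂ V]

theorem exists_eigenbasis [FiniteDimensional ℂ V] [CompleteSpace V] {S : V →L[ℂ] V}
    (hS : IsSelfAdjoint S) :
    ∃ (N : ℕ) (b : OrthonormalBasis (Fin N) ℂ V) (t : Fin N → ℝ),
      ∀ j, S (b j) = (t j : ℂ) • b j := by
  have h := isSelfAdjoint_iff_isSymmetric.1 hS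
  exact ⟨_, h.eigenvectorBasis rfl, h.eigenvalues rfl, fun j => h.apply_eigenvectorBasis rfl j⟩

/-- The moments of the spectral measure of `S` at `w`, which has the weight `|⟪b j, w⟫|²` at the
eigenvalue `t j`. -/
theorem inner_pow_eq_sum {N : ℕ} (b : OrthonormalBasis (Fin N) ℂ V) {S : V →L[ℂ] V}
    {t : Fin N → ℝ} (h : ∀ j, S (b j) = (t j : ℂ) • b j) (w : V) (m : ℕ) :
    ⟪w, (S ^ m) w⟫_ℂ = ∑ j, ((‖⟪b j, w⟫_ℂ‖ ^ 2 : ℝ) : ℂ) * (t j : ℂ) ^ m := by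
  have hm : ∀ j, (S ^ m) (b j) = ((t j : ℂ) ^ m) • b j := fun j => by
    induction m with
    | zero => simp
    | succ m ih => rw [pow_succ', mul_apply_eq_comp, ih, map_smul, h, smul_smul, pow_succ]
  conv_lhs => rw [← b.sum_repr' w]
  rw [map_sum, b.sum_repr' w, inner_sum]
  refine Finset.sum_congr rfl fun j _ => ?_
  rw [map_smul, hm, inner_smul_right, inner_smul_right, ← inner_conj_symm w, Complex.ofReal_pow,
    ← Complex.mul_conj']
  ring

theorem sum_weights {N : ℕ} (b : OrthonormalBasis (Fin N) ℂ V) {w : V} (hw : ‖w‖ = 1) :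
    ∑ j, ‖⟪b j, w⟫_ℂ‖ ^ 2 = 1 := by
  rw [b.sum_sq_norm_inner_right, hw, one_pow]

/-- The weight of the spectral measure at `w` of the eigenvalue `1` is bounded below. -/
theorem KrylovModel.le_weight [CompleteSpace V] {r : ℝ} {n : ℕ} {T : V →L[ℂ] V} {p η w : V}
    (h : KrylovModel r n T p η w) {N : ℕ} (b : OrthonormalBasis (Fin N) ℂ V) {t : Fin N → ℝ}
    (ht : ∀ j, T (b j) = (t j : ℂ) • b j) :
    ‖⟪w, p⟫_ℂ‖ ^ 2 ≤ (∑ j with t j = 1, ‖⟪b j, w⟫_ℂ‖ ^ 2) * ‖p‖ ^ 2 := by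
  have h1 : ⟪w, p⟫_ℂ = ∑ j with t j = 1, ⟪w, b j⟫_ℂ * ⟪b j, p⟫_ℂ := by
    rw [Finset.sum_filter, ← b.sum_inner_mul_inner]
    refine Finset.sum_congr rfl fun j _ => ?_
    split_ifs with hj
    · rfl
    · have : ⟪p, b j⟫_ℂ = 0 := by
        by_contra hne
        exact hj (h.eigenvalue_eq_one (ht j) hne)
      rw [← inner_conj_symm (b j) p, this, map_zero, mul_zero]
  calc ‖⟪w, p⟫_ℂ‖ ^ 2 ≤ (∑ j with t j = 1, ‖⟪b j, w⟫_ℂ‖ * ‖⟪b j, p⟫_ℂ‖) ^ 2 := by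
        gcongr
        rw [h1]
        refine (norm_sum_le _ _).trans (Finset.sum_le_sum fun j _ => ?_)
        rw [norm_mul, norm_inner_symm]
    _ ≤ (∑ j with t j = 1, ‖⟪b j, w⟫_ℂ‖ ^ 2) * ∑ j with t j = 1, ‖⟪b j, p⟫_ℂ‖ ^ 2 :=
        Finset.sum_mul_sq_le_sq_mul_sq _ _ _
    _ ≤ _ := by
        gcongr
        rw [← b.sum_sq_norm_inner_right p]
        exact Finset.sum_le_sum_of_subset_of_nonneg (Finset.filter_subset _ _)
          fun _ _ _ => sq_nonneg _

end SpectralMeasure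

/-! ### Comparison of operator segments on tensor products -/

section Segment

variable {E : Type u} [NormedAddCommGroup E] [InnerProductSpace ℂ E]
variable {ι : Type} [Fintype ι]

/-- The point `X + t (Y - X) + ε` of the segment from `X` to `Y`, shifted by `ε`. -/
def seg (X Y : Fin k → E →L[ℂ] E) (t ε : ℝ) : Fin k → E →L[ℂ] E := fun i =>
  X i + (t : ℂ) • (Y i - X i) + (ε : ℂ) • 1

/-- The segment from `X` to `Y` with an operator `T` as its parameter. -/
def segOp (X Y : Fin k → E →L[ℂ] E) (T : EuclideanSpace ℂ ι →L[ℂ] EuclideanSpace ℂ ι) :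
    Fin k → EuclideanSpace ℂ ι ⊗[ℂ] E →L[ℂ] EuclideanSpace ℂ ι ⊗[ℂ] E := fun i =>
  TensorProduct.mapL 1 (X i) + TensorProduct.mapL T (Y i - X i)

/-- The segment from `X` to `Y` with the compression of `T` to the orthogonal complement of `η` as
its parameter, shifted by `ε` on this complement and by the larger number `ε + ‖Yᵢ - Xᵢ‖² / ε` on
the line `ℂ η`, which compensates for the off-diagonal part of `T`. -/
def segCompr (X Y : Fin k → E →L[ℂ] E) (T : EuclideanSpace ℂ ι →L[ℂ] EuclideanSpace ℂ ι)
    (η : EuclideanSpace ℂ ι) (ε : ℝ) :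
    Fin k → EuclideanSpace ℂ ι ⊗[ℂ] E →L[ℂ] EuclideanSpace ℂ ι ⊗[ℂ] E := fun i =>
  TensorProduct.mapL 1 (X i + (ε : ℂ) • 1) +
    TensorProduct.mapL ((1 - InnerProductSpace.rankOne ℂ η η) * T *
      (1 - InnerProductSpace.rankOne ℂ η η)) (Y i - X i) +
    ((‖Y i - X i‖ ^ 2 / ε : ℝ) : ℂ) • TensorProduct.mapL (InnerProductSpace.rankOne ℂ η η) 1

theorem segOp_tmul (X Y : Fin k → E →L[ℂ] E) {T : EuclideanSpace ℂ ι →L[ℂ] EuclideanSpace ℂ ι}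
    {v : EuclideanSpace ℂ ι} {t : ℝ} (hv : T v = (t : ℂ) • v) (i : Fin k) (x : E) :
    segOp X Y T i (v ⊗ₜ[ℂ] x) = v ⊗ₜ[ℂ] seg X Y t 0 i x := by
  simp [segOp, seg, hv, TensorProduct.tmul_add, TensorProduct.smul_tmul']

theorem segCompr_tmul (X Y : Fin k → E →L[ℂ] E)
    {T : EuclideanSpace ℂ ι →L[ℂ] EuclideanSpace ℂ ι} {η v : EuclideanSpace ℂ ι} {t : ℝ}
    (hηv : ⟪η, v⟫_ℂ = 0) (hv : (1 - InnerProductSpace.rankOne ℂ η η) (T v) = (t : ℂ) • v)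
    (ε : ℝ) (i : Fin k) (x : E) :
    segCompr X Y T η ε i (v ⊗ₜ[ℂ] x) = v ⊗ₜ[ℂ] seg X Y t ε i x := by
  have h1 : ((1 - InnerProductSpace.rankOne ℂ η η) * T *
      (1 - InnerProductSpace.rankOne ℂ η η)) v = (t : ℂ) • v := by
    rw [mul_apply_eq_comp, mul_apply_eq_comp,
      KrylovModel.one_sub_rankOne_apply_of_inner_eq_zero hηv, hv]
  have h2 : InnerProductSpace.rankOne ℂ η η v = 0 := by
    rw [InnerProductSpace.rankOne_apply, hηv, zero_smul]
  simp only [segCompr, seg, add_apply, smul_apply, TensorProduct.mapL_tmul, h1, h2,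
    one_apply_eq_self, TensorProduct.zero_tmul, smul_zero, add_zero, TensorProduct.tmul_add,
    ← TensorProduct.smul_tmul', TensorProduct.tmul_smul]
  abel

variable [CompleteSpace E]

theorem le_re_inner_mapL {a : EuclideanSpace ℂ ι →L[ℂ] EuclideanSpace ℂ ι} (ha : 0 ≤ a)
    {A : E →L[ℂ] E} {δ : ℝ} (h : ∀ x, δ * ‖x‖ ^ 2 ≤ (⟪x, A x⟫_ℂ).re)
    (z : EuclideanSpace ℂ ι ⊗[ℂ] E) :
    δ * (⟪z, TensorProduct.mapL a (1 : E →L[ℂ] E) z⟫_ℂ).re ≤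
      (⟪z, TensorProduct.mapL a A z⟫_ℂ).re := by
  obtain ⟨s, rfl⟩ := CStarAlgebra.nonneg_iff_eq_star_mul_self.1 ha
  rw [inner_mapL_star_mul_self, inner_mapL_star_mul_self]
  have h1 : AccretiveBound 1 δ A := fun x => by simpa using h x
  have h2 := h1.mapL (ι := ι) (TensorProduct.mapL s (1 : E →L[ℂ] E) z)
  have h3 : TensorProduct.mapL (1 : EuclideanSpace ℂ ι →L[ℂ] _) (1 : E →L[ℂ] E) = 1 :=
    TensorProduct.mapL_id_id
  rw [one_mul] at h2
  rw [h3, one_apply_eq_self]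
  refine le_trans (le_of_eq ?_) h2
  congr 1
  exact inner_self_eq_norm_sq (𝕜 := ℂ) _

theorem adjoint_mapL_of_isSelfAdjoint {a : EuclideanSpace ℂ ι →L[ℂ] EuclideanSpace ℂ ι}
    {A : E →L[ℂ] E} (ha : IsSelfAdjoint a) (hA : IsSelfAdjoint A) :
    adjoint (TensorProduct.mapL a A) = TensorProduct.mapL a A := by
  rw [TensorProduct.adjoint_mapL, ← star_eq_adjoint, ← star_eq_adjoint, ha.star_eq, hA.star_eq]

theorem seg_mem_posCone {X Y : Fin k → E →L[ℂ] E} (hX : X ∈ posCone k E) (hY : Y ∈ posCone k E)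
    {t ε : ℝ} (ht : 0 ≤ t) (ht1 : t ≤ 1) (hε : 0 ≤ ε) : seg X Y t ε ∈ posCone k E := fun i => by
  have h1 := Realization.posCone_convexComb hX hY (sub_nonneg.2 ht1) ht (sub_add_cancel 1 t) i
  refine h1.of_le ?_
  have h2 : seg X Y t ε i = ((1 - t : ℝ) : ℂ) • X i + (t : ℂ) • Y i + (ε : ℂ) • 1 := by
    rw [seg, Complex.ofReal_sub, Complex.ofReal_one, sub_smul, one_smul, smul_sub]
    abel
  rw [h2]
  refine le_add_of_nonneg_right ?_
  refine (nonneg_iff_re_inner (isSelfAdjoint_real_smul_one ε)).2 fun x => ?_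
  have : (⟪x, x⟫_ℂ).re = ‖x‖ ^ 2 := inner_self_eq_norm_sq (𝕜 := ℂ) x
  rw [smul_apply, one_apply_eq_self, inner_smul_right, Complex.re_ofReal_mul, this]
  positivity

theorem segOp_mem_posCone {X Y : Fin k → E →L[ℂ] E} (hX : X ∈ posCone k E)
    (hY : Y ∈ posCone k E) {T : EuclideanSpace ℂ ι →L[ℂ] EuclideanSpace ℂ ι} (hT : 0 ≤ T)
    (hT1 : T ≤ 1) : segOp X Y T ∈ posCone k (EuclideanSpace ℂ ι ⊗[ℂ] E) := by
  refine mem_posCone_iff.2 fun i => ⟨?_, ?_⟩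
  · rw [IsSelfAdjoint, star_eq_adjoint, segOp, map_add,
      adjoint_mapL_of_isSelfAdjoint (.one _) (hX i).isSelfAdjoint,
      adjoint_mapL_of_isSelfAdjoint (.of_nonneg hT)
        ((hY i).isSelfAdjoint.sub (hX i).isSelfAdjoint)]
  · obtain ⟨-, ε, hε, h⟩ := mem_posCone_iff.1 hX i
    obtain ⟨-, δ, hδ, h'⟩ := mem_posCone_iff.1 hY i
    refine ⟨min ε δ, lt_min hε hδ, fun z => ?_⟩
    have h1 := le_re_inner_mapL (sub_nonneg.2 hT1) (A := X i) (δ := min ε δ) (fun x =>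
      (mul_le_mul_of_nonneg_right (min_le_left _ _) (sq_nonneg _)).trans (h x)) z
    have h2 := le_re_inner_mapL hT (A := Y i) (δ := min ε δ) (fun x =>
      (mul_le_mul_of_nonneg_right (min_le_right _ _) (sq_nonneg _)).trans (h' x)) z
    have e1 : TensorProduct.mapL (1 - T) (1 : E →L[ℂ] E) z =
        z - TensorProduct.mapL T (1 : E →L[ℂ] E) z := by
      have : TensorProduct.mapL (1 - T) (1 : E →L[ℂ] E) =
          1 - TensorProduct.mapL T (1 : E →L[ℂ] E) := by
        apply ContinuousLinearMap.coe_inj.mp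
        ext v x
        simp [TensorProduct.sub_tmul]
      rw [this]
      rfl
    -- the segment is the convex combination of its ends with operator coefficients `1 - T` and `T`
    have e2 : segOp X Y T i z =
        TensorProduct.mapL (1 - T) (X i) z + TensorProduct.mapL T (Y i) z := by
      have : segOp X Y T i = TensorProduct.mapL (1 - T) (X i) + TensorProduct.mapL T (Y i) := by
        apply ContinuousLinearMap.coe_inj.mp
        ext v x
        simp [segOp, TensorProduct.sub_tmul, TensorProduct.tmul_sub]
        abel
      rw [this, add_apply]
    have e3 : (⟪z, z⟫_ℂ).re = ‖z‖ ^ 2 := inner_self_eq_norm_sq (𝕜 := ℂ) z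
    rw [e1, inner_sub_right, Complex.sub_re, e3] at h1
    rw [e2, inner_add_right, Complex.add_re]
    linarith

theorem isSelfAdjoint_segCompr {X Y : Fin k → E →L[ℂ] E} (hX : X ∈ posCone k E)
    (hY : Y ∈ posCone k E) {T : EuclideanSpace ℂ ι →L[ℂ] EuclideanSpace ℂ ι}
    (hT : IsSelfAdjoint T) (η : EuclideanSpace ℂ ι) (ε : ℝ) (i : Fin k) :
    IsSelfAdjoint (segCompr X Y T η ε i) := by
  have hQ := KrylovModel.isSelfAdjoint_one_sub_rankOne η
  have h1 : IsSelfAdjoint ((1 - InnerProductSpace.rankOne ℂ η η) * T *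
      (1 - InnerProductSpace.rankOne ℂ η η)) := by
    rw [IsSelfAdjoint, star_mul, star_mul, hQ.star_eq, hT.star_eq, mul_assoc]
  rw [IsSelfAdjoint, star_eq_adjoint, segCompr, map_add, map_add, LinearIsometryEquiv.map_smulₛₗ,
    adjoint_mapL_of_isSelfAdjoint (.one _)
      ((hX i).isSelfAdjoint.add (isSelfAdjoint_real_smul_one ε)),
    adjoint_mapL_of_isSelfAdjoint h1 ((hY i).isSelfAdjoint.sub (hX i).isSelfAdjoint),
    adjoint_mapL_of_isSelfAdjoint (KrylovModel.isSelfAdjoint_rankOne η) (.one _),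
    Complex.conj_ofReal]

theorem isStarProjection_rankOne {V : Type*} [NormedAddCommGroup V] [InnerProductSpace ℂ V]
    [CompleteSpace V] {η : V} (hη : ‖η‖ = 1) :
    IsStarProjection (InnerProductSpace.rankOne ℂ η η) := by
  refine ⟨?_, KrylovModel.isSelfAdjoint_rankOne η⟩
  refine ContinuousLinearMap.ext fun v => ?_
  have hηη : ⟪η, η⟫_ℂ = 1 := by rw [inner_self_eq_norm_sq_to_K, hη]; simp
  rw [mul_apply_eq_comp, InnerProductSpace.rankOne_apply, InnerProductSpace.rankOne_apply,
    inner_smul_right, hηη, mul_one]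

theorem norm_inner_apply_le {V : Type*} [NormedAddCommGroup V] [InnerProductSpace ℂ V]
    {A : V →L[ℂ] V} {m : ℝ} (hA : ‖A‖ ≤ m) (z y : V) : ‖⟪z, A y⟫_ℂ‖ ≤ ‖z‖ * (m * ‖y‖) :=
  (norm_inner_le_norm _ _).trans
    (mul_le_mul_of_nonneg_left (le_of_opNorm_le _ hA y) (norm_nonneg _))

theorem re_inner_combination {V : Type*} [NormedAddCommGroup V] [InnerProductSpace ℂ V]
    (z s y a b : V) (p q : ℝ) : (⟪z, s - (p : ℂ) • z - (q : ℂ) • y + (a + b)⟫_ℂ).re =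
      (⟪z, s⟫_ℂ).re - p * (⟪z, z⟫_ℂ).re - q * (⟪z, y⟫_ℂ).re + ((⟪z, a⟫_ℂ).re + (⟪z, b⟫_ℂ).re) := by
  rw [inner_add_right, inner_add_right, inner_sub_right, inner_sub_right, inner_smul_right,
    inner_smul_right, Complex.add_re, Complex.add_re, Complex.sub_re, Complex.sub_re,
    Complex.re_ofReal_mul, Complex.re_ofReal_mul]

/-- The part of `T` removed by the compression is absorbed by the shifts, by the inequality
`2 a b ≤ ε a² + b² / ε`. -/
theorem re_inner_segOp_le {X Y : Fin k → E →L[ℂ] E}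
    {T : EuclideanSpace ℂ ι →L[ℂ] EuclideanSpace ℂ ι} (hT : ‖T‖ ≤ 1) {η : EuclideanSpace ℂ ι}
    (hη : ‖η‖ = 1) {ε : ℝ} (hε : 0 < ε) (i : Fin k) (z : EuclideanSpace ℂ ι ⊗[ℂ] E) :
    (⟪z, segOp X Y T i z⟫_ℂ).re ≤ (⟪z, segCompr X Y T η ε i z⟫_ℂ).re := by
  have hN := isStarProjection_rankOne hη
  set N := InnerProductSpace.rankOne ℂ η η with hN'
  have hQ : ‖1 - N‖ ≤ 1 := hN.one_sub.norm_le
  set Δ := Y i - X i with hΔ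
  set m := ‖Δ‖ with hm
  set y := TensorProduct.mapL N (1 : E →L[ℂ] E) z with hy
  have hid : TensorProduct.mapL (1 : EuclideanSpace ℂ ι →L[ℂ] _) (1 : E →L[ℂ] E) = 1 :=
    TensorProduct.mapL_id_id
  have hyy : (⟪z, y⟫_ℂ).re = ‖y‖ ^ 2 := by
    have h1 := inner_mapL_star_mul_self N (1 : E →L[ℂ] E) z z
    rw [hN.isSelfAdjoint.star_eq, hN.isIdempotentElem.eq, hid, one_apply_eq_self, ← hy] at h1
    rw [h1]
    exact inner_self_eq_norm_sq (𝕜 := ℂ) y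
  have hzz : (⟪z, z⟫_ℂ).re = ‖z‖ ^ 2 := inner_self_eq_norm_sq (𝕜 := ℂ) z
  -- the part of `T` removed by the compression is `T N + N T (1 - N)`
  have e : segOp X Y T i z = segCompr X Y T η ε i z - (ε : ℂ) • z - ((m ^ 2 / ε : ℝ) : ℂ) • y +
      (TensorProduct.mapL T Δ y +
        TensorProduct.mapL N (1 : E →L[ℂ] E) (TensorProduct.mapL (T * (1 - N)) Δ z)) := by
    have h1 : segOp X Y T i = segCompr X Y T η ε i - (ε : ℂ) • 1 -
        ((m ^ 2 / ε : ℝ) : ℂ) • TensorProduct.mapL N (1 : E →L[ℂ] E) +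
        (TensorProduct.mapL T Δ * TensorProduct.mapL N (1 : E →L[ℂ] E) +
        TensorProduct.mapL N (1 : E →L[ℂ] E) * TensorProduct.mapL (T * (1 - N)) Δ) := by
      apply ContinuousLinearMap.coe_inj.mp
      ext v x
      simp [segOp, segCompr, TensorProduct.sub_tmul, TensorProduct.tmul_add, ← hN', ← hΔ, ← hm,
        -Complex.coe_smul]
      abel
    rw [h1]
    rfl
  have b1 : ‖⟪z, TensorProduct.mapL T Δ y⟫_ℂ‖ ≤ ‖z‖ * (m * ‖y‖) := by
    refine norm_inner_apply_le ((TensorProduct.norm_mapL_le _ _).trans ?_) z y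
    exact mul_le_of_le_one_left (norm_nonneg _) hT
  have b2 : ‖⟪z, TensorProduct.mapL N (1 : E →L[ℂ] E) (TensorProduct.mapL (T * (1 - N)) Δ z)⟫_ℂ‖ ≤
      ‖y‖ * (m * ‖z‖) := by
    have h1 := adjoint_mapL_of_isSelfAdjoint (E := E) hN.isSelfAdjoint (.one _)
    rw [← adjoint_inner_left, h1, ← hy]
    refine norm_inner_apply_le ((TensorProduct.norm_mapL_le _ _).trans ?_) y z
    refine mul_le_of_le_one_left (norm_nonneg _) ((norm_mul_le _ _).trans ?_)
    exact mul_le_one₀ hT (norm_nonneg _) hQ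
  have h3 := (Complex.abs_re_le_norm _).trans' (le_abs_self _) |>.trans b1
  have h4 := (Complex.abs_re_le_norm _).trans' (le_abs_self _) |>.trans b2
  have h5 : 0 ≤ ε * ‖z‖ ^ 2 + m ^ 2 / ε * ‖y‖ ^ 2 - 2 * (m * ‖y‖ * ‖z‖) := by
    have : ε * ‖z‖ ^ 2 + m ^ 2 / ε * ‖y‖ ^ 2 - 2 * (m * ‖y‖ * ‖z‖) =
        (ε * ‖z‖ - m * ‖y‖) ^ 2 / ε := by field_simp; ring
    rw [this]
    positivity
  rw [e]
  refine (re_inner_combination z _ y _ _ ε (m ^ 2 / ε)).trans_le ?_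
  rw [hzz, hyy]
  linarith

theorem segOp_le_segCompr {X Y : Fin k → E →L[ℂ] E} (hX : X ∈ posCone k E)
    (hY : Y ∈ posCone k E) {T : EuclideanSpace ℂ ι →L[ℂ] EuclideanSpace ℂ ι} (hT : 0 ≤ T)
    (hT1 : T ≤ 1) {η : EuclideanSpace ℂ ι} (hη : ‖η‖ = 1) {ε : ℝ} (hε : 0 < ε) (i : Fin k) :
    segOp X Y T i ≤ segCompr X Y T η ε i := by
  have h1 := isSelfAdjoint_segCompr hX hY (.of_nonneg hT) η ε i
  have h2 := (segOp_mem_posCone hX hY hT hT1 i).isSelfAdjoint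
  exact (le_iff_re_inner (h1.sub h2)).2 fun z =>
    re_inner_segOp_le ((CStarAlgebra.norm_le_one_iff_of_nonneg T hT).2 hT1) hη hε i z

end Segment

/-! ### Comparison of a monotone map with a holomorphic function on a segment -/

section LocalComparison

theorem re_inner_sum_tmul {E : Type*} [NormedAddCommGroup E] [InnerProductSpace ℂ E]
    {V : Type*} [NormedAddCommGroup V] [InnerProductSpace ℂ V] {N : ℕ}
    (b : OrthonormalBasis (Fin N) ℂ V) (w : V) (x : E) (y : Fin N → E) :
    (⟪w ⊗ₜ[ℂ] x, ∑ j, ⟪b j, w⟫_ℂ • (b j ⊗ₜ[ℂ] y j)⟫_ℂ).re =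
      ∑ j, ‖⟪b j, w⟫_ℂ‖ ^ 2 * (⟪x, y j⟫_ℂ).re := by
  rw [inner_sum, Complex.re_sum]
  refine Finset.sum_congr rfl fun j _ => ?_
  refine (congrArg Complex.re (inner_smul_right (w ⊗ₜ[ℂ] x) (b j ⊗ₜ[ℂ] y j) _)).trans ?_
  rw [TensorProduct.inner_tmul, ← mul_assoc, ← inner_conj_symm w,
    Complex.mul_conj', ← Complex.ofReal_pow, Complex.re_ofReal_mul]

variable {E : Type u} [NormedAddCommGroup E] [InnerProductSpace ℂ E] [CompleteSpace E]

/-- The isometry `x ↦ v ⊗ x` for a unit vector `v`. -/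
def tmulIsometry (E : Type u) [NormedAddCommGroup E] [InnerProductSpace ℂ E] {V : Type*}
    [NormedAddCommGroup V] [InnerProductSpace ℂ V] {v : V} (hv : ‖v‖ = 1) : E →ₗᵢ[ℂ] V ⊗[ℂ] E where
  toLinearMap := TensorProduct.mk ℂ V E v
  norm_map' x := by
    rw [TensorProduct.mk_apply, TensorProduct.norm_tmul, hv, one_mul]

/-- The values of a map respecting isometries at a tuple that is diagonal with respect to an
orthonormal basis of the first tensor factor. -/
theorem RespectsIsometries.re_inner_eq_sum {G : GradedMap.{u} k} (hG : RespectsIsometries G)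
    {ι : Type} [Fintype ι] {N : ℕ} (b : OrthonormalBasis (Fin N) ℂ (EuclideanSpace ℂ ι))
    {X' : Fin k → EuclideanSpace ℂ ι ⊗[ℂ] E →L[ℂ] EuclideanSpace ℂ ι ⊗[ℂ] E}
    (hX' : X' ∈ posCone k (EuclideanSpace ℂ ι ⊗[ℂ] E)) {Z : Fin N → Fin k → E →L[ℂ] E}
    {w : EuclideanSpace ℂ ι} (hZ : ∀ j, ⟪b j, w⟫_ℂ ≠ 0 → Z j ∈ posCone k E ∧
      ∀ i x, X' i (b j ⊗ₜ[ℂ] x) = b j ⊗ₜ[ℂ] Z j i x) (x : E) :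
    (⟪w ⊗ₜ[ℂ] x, G _ X' (w ⊗ₜ[ℂ] x)⟫_ℂ).re =
      ∑ j, ‖⟪b j, w⟫_ℂ‖ ^ 2 * (⟪x, G E (Z j) x⟫_ℂ).re := by
  have h1 : w ⊗ₜ[ℂ] x = ∑ j, ⟪b j, w⟫_ℂ • (b j ⊗ₜ[ℂ] x) := by
    conv_lhs => rw [← b.sum_repr' w, TensorProduct.sum_tmul]
    rfl
  have h2 : G _ X' (w ⊗ₜ[ℂ] x) = ∑ j, ⟪b j, w⟫_ℂ • (b j ⊗ₜ[ℂ] G E (Z j) x) := by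
    rw [h1, map_sum]
    refine Finset.sum_congr rfl fun j _ => ?_
    rw [map_smul]
    by_cases hj : ⟪b j, w⟫_ℂ = 0
    · rw [hj, zero_smul, zero_smul]
    · congr 1
      exact hG _ _ (Z j) X' (tmulIsometry E (b.orthonormal.1 j)) (hZ j hj).1 hX' (hZ j hj).2 x
  rw [h2, re_inner_sum_tmul]

/-- The value of `t ↦ ⟪x, G(X + t (Y - X)) x⟫`, averaged over the spectral measure of `T` at `w`, is
at most the average over the spectral measure of the compression. In the second average the values
are replaced by the limits `g` of those at shifted segments. -/
theorem KrylovModel.sum_le {G : GradedMap.{u} k} (hG : RespectsIsometries G)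
    (hmono : IsOperatorMonotone G) {X Y : Fin k → E →L[ℂ] E} (hX : X ∈ posCone k E)
    (hY : Y ∈ posCone k E) (x : E) {ι : Type} [Fintype ι] {r : ℝ} {n : ℕ}
    {T : EuclideanSpace ℂ ι →L[ℂ] EuclideanSpace ℂ ι} {p η w : EuclideanSpace ℂ ι}
    (h : KrylovModel r n T p η w) (hn : 0 < n) (hr : r ≤ 1) {g : ℝ → ℝ}
    (hg : ∀ t ∈ Set.Icc 0 r, Tendsto (fun ε : ℝ => (⟪x, G E (seg X Y t ε) x⟫_ℂ).re) (𝓝[>] 0)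
      (𝓝 (g t)))
    {N N' : ℕ} {b : OrthonormalBasis (Fin N) ℂ (EuclideanSpace ℂ ι)} {t : Fin N → ℝ}
    (hb : ∀ j, T (b j) = (t j : ℂ) • b j)
    {b' : OrthonormalBasis (Fin N') ℂ (EuclideanSpace ℂ ι)} {t' : Fin N' → ℝ}
    (hb' : ∀ j, compression T η (b' j) = (t' j : ℂ) • b' j) :
    ∑ j, ‖⟪b j, w⟫_ℂ‖ ^ 2 * (⟪x, G E (seg X Y (t j) 0) x⟫_ℂ).re ≤
      ∑ j, ‖⟪b' j, w⟫_ℂ‖ ^ 2 * g (t' j) := by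
  have hspec := fun j (hj : ⟪b' j, w⟫_ℂ ≠ 0) =>
    h.compression_eigenvalue hn hr (b'.orthonormal.1 j) (hb' j) hj
  have hT := segOp_mem_posCone hX hY h.nonneg h.le_one
  have h1 := hG.re_inner_eq_sum b hT (Z := fun j => seg X Y (t j) 0) (w := w) (fun j _ => by
    obtain ⟨h0, h1⟩ := h.eigenvalue_mem hr (b.orthonormal.1 j) (hb j)
    exact ⟨seg_mem_posCone hX hY h0 (h1.elim le_of_eq fun h' => h'.trans hr) le_rfl,
      segOp_tmul X Y (hb j)⟩) x
  rw [← h1]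
  have hlim : Tendsto (fun ε : ℝ => ∑ j, ‖⟪b' j, w⟫_ℂ‖ ^ 2 *
      (⟪x, G E (seg X Y (t' j) ε) x⟫_ℂ).re) (𝓝[>] 0) (𝓝 (∑ j, ‖⟪b' j, w⟫_ℂ‖ ^ 2 * g (t' j))) := by
    refine tendsto_finsetSum _ fun j _ => ?_
    by_cases hj : ⟪b' j, w⟫_ℂ = 0
    · simp [hj]
    · exact (hg _ (hspec j hj).2).const_mul _
  refine ge_of_tendsto hlim ?_
  filter_upwards [self_mem_nhdsWithin] with ε (hε : 0 < ε)
  have hle := segOp_le_segCompr hX hY h.nonneg h.le_one h.norm_η hε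
  have hJ : segCompr X Y T η ε ∈ posCone k (EuclideanSpace ℂ ι ⊗[ℂ] E) := fun i =>
    (hT i).of_le (hle i)
  have h2 := hG.re_inner_eq_sum b' hJ (Z := fun j => seg X Y (t' j) ε) (w := w) (fun j hj => by
    obtain ⟨h0, h1, h2⟩ := hspec j hj
    refine ⟨seg_mem_posCone hX hY h1 (h2.trans hr) hε.le, segCompr_tmul X Y h0 ?_ ε⟩
    rw [← compression_apply_of_inner_eq_zero h0, hb']) x
  rw [← h2]
  have h3 := hmono _ _ _ hT hJ hle
  rw [ContinuousLinearMap.le_def] at h3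
  have h4 := h3.re_inner_nonneg_right (w ⊗ₜ[ℂ] x)
  rw [sub_apply, inner_sub_right, map_sub, sub_nonneg] at h4
  exact h4

/-- The spectral measures at `w` of `T` and of its compression give the same average to polynomials
of degree less than `2 n`. -/
theorem sum_weight_partialSum {V : Type*} [NormedAddCommGroup V] [InnerProductSpace ℂ V]
    [CompleteSpace V] {r : ℝ} {n : ℕ} {T : V →L[ℂ] V} {p η w : V} (h : KrylovModel r n T p η w)
    (hn : 0 < n) {N N' : ℕ} {b : OrthonormalBasis (Fin N) ℂ V} {t : Fin N → ℝ}
    (hb : ∀ j, T (b j) = (t j : ℂ) • b j) {b' : OrthonormalBasis (Fin N') ℂ V} {t' : Fin N' → ℝ}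
    (hb' : ∀ j, KrylovModel.compression T η (b' j) = (t' j : ℂ) • b' j)
    (q : FormalMultilinearSeries ℂ ℂ ℂ) :
    ∑ j, ‖⟪b j, w⟫_ℂ‖ ^ 2 * (q.partialSum (2 * n) (t j)).re =
      ∑ j, ‖⟪b' j, w⟫_ℂ‖ ^ 2 * (q.partialSum (2 * n) (t' j)).re := by
  have key : ∀ {N : ℕ} (b : OrthonormalBasis (Fin N) ℂ V) (t : Fin N → ℝ),
      ∑ j, ‖⟪b j, w⟫_ℂ‖ ^ 2 * (q.partialSum (2 * n) (t j)).re = (∑ m ∈ Finset.range (2 * n),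
        (∑ j, ((‖⟪b j, w⟫_ℂ‖ ^ 2 : ℝ) : ℂ) * (t j : ℂ) ^ m) * q.coeff m).re := fun b t => by
    simp only [Finset.sum_mul]
    rw [Finset.sum_comm, Complex.re_sum]
    refine Finset.sum_congr rfl fun j _ => ?_
    rw [← Complex.re_ofReal_mul, FormalMultilinearSeries.partialSum, Finset.mul_sum]
    congr 1
    refine Finset.sum_congr rfl fun m _ => ?_
    rw [FormalMultilinearSeries.apply_eq_pow_smul_coeff, smul_eq_mul, mul_assoc]
  rw [key, key]
  congr 1
  refine Finset.sum_congr rfl fun m hm => ?_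
  rw [← inner_pow_eq_sum b hb, ← inner_pow_eq_sum b' hb', h.moment_eq hn (Finset.mem_range.1 hm)]

/-- A monotone map that agrees with a holomorphic function near one end of a segment is at most
this function at the other end, if the function extends to a disc of radius `8` around the first
end, in terms of the length of the segment. No continuity of the map is assumed beyond the initial
piece of the segment. -/
theorem re_inner_le_of_eqOn {G : GradedMap.{u} k} (hG : RespectsIsometries G)
    (hmono : IsOperatorMonotone G) {X Y : Fin k → E →L[ℂ] E} (hX : X ∈ posCone k E)
    (hY : Y ∈ posCone k E) (x : E) {φ : ℂ → ℂ} (hφ : DifferentiableOn ℂ φ (Metric.closedBall 0 8))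
    {r : ℝ} (hr0 : 0 < r) (hr : r ≤ 1)
    (h0 : ∀ t ∈ Set.Icc 0 r, (⟪x, G E (seg X Y t 0) x⟫_ℂ).re = (φ t).re)
    (hε : ∀ t ∈ Set.Icc 0 r, Tendsto (fun ε : ℝ => (⟪x, G E (seg X Y t ε) x⟫_ℂ).re) (𝓝[>] 0)
      (𝓝 (φ t).re)) : (⟪x, G E Y x⟫_ℂ).re ≤ (φ 1).re := by
  -- the Taylor remainder of order `2 n` is of size `(t / 7) ^ (2 n)` for `t ≤ 1`, because `7 < 8`
  have hps : HasFPowerSeriesOnBall φ (cauchyPowerSeries φ 0 (8 : NNReal)) 0 (8 : NNReal) :=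
    DifferentiableOn.hasFPowerSeriesOnBall (by simpa using hφ) (by norm_num)
  set q := cauchyPowerSeries φ 0 (8 : NNReal)
  obtain ⟨a, ha, C, hC, hrem⟩ := hps.uniform_geometric_approx' (r' := 7) (by norm_num)
  have hrem' : ∀ (n : ℕ) (t : ℝ), 0 ≤ t → t ≤ 1 →
      |(φ t).re - (q.partialSum (2 * n) t).re| ≤ C * (t / 7) ^ (2 * n) := fun n t ht0 ht1 => by
    have hnorm : ‖(t : ℂ)‖ = t := by rw [Complex.norm_real, Real.norm_of_nonneg ht0]
    have h1 := hrem (t : ℂ) (by rw [mem_ball_zero_iff, hnorm]; norm_num; linarith) (2 * n)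
    rw [zero_add, hnorm] at h1
    rw [← Complex.sub_re]
    refine ((Complex.abs_re_le_norm _).trans h1).trans ?_
    have h7 : ((7 : NNReal) : ℝ) = 7 := rfl
    rw [h7]
    have ha0 := ha.1.le
    gcongr
    exact mul_le_of_le_one_left (by positivity) ha.2.le
  set d := (⟪x, G E Y x⟫_ℂ).re - (φ 1).re with hd
  -- the model with the parameter `l = r / 5` has its spectrum in `[0, r] ∪ {1}`
  set l := r / 5 with hl
  have hl0 : 0 < l := by positivity
  have hrl : 5 * l = r := by rw [hl]; ring
  -- the remainders on `[0, r]`, relative to the weight `l ^ (2 n) / (n + 1)` of the eigenvalue `1`,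
  -- decay as `(r / (7 l)) ^ (2 n) = (25 / 49) ^ n`
  have key : ∀ n : ℕ, 0 < n → d ≤ 2 * C * ((n + 1) * (25 / 49 : ℝ) ^ n) + C * (1 / 49 : ℝ) ^ n :=
      fun n hn => by
    have hm := krylovModel_tridiag hl0.le (by rw [hl]; linarith) n
    rw [hrl] at hm
    obtain ⟨N, b, t, hb⟩ := exists_eigenbasis hm.selfAdjoint
    obtain ⟨N', b', t', hb'⟩ := exists_eigenbasis hm.isSelfAdjoint_compression
    have hcomp := hm.sum_le hG hmono hX hY x hn hr hε hb hb'
    have hpoly := sum_weight_partialSum hm hn hb hb' q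
    have hweight := hm.le_weight b hb
    have hspec := fun j => hm.eigenvalue_mem hr (b.orthonormal.1 j) (hb j)
    have hspec' := fun j hj => (hm.compression_eigenvalue hn hr (b'.orthonormal.1 j) (hb' j) hj).2
    have hc := sum_weights b hm.norm_w
    have hc' := sum_weights b' hm.norm_w
    set w : EuclideanSpace ℂ (Fin (n + 1)) := EuclideanSpace.single 0 (1 : ℂ)
    set A := ∑ j with t j = 1, ‖⟪b j, w⟫_ℂ‖ ^ 2 with hA
    have hA0 : 0 ≤ A := Finset.sum_nonneg fun _ _ => sq_nonneg _
    have e1 : ∑ j, ‖⟪b j, w⟫_ℂ‖ ^ 2 * (⟪x, G E (seg X Y (t j) 0) x⟫_ℂ).re =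
        ∑ j, ‖⟪b j, w⟫_ℂ‖ ^ 2 * (φ (t j)).re + A * d := by
      rw [hA, Finset.sum_filter, Finset.sum_mul, ← Finset.sum_add_distrib]
      refine Finset.sum_congr rfl fun j _ => ?_
      split_ifs with hj
      · have : seg X Y (t j) 0 = Y := by
          funext i
          simp [seg, hj]
        rw [this, hj, hd, Complex.ofReal_one]
        ring
      · rw [h0 _ ⟨(hspec j).1, (hspec j).2.resolve_left hj⟩]
        ring
    -- the remainder of `φ` averaged over the compression, and then over the model itself
    have b1 : ∑ j, ‖⟪b' j, w⟫_ℂ‖ ^ 2 * ((φ (t' j)).re - (q.partialSum (2 * n) (t' j)).re) ≤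
        C * (r / 7) ^ (2 * n) := by
      calc _ ≤ ∑ j, ‖⟪b' j, w⟫_ℂ‖ ^ 2 * (C * (r / 7) ^ (2 * n)) :=
            Finset.sum_le_sum fun j _ => by
              by_cases hj : ⟪b' j, w⟫_ℂ = 0
              · simp [hj]
              · obtain ⟨g1, g2⟩ := hspec' j hj
                refine mul_le_mul_of_nonneg_left ?_ (sq_nonneg _)
                refine (le_abs_self _).trans ((hrem' n _ g1 (g2.trans hr)).trans ?_)
                gcongr
        _ = _ := by rw [← Finset.sum_mul, hc', one_mul]
    have b2 : -(C * (r / 7) ^ (2 * n) + A * (C * (1 / 7) ^ (2 * n))) ≤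
        ∑ j, ‖⟪b j, w⟫_ℂ‖ ^ 2 * ((φ (t j)).re - (q.partialSum (2 * n) (t j)).re) := by
      have : ∑ j, (‖⟪b j, w⟫_ℂ‖ ^ 2 * (C * (r / 7) ^ (2 * n)) +
          (if t j = 1 then ‖⟪b j, w⟫_ℂ‖ ^ 2 else 0) * (C * (1 / 7) ^ (2 * n))) =
          C * (r / 7) ^ (2 * n) + A * (C * (1 / 7) ^ (2 * n)) := by
        rw [Finset.sum_add_distrib, ← Finset.sum_mul, hc, one_mul, ← Finset.sum_mul, hA,
          Finset.sum_filter]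
      rw [← this, ← Finset.sum_neg_distrib]
      refine Finset.sum_le_sum fun j _ => ?_
      obtain ⟨g1, g2⟩ := hspec j
      have hsq := sq_nonneg ‖⟪b j, w⟫_ℂ‖
      have hR : 0 ≤ C * (r / 7) ^ (2 * n) := by positivity
      split_ifs with hj
      · have := neg_le_of_abs_le (hrem' n (t j) g1 hj.le)
        rw [hj] at this ⊢
        have h5 := mul_le_mul_of_nonneg_left this hsq
        have h6 := mul_nonneg hsq hR
        linarith
      · have g3 := g2.resolve_left hj
        have h4 : C * (t j / 7) ^ (2 * n) ≤ C * (r / 7) ^ (2 * n) := by gcongr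
        have := (neg_le_of_abs_le (hrem' n (t j) g1 (g3.trans hr)))
        have h5 := mul_le_mul_of_nonneg_left ((neg_le_neg h4).trans this) hsq
        linarith
    simp only [mul_sub, Finset.sum_sub_distrib] at b1 b2
    rw [e1] at hcomp
    have b3 : A * (d - C * (1 / 7) ^ (2 * n)) ≤ 2 * C * (r / 7) ^ (2 * n) := by linarith
    have e49 : (1 / 7 : ℝ) ^ (2 * n) = (1 / 49) ^ n := by rw [pow_mul]; norm_num
    rw [e49] at b3
    have hpos : 0 ≤ 2 * C * ((n + 1) * (25 / 49 : ℝ) ^ n) := by positivity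
    rcases le_total (d - C * (1 / 49) ^ n) 0 with hneg | hneg
    · linarith
    -- the weight `A` of the eigenvalue `1` is at least `l ^ (2 n) / (n + 1)`
    have b4 : (l ^ n) ^ 2 ≤ A * (n + 1) := by
      rw [norm_inner_single_powVec hl0.le] at hweight
      refine hweight.trans (mul_le_mul_of_nonneg_left ?_ hA0)
      exact norm_sq_powVec_le hl0.le (by rw [hl]; linarith)
    have b5 : (l ^ n) ^ 2 * (d - C * (1 / 49) ^ n) ≤
        (l ^ n) ^ 2 * (2 * C * ((n + 1) * (25 / 49 : ℝ) ^ n)) := by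
      calc (l ^ n) ^ 2 * (d - C * (1 / 49) ^ n) ≤ A * (n + 1) * (d - C * (1 / 49) ^ n) := by gcongr
        _ = (n + 1) * (A * (d - C * (1 / 49) ^ n)) := by ring
        _ ≤ (n + 1) * (2 * C * (r / 7) ^ (2 * n)) := by gcongr
        _ = (l ^ n) ^ 2 * (2 * C * ((n + 1) * (25 / 49 : ℝ) ^ n)) := by
          have : (r / 7) ^ (2 * n) = (l ^ n) ^ 2 * (25 / 49 : ℝ) ^ n := by
            have e5 : 5 * l / 7 = l * (5 / 7) := by ring
            rw [← hrl, e5, mul_pow, pow_mul (5 / 7 : ℝ), ← pow_mul l, mul_comm n 2]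
            norm_num
          rw [this]
          ring
    have := le_of_mul_le_mul_left b5 (by positivity)
    linarith
  have hlim : Tendsto (fun n : ℕ => 2 * C * ((n + 1) * (25 / 49 : ℝ) ^ n) + C * (1 / 49 : ℝ) ^ n)
      atTop (𝓝 (2 * C * (0 + 0) + C * 0)) := by
    refine Tendsto.add (Tendsto.const_mul _ ?_) (Tendsto.const_mul _ ?_)
    · simp only [add_mul, one_mul]
      exact (tendsto_self_mul_const_pow_of_lt_one (by norm_num) (by norm_num)).add
        (tendsto_pow_atTop_nhds_zero_of_lt_one (by norm_num) (by norm_num))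
    · exact tendsto_pow_atTop_nhds_zero_of_lt_one (by norm_num) (by norm_num)
  have : d ≤ 2 * C * (0 + 0) + C * 0 :=
    ge_of_tendsto hlim ((eventually_gt_atTop 0).mono key)
  rw [hd] at this
  linarith

end LocalComparison

/-! ### Scalar tuples -/

section Scalar

/-- The tuple `(z I, …, z I)`. -/
def scalarTuple (k : ℕ) (E : Type u) [NormedAddCommGroup E] [InnerProductSpace ℂ E] (z : ℂ) :
    Fin k → E →L[ℂ] E := fun _ => z • 1

/-- The unit vector spanning the one-dimensional Hilbert space. -/
def unitVec : FinSpace.{u} 1 := EuclideanSpace.single ⟨0⟩ 1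

theorem inner_unitVec (v : FinSpace.{u} 1) : ⟪unitVec.{u}, v⟫_ℂ = v ⟨0⟩ := by
  rw [unitVec, EuclideanSpace.inner_single_left]
  simp

theorem norm_unitVec : ‖unitVec.{u}‖ = 1 := by simp [unitVec]

theorem eq_smul_unitVec (v : FinSpace.{u} 1) : v = ⟪unitVec.{u}, v⟫_ℂ • unitVec.{u} := by
  ext j
  have hj : j = ⟨0⟩ := ULift.ext _ _ (Subsingleton.elim _ _)
  rw [inner_unitVec, hj]
  simp [unitVec]

/-- The value of a graded map at the scalar `z`. -/
def scalarValue (G : GradedMap.{u} k) (z : ℂ) : ℂ :=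
  ⟪unitVec.{u}, G (FinSpace.{u} 1) (scalarTuple k _ z) unitVec.{u}⟫_ℂ

variable {E : Type u} [NormedAddCommGroup E] [InnerProductSpace ℂ E]

/-- The operator `v ↦ ⟪e, v⟫ x` from the one-dimensional Hilbert space, spanned by `e`. -/
def vecMap (x : E) : FinSpace.{u} 1 →L[ℂ] E :=
  (innerSL ℂ unitVec.{u}).smulRight x

theorem vecMap_apply (x : E) (v : FinSpace.{u} 1) : vecMap x v = ⟪unitVec.{u}, v⟫_ℂ • x := rfl

theorem vecMap_unitVec (x : E) : vecMap x unitVec.{u} = x := by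
  rw [vecMap_apply, inner_self_eq_norm_sq_to_K, norm_unitVec]
  simp

theorem scalarTuple_intertwine (z : ℂ) (x : E) (i : Fin k) :
    scalarTuple k E z i ∘L vecMap x = vecMap x ∘L scalarTuple k (FinSpace.{u} 1) z i := by
  refine ContinuousLinearMap.ext fun v => ?_
  simp [scalarTuple]

theorem inner_self_eq_ofReal (x : E) : ⟪x, x⟫_ℂ = ((‖x‖ ^ 2 : ℝ) : ℂ) := by
  rw [inner_self_eq_norm_sq_to_K]
  push_cast
  rfl

theorem re_inner_self (x : E) : (⟪x, x⟫_ℂ).re = ‖x‖ ^ 2 := inner_self_eq_norm_sq (𝕜 := ℂ) x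

theorem inner_scalarTuple (z : ℂ) (x : E) (i : Fin k) :
    ⟪x, scalarTuple k E z i x⟫_ℂ = z * ((‖x‖ ^ 2 : ℝ) : ℂ) := by
  rw [scalarTuple, smul_apply, one_apply_eq_self, inner_smul_right, inner_self_eq_ofReal]

theorem seg_eq (X Y : Fin k → E →L[ℂ] E) (t ε : ℝ) :
    seg X Y t ε = X + (t : ℂ) • (Y - X) + (ε : ℂ) • scalarTuple k E 1 := by
  funext i
  simp [seg, scalarTuple]

variable [CompleteSpace E]

theorem scalarTuple_mem_rightHalf {z : ℂ} (hz : 0 < z.re) : scalarTuple k E z ∈ rightHalf k E :=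
  mem_rightHalf_iff.2 fun i => ⟨z.re, hz, fun x => by
    rw [inner_scalarTuple, Complex.re_mul_ofReal]⟩

theorem scalarTuple_mem_upperHalf {z : ℂ} (hz : 0 < z.im) : scalarTuple k E z ∈ upperHalf k E :=
  mem_upperHalf_iff.2 fun i => ⟨z.im, hz, fun x => by
    rw [inner_scalarTuple, Complex.im_mul_ofReal]⟩

theorem scalarTuple_mem_posCone {t : ℝ} (ht : 0 < t) : scalarTuple k E t ∈ posCone k E :=
  fun _ => ⟨t, ht, le_rfl⟩

/-- Every unit vector spans an invariant subspace of a scalar tuple, so the value there is a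
scalar. -/
theorem RespectsIsometries.apply_scalarTuple {G : GradedMap.{u} k} (hG : RespectsIsometries G)
    {t : ℝ} (ht : 0 < t) : G E (scalarTuple k E t) = scalarValue G t • 1 := by
  have h1 : ∀ x : E, ‖x‖ = 1 → G E (scalarTuple k E t) x = scalarValue G t • x := fun x hx => by
    let J : FinSpace.{u} 1 →ₗᵢ[ℂ] E :=
      { toLinearMap := vecMap x
        norm_map' := fun v => by
          change ‖vecMap x v‖ = _
          rw [vecMap_apply, norm_smul, hx, mul_one]
          conv_rhs => rw [eq_smul_unitVec v, norm_smul, norm_unitVec, mul_one] }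
    have h := hG _ _ (scalarTuple k _ t) (scalarTuple k E t) J (scalarTuple_mem_posCone ht)
      (scalarTuple_mem_posCone ht)
      (fun i v => DFunLike.congr_fun (scalarTuple_intertwine (t : ℂ) x i) v) unitVec.{u}
    change G E (scalarTuple k E t) (vecMap x unitVec.{u}) = vecMap x _ at h
    rw [vecMap_unitVec, vecMap_apply] at h
    exact h
  refine ContinuousLinearMap.ext fun x => ?_
  rw [smul_apply, one_apply_eq_self]
  rcases eq_or_ne x 0 with rfl | hx
  · simp
  · have hx' : (‖x‖ : ℂ) ≠ 0 := by simpa using hx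
    have h2 := h1 ((‖x‖ : ℂ)⁻¹ • x) (by
      rw [norm_smul, norm_inv, Complex.norm_real, norm_norm, inv_mul_cancel₀ (by simpa using hx)])
    rw [map_smul, smul_comm] at h2
    have h3 := congrArg (fun y => (‖x‖ : ℂ) • y) h2
    simpa only [smul_inv_smul₀ hx'] using h3

theorem exists_scalarTuple_le {X : Fin k → E →L[ℂ] E} (hX : X ∈ posCone k E) :
    ∃ δ : ℝ, 0 < δ ∧ ∀ i, scalarTuple k E δ i ≤ X i := by
  choose ε hε h using hX
  obtain ⟨δ, hδ, -, h'⟩ := exists_common_bound hε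
  refine ⟨δ, hδ, fun i => le_trans ?_ (h i)⟩
  refine (real_smul_one_le_iff (isSelfAdjoint_real_smul_one _) _).2 fun x => ?_
  rw [smul_apply, one_apply_eq_self, inner_smul_right, Complex.re_ofReal_mul, re_inner_self]
  exact mul_le_mul_of_nonneg_right (h' i) (sq_nonneg _)

theorem exists_le_scalarTuple {X : Fin k → E →L[ℂ] E} (hX : X ∈ posCone k E) :
    ∃ m : ℝ, 0 < m ∧ ∀ i, X i ≤ scalarTuple k E m i := by
  refine ⟨‖X‖ + 1, by positivity, fun i => ?_⟩
  refine (le_iff_re_inner ((isSelfAdjoint_real_smul_one _).sub (hX i).isSelfAdjoint)).2 fun x => ?_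
  rw [inner_scalarTuple, ← Complex.ofReal_mul, Complex.ofReal_re]
  have h := norm_inner_apply_le (norm_le_pi_norm X i) x x
  have h1 := (le_abs_self _).trans ((Complex.abs_re_le_norm _).trans h)
  nlinarith [sq_nonneg ‖x‖]

end Scalar

/-! ### Positivity of the slice function -/

namespace Realization

variable {𝓑 : PencilFamily.{u} k c₁ c₂}
variable {E : Type u} [NormedAddCommGroup E] [InnerProductSpace ℂ E] [CompleteSpace E]
variable {w : (BigSpace.{u} k c₁ c₂ →L[ℂ] BigSpace.{u} k c₁ c₂) →L[ℂ] ℂ}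

theorem apply_scalarTuple (R : Realization 𝓑) {z : ℂ}
    (hz : 0 < z.re ∨ 0 < z.im) :
    𝓑.sliceFun w E (scalarTuple k E z) = scalarValue (𝓑.sliceFun w) z • 1 := by
  have hmem : ∀ (E : Type u) [NormedAddCommGroup E] [InnerProductSpace ℂ E] [CompleteSpace E],
      ∃ c δ, AccretiveTuple c δ (scalarTuple k E z) := fun E _ _ _ =>
    exists_accretiveTuple (hz.imp scalarTuple_mem_rightHalf scalarTuple_mem_upperHalf)
  refine ContinuousLinearMap.ext fun x => ?_
  have h := R.sliceFun_intertwine (w := w) (hmem (FinSpace.{u} 1)) (hmem E) (vecMap x)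
    (scalarTuple_intertwine z x)
  have h' := DFunLike.congr_fun h unitVec.{u}
  rwa [comp_apply, comp_apply, vecMap_unitVec, vecMap_apply] at h'

theorem sliceFun_nonneg (R : Realization 𝓑) (hw : IsState w) {X : Fin k → E →L[ℂ] E}
    (hX : X ∈ posCone k E) : 0 ≤ 𝓑.sliceFun w E X := by
  refine (nonneg_iff_re_inner (R.isSelfAdjoint_sliceFun hw hX)).2 fun x => ?_
  have := R.re_sliceFun_nonneg hw 1 (exists_accretiveTuple_posCone hX)
    (fun ω η => by rw [one_mul]; exact (R.inner_sh_nonneg ω hX η).1) x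
  rwa [one_mul] at this

theorem isOperatorMonotone_sliceFun (R : Realization 𝓑) (hw : IsState w) :
    IsOperatorMonotone (𝓑.sliceFun w) := fun _ _ _ _ _ _ hX hY h => R.sliceFun_mono hw hX hY h

theorem isOperatorConcave_sliceFun (R : Realization 𝓑) (hw : IsState w) :
    IsOperatorConcave (𝓑.sliceFun w) := fun _ _ _ _ _ _ hX hY _ ht ht1 =>
  R.sliceFun_concave hw hX hY (sub_nonneg.2 ht1) ht (sub_add_cancel 1 _)

/-- By concavity the slice function is strictly positive as soon as it is so at one scalar. -/
theorem isStrictlyPos_sliceFun (R : Realization 𝓑) (hw : IsState w) (hc : 0 < c₁)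
    (h : 0 < (scalarValue (𝓑.sliceFun w) c₁).re) {X : Fin k → E →L[ℂ] E} (hX : X ∈ posCone k E) :
    IsStrictlyPos (𝓑.sliceFun w E X) := by
  obtain ⟨δ, hδ, hle⟩ := exists_scalarTuple_le hX
  -- `t c₁ + (1 - t) δ / 2 ≤ δ ≤ X`, so `F̃(X) ≥ t F̃(c₁) + (1 - t) F̃(δ / 2) ≥ t F̃(c₁)`
  set t := min (1 / 2) (δ / (2 * c₁)) with ht
  have ht0 : 0 < t := lt_min (by norm_num) (by positivity)
  have ht1 : t ≤ 1 := (min_le_left _ _).trans (by norm_num)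
  have htc : t * c₁ ≤ δ / 2 := by
    calc t * c₁ ≤ δ / (2 * c₁) * c₁ := by gcongr; exact min_le_right _ _
      _ = δ / 2 := by field_simp
  have hA : scalarTuple k E (c₁ : ℂ) ∈ posCone k E := scalarTuple_mem_posCone hc
  have hB : scalarTuple k E ((δ / 2 : ℝ) : ℂ) ∈ posCone k E := scalarTuple_mem_posCone (half_pos hδ)
  have h1 := R.sliceFun_concave hw hA hB ht0.le (sub_nonneg.2 ht1) (add_sub_cancel t 1)
  have h2 := R.sliceFun_mono hw (posCone_convexComb hA hB ht0.le (sub_nonneg.2 ht1)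
    (add_sub_cancel t 1)) hX fun i => by
      refine le_trans ?_ (hle i)
      have e : (t : ℂ) • scalarTuple k E (c₁ : ℂ) i +
          ((1 - t : ℝ) : ℂ) • scalarTuple k E ((δ / 2 : ℝ) : ℂ) i =
          ((t * c₁ + (1 - t) * (δ / 2) : ℝ) : ℂ) • 1 := by
        simp only [scalarTuple, smul_smul, ← add_smul]
        congr 1
        push_cast
        ring
      rw [e]
      refine (real_smul_one_le_iff (isSelfAdjoint_real_smul_one δ) _).2 fun x => ?_
      rw [smul_apply, one_apply_eq_self, inner_smul_right, Complex.re_ofReal_mul, re_inner_self]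
      refine mul_le_mul_of_nonneg_right ?_ (sq_nonneg _)
      have : 0 ≤ t * (δ / 2) := by positivity
      linarith
  have h3 := R.sliceFun_nonneg hw hB
  have hsa := R.isSelfAdjoint_sliceFun hw hX
  refine (isStrictlyPos_iff hsa).2 ⟨t * (scalarValue (𝓑.sliceFun w) c₁).re, by positivity,
    fun x => ?_⟩
  have h4 := (h1.trans h2)
  rw [ContinuousLinearMap.le_def] at h4
  have h5 := h4.re_inner_nonneg_right x
  have h6 := (nonneg_iff_re_inner (R.isSelfAdjoint_sliceFun hw hB)).1 h3 x
  have h7 : 0 ≤ (1 - t) * (⟪x, 𝓑.sliceFun w E (scalarTuple k E ((δ / 2 : ℝ) : ℂ)) x⟫_ℂ).re :=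
    mul_nonneg (sub_nonneg.2 ht1) h6
  have h8 : (⟪x, (scalarValue (𝓑.sliceFun w) c₁ • (1 : E →L[ℂ] E)) x⟫_ℂ).re =
      (scalarValue (𝓑.sliceFun w) c₁).re * ‖x‖ ^ 2 := by
    rw [smul_apply, one_apply_eq_self, inner_smul_right, inner_self_eq_ofReal,
      Complex.re_mul_ofReal]
  rw [sub_apply, inner_sub_right, add_apply, inner_add_right, smul_apply, inner_smul_right,
    smul_apply, inner_smul_right] at h5
  simp only [RCLike.re_to_complex, Complex.sub_re, Complex.add_re, Complex.re_ofReal_mul] at h5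
  rw [R.apply_scalarTuple (Or.inl hc), h8] at h5
  linarith

end Realization

/-! ### Identity with the slice function -/

section Identity

variable {E : Type u} [NormedAddCommGroup E] [InnerProductSpace ℂ E] [CompleteSpace E]

/-- If a monotone map `G` agrees near a point `X₀` with a holomorphic function `H`, then it is at
most `H` at all the points of a ball whose size is controlled by the domain of `H` only. The
constant `100` leaves room for the points `X₀ + s (Y - X₀)` with `|s| ≤ 8`. -/
theorem re_inner_le_of_eventually_eq {G : GradedMap.{u} k} (hG : RespectsIsometries G)
    (hmono : IsOperatorMonotone G) {H : (Fin k → E →L[ℂ] E) → E →L[ℂ] E}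
    {Z X₀ Y : Fin k → E →L[ℂ] E}
    {ρ : ℝ} (hH : DifferentiableOn ℂ H (Metric.ball Z ρ)) (hX₀ : X₀ ∈ posCone k E)
    (hY : Y ∈ posCone k E) (hX₀Z : dist X₀ Z < ρ / 100) (hYZ : dist Y Z < ρ / 100)
    (hEq : ∀ᶠ W in 𝓝[posCone k E] X₀, G E W = H W) (x : E) :
    (⟪x, G E Y x⟫_ℂ).re ≤ (⟪x, H Y x⟫_ℂ).re := by
  have hball : ∀ s ∈ Metric.closedBall (0 : ℂ) 8, X₀ + s • (Y - X₀) ∈ Metric.ball Z ρ :=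
    fun s hs => by
      rw [mem_closedBall_zero_iff] at hs
      rw [mem_ball_iff_norm]
      rw [dist_eq_norm] at hX₀Z hYZ
      have h1 : ‖Y - X₀‖ ≤ ρ / 100 + ρ / 100 := by
        calc ‖Y - X₀‖ = ‖(Y - Z) - (X₀ - Z)‖ := by congr 1; abel
          _ ≤ ‖Y - Z‖ + ‖X₀ - Z‖ := norm_sub_le _ _
          _ ≤ _ := by linarith
      calc ‖X₀ + s • (Y - X₀) - Z‖ = ‖(X₀ - Z) + s • (Y - X₀)‖ := by congr 1; abel
        _ ≤ ‖X₀ - Z‖ + ‖s • (Y - X₀)‖ := norm_add_le _ _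
        _ ≤ ‖X₀ - Z‖ + 8 * (ρ / 100 + ρ / 100) := by
          rw [norm_smul]
          gcongr
        _ < ρ := by
          have := (norm_nonneg _).trans_lt hX₀Z
          linarith
  set L : (E →L[ℂ] E) →L[ℂ] ℂ := innerSL ℂ x ∘L ContinuousLinearMap.apply ℂ E x with hL
  have hLa : ∀ T : E →L[ℂ] E, L T = ⟪x, T x⟫_ℂ := fun T => rfl
  have hφ : DifferentiableOn ℂ (fun s : ℂ => L (H (X₀ + s • (Y - X₀))))
      (Metric.closedBall 0 8) := by
    refine L.differentiable.comp_differentiableOn (hH.comp ?_ hball)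
    exact ((differentiable_id.smul_const (Y - X₀)).const_add X₀).differentiableOn
  obtain ⟨r, hr, hrr⟩ : ∃ r > 0, ∀ t ε : ℝ, |t| < r → |ε| < r → seg X₀ Y t ε ∈ posCone k E →
      G E (seg X₀ Y t ε) = H (seg X₀ Y t ε) := by
    rw [eventually_nhdsWithin_iff] at hEq
    have hcont : Tendsto (fun p : ℝ × ℝ => seg X₀ Y p.1 p.2) (𝓝 (0, 0)) (𝓝 X₀) := by
      have h1 : Continuous fun p : ℝ × ℝ => seg X₀ Y p.1 p.2 := by
        simp only [seg_eq]
        fun_prop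
      have h2 := h1.tendsto (0, 0)
      have h3 : seg X₀ Y 0 0 = X₀ := by rw [seg_eq]; simp
      rwa [h3] at h2
    obtain ⟨r, hr, h⟩ := Metric.eventually_nhds_iff.1 (hcont.eventually hEq)
    refine ⟨r, hr, fun t ε ht hε hmem => h (y := (t, ε)) ?_ hmem⟩
    rw [Prod.dist_eq]
    simpa using ⟨ht, hε⟩
  have hr2 : min (r / 2) 1 < r := (min_le_left _ _).trans_lt (half_lt_self hr)
  have hr1 : min (r / 2) 1 ≤ 1 := min_le_right _ _
  have hseg0 : ∀ t : ℝ, seg X₀ Y t 0 = X₀ + (t : ℂ) • (Y - X₀) := fun t => by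
    rw [seg_eq]; simp
  have hval : (⟪x, H Y x⟫_ℂ) = L (H (X₀ + (1 : ℂ) • (Y - X₀))) := by
    rw [one_smul, add_sub_cancel, hLa]
  rw [hval]
  refine re_inner_le_of_eqOn hG hmono hX₀ hY x hφ (r := min (r / 2) 1)
    (lt_min (half_pos hr) one_pos) hr1 (fun t ht => ?_) fun t ht => ?_
  · rw [hrr t 0 (by rw [abs_of_nonneg ht.1]; exact ht.2.trans_lt hr2) (by simpa using hr)
      (seg_mem_posCone hX₀ hY ht.1 (ht.2.trans hr1) le_rfl), hseg0, hLa]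
  · have h1 : Tendsto (fun ε : ℝ => seg X₀ Y t ε) (𝓝[>] 0) (𝓝 (X₀ + (t : ℂ) • (Y - X₀))) := by
      have h2 : Continuous fun ε : ℝ => seg X₀ Y t ε := by
        simp only [seg_eq]
        fun_prop
      have h3 := h2.tendsto 0
      rw [hseg0] at h3
      exact h3.mono_left nhdsWithin_le_nhds
    have h4 : ContinuousAt H (X₀ + (t : ℂ) • (Y - X₀)) := by
      refine (hH.differentiableAt (Metric.isOpen_ball.mem_nhds (hball t ?_))).continuousAt
      rw [mem_closedBall_zero_iff, Complex.norm_real, Real.norm_of_nonneg ht.1]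
      exact (ht.2.trans hr1).trans (by norm_num)
    have h5 := (Complex.continuous_re.tendsto _).comp ((L.continuous.tendsto _).comp
      (h4.tendsto.comp h1))
    refine h5.congr' ?_
    have h6 : ∀ᶠ ε : ℝ in 𝓝[>] 0, ε < r := nhdsWithin_le_nhds (eventually_lt_nhds hr)
    filter_upwards [h6, self_mem_nhdsWithin] with ε hε1 (hε2 : 0 < ε)
    rw [hrr t ε (by rw [abs_of_nonneg ht.1]; exact ht.2.trans_lt hr2)
      (by rwa [abs_of_pos hε2]) (seg_mem_posCone hX₀ hY ht.1 (ht.2.trans hr1) hε2.le)]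
    rfl

theorem le_of_eventually_eq {G : GradedMap.{u} k} (hG : RespectsIsometries G)
    (hmono : IsOperatorMonotone G) (hpos : MapsPosToPos G) {H : GradedMap.{u} k}
    (hHpos : MapsPosToPos H) {Z X₀ Y : Fin k → E →L[ℂ] E}
    {ρ : ℝ} (hH : DifferentiableOn ℂ (H E) (Metric.ball Z ρ)) (hX₀ : X₀ ∈ posCone k E)
    (hY : Y ∈ posCone k E) (hX₀Z : dist X₀ Z < ρ / 100) (hYZ : dist Y Z < ρ / 100)
    (hEq : ∀ᶠ W in 𝓝[posCone k E] X₀, G E W = H E W) : G E Y ≤ H E Y :=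
  (le_iff_re_inner ((hHpos E Y hY).isSelfAdjoint.sub (hpos E Y hY).isSelfAdjoint)).2
    (re_inner_le_of_eventually_eq hG hmono hH hX₀ hY hX₀Z hYZ hEq)

theorem exists_ball_differentiableOn {H : (Fin k → E →L[ℂ] E) → E →L[ℂ] E} {Z : Fin k → E →L[ℂ] E}
    (h : AnalyticAt ℂ H Z) : ∃ ρ > 0, DifferentiableOn ℂ H (Metric.ball Z ρ) := by
  obtain ⟨ρ, hρ, h'⟩ := Metric.eventually_nhds_iff_ball.1 h.eventually_analyticAt
  exact ⟨ρ, hρ, fun W hW => (h' W hW).differentiableAt.differentiableWithinAt⟩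

theorem isPreconnected_posCone : IsPreconnected (posCone k E) := by
  refine Convex.isPreconnected fun X hX Y hY s t hs ht hst => ?_
  exact Realization.posCone_convexComb hX hY hs ht hst

theorem tendsto_invTuple {X : Fin k → E →L[ℂ] E} (hX : X ∈ posCone k E) :
    Tendsto invTuple (𝓝[posCone k E] X) (𝓝[posCone k E] (invTuple X)) :=
  tendsto_nhdsWithin_iff.2 ⟨(analyticAt_invTuple hX).continuousAt.tendsto.mono_left
    nhdsWithin_le_nhds, eventually_mem_nhdsWithin.mono fun _ h => invTuple_mem h⟩

theorem analyticAt_invDual {H : GradedMap.{u} k} (hpos : MapsPosToPos H) {X : Fin k → E →L[ℂ] E}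
    (hX : X ∈ posCone k E) (h : AnalyticAt ℂ (H E) (invTuple X)) :
    AnalyticAt ℂ (invDual H E) X := by
  obtain ⟨v, hv⟩ := (hpos E _ (invTuple_mem hX)).isUnit
  refine AnalyticAt.fun_comp (g := Ring.inverse) ?_ (h.comp (analyticAt_invTuple hX))
  rw [← hv]
  exact analyticAt_inverse v

/-- The set of points near which a monotone map `F` agrees with a holomorphic map `H` is closed in
the cone: near a limit point of this set, the local comparison gives `F ≤ H`, and the same for
`X ↦ F(X⁻¹)⁻¹` and `X ↦ H(X⁻¹)⁻¹` gives `H ≤ F`. -/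
theorem eventually_eq_of_frequently {F H : GradedMap.{u} k} (hF : RespectsIsometries F)
    (hFm : IsOperatorMonotone F) (hFp : MapsPosToPos F) (hHp : MapsPosToPos H)
    (hH : ∀ X ∈ posCone k E, AnalyticAt ℂ (H E) X) {X : Fin k → E →L[ℂ] E} (hX : X ∈ posCone k E)
    (h : ∃ᶠ X₀ in 𝓝[posCone k E] X, ∀ᶠ W in 𝓝[posCone k E] X₀, F E W = H E W) :
    ∀ᶠ Y in 𝓝[posCone k E] X, F E Y = H E Y := by
  obtain ⟨ρ, hρ, hHd⟩ := exists_ball_differentiableOn (hH X hX)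
  obtain ⟨σ, hσ, hHd'⟩ := exists_ball_differentiableOn
    (analyticAt_invDual hHp (invTuple_mem hX) (by rw [invTuple_invTuple hX]; exact hH X hX))
  have hnear : ∀ᶠ Y in 𝓝[posCone k E] X, Y ∈ posCone k E ∧ dist Y X < ρ / 100 ∧
      dist (invTuple Y) (invTuple X) < σ / 100 := by
    refine eventually_mem_nhdsWithin.and (Eventually.and ?_ ?_)
    · exact nhdsWithin_le_nhds (Metric.ball_mem_nhds X (by positivity))
    · exact (tendsto_invTuple hX).eventually
        (nhdsWithin_le_nhds (Metric.ball_mem_nhds (invTuple X) (by positivity)))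
  obtain ⟨X₀, hEq, hX₀, hd, hd'⟩ := (h.and_eventually hnear).exists
  have hEq' : ∀ᶠ W in 𝓝[posCone k E] (invTuple X₀), invDual F E W = invDual H E W := by
    have := tendsto_invTuple (invTuple_mem hX₀)
    rw [invTuple_invTuple hX₀] at this
    exact (this.eventually hEq).mono fun W hW => congrArg Ring.inverse hW
  filter_upwards [hnear] with Y ⟨hY, hYd, hYd'⟩
  refine le_antisymm (le_of_eventually_eq hF hFm hFp hHp hHd hX₀ hY hd hYd hEq) ?_
  have h1 := le_of_eventually_eq (hF.invDual hFp) (hFm.invDual hFp) hFp.invDual hHp.invDual hHd'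
    (invTuple_mem hX₀) (invTuple_mem hY) hd' hYd' hEq'
  rw [invDual, invDual, invTuple_invTuple hY] at h1
  have h2 := (hFp E Y hY).inverse.inverse_le_inverse h1
  rwa [inverse_inverse_of_isUnit (hHp E Y hY).isUnit,
    inverse_inverse_of_isUnit (hFp E Y hY).isUnit] at h2

/-- An identity theorem: if a monotone map agrees with a holomorphic map near one point of the cone,
then they agree on the cone. -/
theorem eqOn_posCone {F H : GradedMap.{u} k} (hF : RespectsIsometries F)
    (hFm : IsOperatorMonotone F) (hFp : MapsPosToPos F) (hHp : MapsPosToPos H)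
    (hH : ∀ X ∈ posCone k E, AnalyticAt ℂ (H E) X) {X₀ : Fin k → E →L[ℂ] E}
    (hX₀ : X₀ ∈ posCone k E) (h : ∀ᶠ W in 𝓝[posCone k E] X₀, F E W = H E W)
    {X : Fin k → E →L[ℂ] E} (hX : X ∈ posCone k E) : F E X = H E X := by
  have : PreconnectedSpace (posCone k E) :=
    isPreconnected_iff_preconnectedSpace.1 isPreconnected_posCone
  set S : Set (posCone k E) := {X | ∀ᶠ W : posCone k E in 𝓝 X, F E W = H E W} with hS
  have hmem : ∀ X : posCone k E, X ∈ S ↔ ∀ᶠ W in 𝓝[posCone k E] (X : Fin k → E →L[ℂ] E),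
      F E W = H E W := fun X => eventually_nhds_subtype_iff _ X fun W => F E W = H E W
  have hclopen : IsClopen S := by
    refine ⟨isClosed_of_closure_subset fun X hX => ?_, isOpen_iff_mem_nhds.2 fun X hX =>
      eventually_eventually_nhds.2 hX⟩
    refine (hmem X).2 (eventually_eq_of_frequently hF hFm hFp hHp hH X.2 ?_)
    rw [nhdsWithin_eq_map_subtype_coe X.2, frequently_map]
    exact (mem_closure_iff_frequently.1 hX).mono fun Y hY => (hmem Y).1 hY
  have huniv := hclopen.eq_univ ⟨⟨X₀, hX₀⟩, (hmem _).2 h⟩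
  have hXS : (⟨X, hX⟩ : posCone k E) ∈ S := huniv ▸ Set.mem_univ _
  exact Eventually.self_of_nhds (p := fun W : posCone k E => F E W = H E W) hXS

theorem eventually_mem_posBox (hc : c₁ < c₂) :
    ∀ᶠ W in 𝓝[posCone k E] (scalarTuple k E (((c₁ + c₂) / 2 : ℝ) : ℂ)), W ∈ posBox k E c₁ c₂ := by
  have hρ : 0 < (c₂ - c₁) / 2 := by linarith
  filter_upwards [eventually_mem_nhdsWithin,
    nhdsWithin_le_nhds (Metric.ball_mem_nhds _ hρ)] with W hW hd i
  have hsa := (hW i).isSelfAdjoint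
  have hb : ‖W i - scalarTuple k E (((c₁ + c₂) / 2 : ℝ) : ℂ) i‖ ≤ (c₂ - c₁) / 2 :=
    (norm_le_pi_norm (W - scalarTuple k E _) i).trans (mem_ball_iff_norm.1 hd).le
  have key : ∀ x, |(⟪x, W i x⟫_ℂ).re - (c₁ + c₂) / 2 * ‖x‖ ^ 2| ≤ (c₂ - c₁) / 2 * ‖x‖ ^ 2 :=
    fun x => by
      have h1 := norm_inner_apply_le hb x x
      have h2 := (Complex.abs_re_le_norm _).trans h1
      rw [sub_apply, inner_sub_right, inner_scalarTuple, ← Complex.ofReal_mul, Complex.sub_re,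
        Complex.ofReal_re] at h2
      refine h2.trans_eq ?_
      ring
  constructor
  · refine (real_smul_one_le_iff hsa _).2 fun x => ?_
    have := neg_le_of_abs_le (key x)
    linarith
  · refine (le_iff_re_inner ((isSelfAdjoint_real_smul_one _).sub hsa)).2 fun x => ?_
    have := le_of_abs_le (key x)
    rw [smul_apply, one_apply_eq_self, inner_smul_right, Complex.re_ofReal_mul, re_inner_self]
    linarith

end Identity

/-! ### Strict positivity of the imaginary part -/

/-- The union of the right and the upper half-plane. -/
def scalarDomain : Set ℂ := {z | 0 < z.re} ∪ {z | 0 < z.im}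

theorem isPreconnected_scalarDomain : IsPreconnected scalarDomain :=
  IsPreconnected.union (1 + Complex.I) (by simp) (by simp)
    (convex_halfSpace_re_gt 0).isPreconnected (convex_halfSpace_im_gt 0).isPreconnected

/-- By the open mapping theorem a holomorphic function that is real on the upper half-plane is
constant. -/
theorem exists_eq_of_im_eq_zero {f : ℂ → ℂ} (hf : AnalyticOnNhd ℂ f scalarDomain)
    (him : ∀ z : ℂ, 0 < z.im → (f z).im = 0) : ∃ a : ℂ, ∀ z ∈ scalarDomain, f z = a := by
  have hU : IsOpen {z : ℂ | 0 < z.im} := isOpen_lt continuous_const Complex.continuous_im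
  have hI : Complex.I ∈ {z : ℂ | 0 < z.im} := by simp
  obtain ⟨a, ha⟩ | hopen := (hf.mono Set.subset_union_right).is_constant_or_isOpen
    (convex_halfSpace_im_gt 0).isPreconnected
  · refine ⟨a, fun z hz => ?_⟩
    exact hf.eqOn_of_preconnected_of_eventuallyEq analyticOnNhd_const isPreconnected_scalarDomain
      (Set.mem_union_right _ hI) (eventually_of_mem (hU.mem_nhds hI) ha) hz
  · -- a nonempty open set is not contained in the real line
    exfalso
    have h1 := hopen _ subset_rfl hU
    have h2 : f '' {z : ℂ | 0 < z.im} ⊆ {z : ℂ | z.im = 0} := by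
      rintro _ ⟨z, hz, rfl⟩
      exact him z hz
    obtain ⟨ε, hε, hb⟩ := Metric.isOpen_iff.1 h1 _ (Set.mem_image_of_mem f hI)
    have h3 : f Complex.I + ((ε / 2 : ℝ) : ℂ) * Complex.I ∈ Metric.ball (f Complex.I) ε := by
      rw [mem_ball_iff_norm, add_sub_cancel_left, norm_mul, Complex.norm_I, mul_one,
        Complex.norm_real, Real.norm_of_nonneg (by positivity)]
      linarith
    have h4 : (f Complex.I + ((ε / 2 : ℝ) : ℂ) * Complex.I).im = 0 := h2 (hb h3)
    rw [Complex.add_im, him _ hI, Complex.im_ofReal_mul, Complex.I_im] at h4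
    linarith

/-- A monotone map is squeezed between its values at scalar tuples. -/
theorem isConstant_of_scalarValue_eq {F : GradedMap.{u} k} (hF : RespectsIsometries F)
    (hFm : IsOperatorMonotone F) (hFp : MapsPosToPos F) {a : ℂ}
    (h : ∀ t : ℝ, 0 < t → scalarValue F t = a) : IsConstant F := by
  have him : a = (a.re : ℂ) := by
    have h1 := (hFp (FinSpace.{u} 1) _ (scalarTuple_mem_posCone one_pos)).isSelfAdjoint
    have h2 := inner_selfAdjoint_im h1 unitVec.{u}
    have h3 : (scalarValue F ((1 : ℝ) : ℂ)).im = 0 := h2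
    rw [h 1 one_pos] at h3
    exact Complex.ext rfl h3
  refine ⟨a.re, fun E _ _ _ X hX => ?_⟩
  obtain ⟨δ, hδ, h1⟩ := exists_scalarTuple_le hX
  obtain ⟨m, hm, h2⟩ := exists_le_scalarTuple hX
  have h3 := hFm E _ X (scalarTuple_mem_posCone hδ) hX h1
  have h4 := hFm E X _ hX (scalarTuple_mem_posCone hm) h2
  rw [hF.apply_scalarTuple hδ, h δ hδ, him] at h3
  rw [hF.apply_scalarTuple hm, h m hm, him] at h4
  exact le_antisymm h4 h3

theorem scalarValue_sliceFun_pos {𝓑 : PencilFamily.{u} k c₁ c₂}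
    {w : (BigSpace.{u} k c₁ c₂ →L[ℂ] BigSpace.{u} k c₁ c₂) →L[ℂ] ℂ} {F : GradedMap.{u} k}
    (hFp : MapsPosToPos F)
    (hc₁ : 0 < c₁) (hc : c₁ ≤ c₂)
    (hrep : ∀ (E : Type u) [NormedAddCommGroup E] [InnerProductSpace ℂ E] [CompleteSpace E]
      [FiniteDimensional ℂ E] (X : Fin k → E →L[ℂ] E), X ∈ posBox k E c₁ c₂ →
        F E X = 𝓑.sliceFun w E X) : 0 < (scalarValue (𝓑.sliceFun w) c₁).re := by
  have hbox : scalarTuple k (FinSpace.{u} 1) (c₁ : ℂ) ∈ posBox k _ c₁ c₂ := fun i =>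
    ⟨le_rfl, (real_smul_one_le_iff (isSelfAdjoint_real_smul_one c₂) _).2 fun x => by
      rw [smul_apply, one_apply_eq_self, inner_smul_right, Complex.re_ofReal_mul, re_inner_self]
      gcongr⟩
  have h1 := hFp (FinSpace.{u} 1) _ (scalarTuple_mem_posCone hc₁)
  obtain ⟨ε, hε, h2⟩ := (isStrictlyPos_iff h1.isSelfAdjoint).1 h1
  have h3 := h2 unitVec.{u}
  rw [norm_unitVec, hrep _ _ hbox] at h3
  have h4 : ε * 1 ^ 2 ≤ (scalarValue (𝓑.sliceFun w) c₁).re := h3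
  linarith

namespace Realization

variable {𝓑 : PencilFamily.{u} k c₁ c₂}
variable {w : (BigSpace.{u} k c₁ c₂ →L[ℂ] BigSpace.{u} k c₁ c₂) →L[ℂ] ℂ}

theorem analyticOnNhd_scalarValue (R : Realization 𝓑) :
    AnalyticOnNhd ℂ (scalarValue (𝓑.sliceFun w)) scalarDomain := by
  intro z hz
  have h1 : AnalyticAt ℂ (𝓑.sliceFun w (FinSpace.{u} 1)) (scalarTuple k _ z) :=
    R.analyticAt_sliceFun (exists_accretiveTuple
      (hz.imp scalarTuple_mem_rightHalf scalarTuple_mem_upperHalf))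
  have h2 : AnalyticAt ℂ (fun z : ℂ => scalarTuple k (FinSpace.{u} 1) z) z :=
    AnalyticAt.pi fun i => analyticAt_id.smul analyticAt_const
  exact ((innerSL ℂ unitVec.{u} ∘L ContinuousLinearMap.apply ℂ _ unitVec.{u}).analyticAt _).comp
    (h1.comp (f := fun z : ℂ => scalarTuple k (FinSpace.{u} 1) z) h2)

/-- If the imaginary part of the scalar function vanishes at `i`, then by the Harnack inequality the
scalar function is real on the upper half-plane, hence constant. -/
theorem exists_scalarValue_eq (R : Realization 𝓑) (hw : IsState w)
    (h : (scalarValue (𝓑.sliceFun w) Complex.I).im ≤ 0) :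
    ∃ a : ℂ, ∀ z ∈ scalarDomain, scalarValue (𝓑.sliceFun w) z = a := by
  have hI : scalarTuple k (FinSpace.{u} 1) Complex.I ∈ upperHalf k _ :=
    scalarTuple_mem_upperHalf (by simp)
  refine exists_eq_of_im_eq_zero R.analyticOnNhd_scalarValue fun z hz => ?_
  have hz' : scalarTuple k (FinSpace.{u} 1) z ∈ upperHalf k _ := scalarTuple_mem_upperHalf hz
  obtain ⟨C, hC, h1⟩ := R.exists_im_sliceFun_le hw hI hz'
  exact le_antisymm ((h1 unitVec.{u}).trans (mul_nonpos_of_nonneg_of_nonpos hC h))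
    (R.im_sliceFun_nonneg hw hz' _)

theorem isFree_rightHalf_sliceFun (R : Realization 𝓑) :
    IsFree (rightHalf k) (𝓑.sliceFun w) :=
  isFree_of_intertwine (fun _ _ _ _ _ _ _ _ U _ hX => unitaryConj_mem_rightHalf U hX)
    (fun _ _ _ _ _ _ _ _ _ _ hX hY => dirSum_mem_rightHalf hX hY)
    fun _ _ _ _ _ _ _ _ _ _ J hX hX' h => R.sliceFun_intertwine
      (exists_accretiveTuple (Or.inl hX)) (exists_accretiveTuple (Or.inl hX')) J h

theorem isFree_upperHalf_sliceFun (R : Realization 𝓑) :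
    IsFree (upperHalf k) (𝓑.sliceFun w) :=
  isFree_of_intertwine (fun _ _ _ _ _ _ _ _ U _ hX => unitaryConj_mem_upperHalf U hX)
    (fun _ _ _ _ _ _ _ _ _ _ hX hY => dirSum_mem_upperHalf hX hY)
    fun _ _ _ _ _ _ _ _ _ _ J hX hX' h => R.sliceFun_intertwine
      (exists_accretiveTuple (Or.inr hX)) (exists_accretiveTuple (Or.inr hX')) J h

variable {E : Type u} [NormedAddCommGroup E] [InnerProductSpace ℂ E] [CompleteSpace E]
variable {X : Fin k → E →L[ℂ] E}

theorem imaginaryPart_sliceFun_nonneg (R : Realization 𝓑) (hw : IsState w)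
    (hX : X ∈ upperHalf k E) :
    0 ≤ ((ℑ (𝓑.sliceFun w E X) : selfAdjoint (E →L[ℂ] E)) : E →L[ℂ] E) :=
  (nonneg_iff_re_inner (ℑ (𝓑.sliceFun w E X)).2).2 fun x => by
    rw [re_inner_imaginaryPart]
    exact R.im_sliceFun_nonneg hw hX x

theorem isStrictlyPos_imaginaryPart_sliceFun (R : Realization 𝓑) (hw : IsState w)
    (h : 0 < (scalarValue (𝓑.sliceFun w) Complex.I).im) (hX : X ∈ upperHalf k E) :
    IsStrictlyPos ((ℑ (𝓑.sliceFun w E X) : selfAdjoint (E →L[ℂ] E)) : E →L[ℂ] E) := by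
  have hI : (0 : ℝ) < Complex.I.im := by simp
  obtain ⟨C, hC, h1⟩ := R.exists_im_sliceFun_le hw hX (scalarTuple_mem_upperHalf hI)
  refine (isStrictlyPos_iff (ℑ (𝓑.sliceFun w E X)).2).2
    ⟨(scalarValue (𝓑.sliceFun w) Complex.I).im / (C + 1), by positivity, fun x => ?_⟩
  have h2 := h1 x
  have h3 := R.im_sliceFun_nonneg hw hX x
  rw [R.apply_scalarTuple (Or.inr hI), smul_apply, one_apply_eq_self, inner_smul_right,
    inner_self_eq_ofReal, Complex.im_mul_ofReal] at h2
  rw [re_inner_imaginaryPart, div_mul_eq_mul_div, div_le_iff₀ (by positivity)]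
  linarith

end Realization

end FreeLoewner

end

theorem proposition5p6 {k : ℕ} (hk : 0 < k) (F : FreeLoewner.GradedMap.{u} k)
    (hF_free : FreeLoewner.IsFree (FreeLoewner.posCone k) F)
    (hF_pos : FreeLoewner.MapsPosToPos F)
    (hF_mono : FreeLoewner.IsOperatorMonotone F)
    (c₁ c₂ : ℝ) (hc₁ : 0 < c₁) (hc₁₂ : c₁ < c₂)
    (𝓑 : FreeLoewner.PencilFamily.{u} k c₁ c₂) (h𝓑 : 𝓑.Supports F)
    (w : (FreeLoewner.BigSpace.{u} k c₁ c₂ →L[ℂ] FreeLoewner.BigSpace.{u} k c₁ c₂) →L[ℂ] ℂ)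
    (hw : FreeLoewner.IsState w)
    (hrep : ∀ (E : Type u) [NormedAddCommGroup E] [InnerProductSpace ℂ E] [CompleteSpace E]
      [FiniteDimensional ℂ E] (X : Fin k → E →L[ℂ] E), X ∈ FreeLoewner.posBox k E c₁ c₂ →
        F E X = 𝓑.sliceFun w E X) :
    -- the formula is defined on both poly-halfspaces
    (∀ (E : Type u) [NormedAddCommGroup E] [InnerProductSpace ℂ E] [CompleteSpace E]
      (X : Fin k → E →L[ℂ] E), X ∈ FreeLoewner.rightHalf k E ∪ FreeLoewner.upperHalf k E →
        𝓑.PsiExists E X) ∧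
    -- it is a free function on each of them
    FreeLoewner.IsFree (FreeLoewner.rightHalf k) (𝓑.sliceFun w) ∧
    FreeLoewner.IsFree (FreeLoewner.upperHalf k) (𝓑.sliceFun w) ∧
    -- it is analytic
    (∀ (E : Type u) [NormedAddCommGroup E] [InnerProductSpace ℂ E] [CompleteSpace E],
      AnalyticOnNhd ℂ (𝓑.sliceFun w E)
        (FreeLoewner.rightHalf k E ∪ FreeLoewner.upperHalf k E)) ∧
    -- it extends `F`
    (∀ (E : Type u) [NormedAddCommGroup E] [InnerProductSpace ℂ E] [CompleteSpace E]
      [FiniteDimensional ℂ E] (X : Fin k → E →L[ℂ] E), X ∈ FreeLoewner.posCone k E →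
        𝓑.sliceFun w E X = F E X) ∧
    -- on the upper poly-halfspace the imaginary part is nonnegative, and it is strictly positive
    -- unless `F` is constant
    (∀ (E : Type u) [NormedAddCommGroup E] [InnerProductSpace ℂ E] [CompleteSpace E]
      (X : Fin k → E →L[ℂ] E), X ∈ FreeLoewner.upperHalf k E →
        0 ≤ ((ℑ (𝓑.sliceFun w E X) : selfAdjoint (E →L[ℂ] E)) : E →L[ℂ] E) ∧
        (¬ FreeLoewner.IsConstant F →
          FreeLoewner.IsStrictlyPos
            ((ℑ (𝓑.sliceFun w E X) : selfAdjoint (E →L[ℂ] E)) : E →L[ℂ] E))) ∧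
    -- on the strictly positive tuples it is positive, operator monotone and operator concave
    FreeLoewner.MapsPosToPos (𝓑.sliceFun w) ∧
    FreeLoewner.IsOperatorMonotone (𝓑.sliceFun w) ∧
    FreeLoewner.IsOperatorConcave (𝓑.sliceFun w) := by
  obtain ⟨R⟩ := h𝓑.nonempty_realization
  have hFr := hF_free.respectsIsometries
  have hc₂ : 0 < c₁ + c₂ := by linarith
  have hval : 0 < (FreeLoewner.scalarValue (𝓑.sliceFun w) c₁).re :=
    FreeLoewner.scalarValue_sliceFun_pos hF_pos hc₁ hc₁₂.le hrep
  have hpos : FreeLoewner.MapsPosToPos (𝓑.sliceFun w) := fun E _ _ _ X hX =>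
    R.isStrictlyPos_sliceFun hw hc₁ hval hX
  have hext : ∀ (E : Type u) [NormedAddCommGroup E] [InnerProductSpace ℂ E] [CompleteSpace E]
      [FiniteDimensional ℂ E] (X : Fin k → E →L[ℂ] E), X ∈ FreeLoewner.posCone k E →
        𝓑.sliceFun w E X = F E X := fun E _ _ _ _ X hX =>
    (FreeLoewner.eqOn_posCone hFr hF_mono hF_pos hpos
      (fun Z hZ => R.analyticAt_sliceFun (FreeLoewner.Realization.exists_accretiveTuple_posCone hZ))
      (FreeLoewner.scalarTuple_mem_posCone (half_pos hc₂))
      ((FreeLoewner.eventually_mem_posBox hc₁₂).mono fun W hW => hrep E W hW) hX).symm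
  refine ⟨fun E _ _ _ X hX => ?_, R.isFree_rightHalf_sliceFun, R.isFree_upperHalf_sliceFun,
    fun E _ _ _ X hX => R.analyticAt_sliceFun (FreeLoewner.exists_accretiveTuple hX),
    hext, fun E _ _ _ X hX =>
      ⟨R.imaginaryPart_sliceFun_nonneg hw hX, fun hconst =>
        R.isStrictlyPos_imaginaryPart_sliceFun hw ?_ hX⟩, hpos,
    R.isOperatorMonotone_sliceFun hw, R.isOperatorConcave_sliceFun hw⟩
  · obtain ⟨c, δ, h⟩ := FreeLoewner.exists_accretiveTuple hX
    exact R.psiExists h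
  · by_contra hle
    obtain ⟨a, ha⟩ := R.exists_scalarValue_eq hw (not_lt.1 hle)
    refine hconst (FreeLoewner.isConstant_of_scalarValue_eq hFr hF_mono hF_pos (a := a)
      fun t ht => ?_)
    rw [← ha t (Or.inl (by simpa using ht)), FreeLoewner.scalarValue, FreeLoewner.scalarValue,
      hext _ _ (FreeLoewner.scalarTuple_mem_posCone ht)]
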